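/- \textbf{Problem (predecessor in shrinking nested sets, PISNS).} An instance consists of a positive integer $N$ and nonempty sets $S_1,\dots,S_k\subseteq[1,N]$ of integers ($k\ge 1$) for which there exist integers $1\le n_1\le n_2\le\dots\le n_k$ such that $S_i\subseteq[n_i,N]$ for all $i\le k$ and $S_i\cap[n_{i+1},N]\subseteq S_{i+1}$ for all $i<k$. The input is $N$, $k$, the cardinalities $|S_i|$, and for every $i$ a list of the elements of $S_i$ in arbitrary order (the $n_i$ are not given). The instance is to be preprocessed so that, given $i\in\{1,\dots,k\}$ and $x\in[1,N]$, one can return the rank in $S_i$ of the predecessor of $x$ (the largest element of $S_i$ that is at most $x$), i.e. $|\{y\in S_i: y\le x\}|$, which is $0$ if there is no predecessor. \textbf{Model.} Word-RAM with words of $\mathcal W$ bits: unit-cost arithmetic modulo $2^{\mathcal W}$, bitwise operations, shifts, comparisons and indirect memory access. A universal table answering $\mathtt{rank}$ (number of $1$ bits among the first $j$ bits of a word) and $\mathtt{select}$ (position of the $j$-th $1$ bit of a word) in unit time is available at no cost. Words are long enough to address the memory used: $\mathcal W\ge\log_2\bigl(N+\sum_i|S_i|\bigr)+O(1)$. Space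 is measured in words, time is deterministic worst-case. \textbf{Lemma.} For every constant $t_2\ge 1$, PISNS can be solved with $\mathcal O\bigl(N/\mathcal W^{t_2}+\sum_i|S_i|\bigr)$ preprocessing time, $\mathcal O\bigl(N/\mathcal W^{t_2}+\sum_i|S_i|\bigr)$ space (including the input and the working space of the preprocessing) and $\mathcal O(1)$ query time. Precisely: there are a preprocessing program, a query program and a constant $c$, all depending only on $t_2$, such that for every word size $\mathcal W$ and every instance with $c\,(N+\sum_i|S_i|)\le 2^{\mathcal W}$, on a machine whose memory has $\lfloor c\,(N/\mathcal W^{t_2}+\sum_i|S_i|)\rfloor$ words and is zero outside the input, the preprocessing halts within $c\,(N/\mathcal W^{t_2}+\sum_i|S_i|)$ steps, and afterwards every query $(i,x)$ is answered correctly within $c$ steps without changing the memory. -/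

import Mathlib

/-! ## The word-RAM

Words are natural numbers below `2 ^ W`, where `W` is the word size in bits.  A program uses the
finitely many registers named in its text and a memory of words addressed indirectly. -/

namespace WordRAM

/-- `rank v j`: the number of 1 bits of the word `v` among its first `j` bits
(least significant bit first; the bit at position `p ≥ 1` is `v.testBit (p - 1)`). -/
def rank (v j : ℕ) : ℕ := Nat.count (fun b => v.testBit b = true) j

/-- `select W v j`: the position (counted from `1`) of the `j`-th 1 bit of the `W`-bit word `v`,
and `0` if there is no such bit. -/
noncomputable def select (W v j : ℕ) : ℕ :=
  if 1 ≤ j ∧ j ≤ rank v W then Nat.nth (fun b => v.testBit b = true) (j - 1) + 1 else 0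

/-- The binary word instructions: arithmetic modulo `2 ^ W` (with `a / 0 = 0`, `a mod 0 = a`),
bitwise operations, shifts, comparisons (with value `1` or `0`), and `rank` / `select` on a single
word.  The last two stand for the look-ups in the universal table that the model supplies. -/
inductive Op
  | add | sub | mul | div | mod
  | and | or | xor | shl | shr
  | lt | eq
  | rank | select

/-- The value of an instruction on two `W`-bit words. -/
noncomputable def Op.eval (W : ℕ) : Op → ℕ → ℕ → ℕ
  | .add, a, b => (a + b) % 2 ^ W
  | .sub, a, b => (a + (2 ^ W - b)) % 2 ^ W
  | .mul, a, b => (a * b) % 2 ^ W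
  | .div, a, b => a / b
  | .mod, a, b => a % b
  | .and, a, b => a &&& b
  | .or, a, b => a ||| b
  | .xor, a, b => a ^^^ b
  | .shl, a, b => (a <<< b) % 2 ^ W
  | .shr, a, b => a >>> b
  | .lt, a, b => if a < b then 1 else 0
  | .eq, a, b => if a = b then 1 else 0
  | .rank, a, b => WordRAM.rank a b
  | .select, a, b => WordRAM.select W a b

/-- Expressions over registers. -/
inductive Expr
  | const (c : ℕ)
  | wordSize
  | reg (r : ℕ)
  | bin (o : Op) (e₁ e₂ : Expr)

/-- The value of an expression under the register contents `ρ`. -/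
noncomputable def Expr.eval (W : ℕ) (ρ : ℕ → ℕ) : Expr → ℕ
  | .const c => c % 2 ^ W
  | .wordSize => W
  | .reg r => ρ r
  | .bin o e₁ e₂ => o.eval W (e₁.eval W ρ) (e₂.eval W ρ)

/-- The number of steps needed to evaluate an expression: one for each node. -/
def Expr.cost : Expr → ℕ
  | .const _ => 1
  | .wordSize => 1
  | .reg _ => 1
  | .bin _ e₁ e₂ => e₁.cost + e₂.cost + 1

/-- Programs. -/
inductive Stmt
  | skip
  /-- put the value of `e` into register `r` -/
  | assign (r : ℕ) (e : Expr)
  /-- put the content of the memory cell with address `a` into register `r` -/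
  | load (r : ℕ) (a : Expr)
  /-- put the value of `e` into the memory cell with address `a` -/
  | store (a e : Expr)
  | seq (s₁ s₂ : Stmt)
  /-- run `s₁` if the value of `e` is nonzero, and `s₂` otherwise -/
  | cond (e : Expr) (s₁ s₂ : Stmt)
  /-- run `s` as long as the value of `e` is nonzero -/
  | loop (e : Expr) (s : Stmt)

/-- A configuration: the contents of the registers and of the memory. -/
structure State where
  regs : ℕ → ℕ
  mem : ℕ → ℕ

/-- `Exec W M s σ T σ'`: on a machine with words of `W` bits and a memory of `M` words (the cells
`0, …, M - 1`), the program `s` started in `σ` halts in `σ'` after exactly `T` steps.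
There is no transition for an access to a cell outside the memory. -/
inductive Exec (W M : ℕ) : Stmt → State → ℕ → State → Prop
  | skip (σ : State) : Exec W M .skip σ 1 σ
  | assign (r : ℕ) (e : Expr) (σ : State) :
      Exec W M (.assign r e) σ (e.cost + 1)
        ⟨Function.update σ.regs r (e.eval W σ.regs), σ.mem⟩
  | load (r : ℕ) (a : Expr) (σ : State) (h : a.eval W σ.regs < M) :
      Exec W M (.load r a) σ (a.cost + 1)
        ⟨Function.update σ.regs r (σ.mem (a.eval W σ.regs)), σ.mem⟩
  | store (a e : Expr) (σ : State) (h : a.eval W σ.regs < M) :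
      Exec W M (.store a e) σ (a.cost + e.cost + 1)
        ⟨σ.regs, Function.update σ.mem (a.eval W σ.regs) (e.eval W σ.regs)⟩
  | seq {s₁ s₂ : Stmt} {σ σ₁ σ₂ : State} {T₁ T₂ : ℕ} :
      Exec W M s₁ σ T₁ σ₁ → Exec W M s₂ σ₁ T₂ σ₂ → Exec W M (.seq s₁ s₂) σ (T₁ + T₂) σ₂
  | cond_true {e : Expr} {s₁ s₂ : Stmt} {σ σ' : State} {T : ℕ} :
      e.eval W σ.regs ≠ 0 → Exec W M s₁ σ T σ' →
      Exec W M (.cond e s₁ s₂) σ (e.cost + 1 + T) σ'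
  | cond_false {e : Expr} {s₁ s₂ : Stmt} {σ σ' : State} {T : ℕ} :
      e.eval W σ.regs = 0 → Exec W M s₂ σ T σ' →
      Exec W M (.cond e s₁ s₂) σ (e.cost + 1 + T) σ'
  | loop_done {e : Expr} {s : Stmt} {σ : State} :
      e.eval W σ.regs = 0 → Exec W M (.loop e s) σ (e.cost + 1) σ
  | loop_step {e : Expr} {s : Stmt} {σ σ₁ σ₂ : State} {T₁ T₂ : ℕ} :
      e.eval W σ.regs ≠ 0 → Exec W M s σ T₁ σ₁ → Exec W M (.loop e s) σ₁ T₂ σ₂ →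
      Exec W M (.loop e s) σ (e.cost + 1 + T₁ + T₂) σ₂

end WordRAM

/-! ## Predecessor in shrinking nested sets -/

namespace PISNS

/-- `S₁, …, S_k` (with `k ≥ 1`) are nonempty, and there are `1 ≤ n₁ ≤ n₂ ≤ … ≤ n_k` with
`S_i ⊆ [n_i, N]` and `S_i ∩ [n_{i+1}, N] ⊆ S_{i+1}`. -/
structure IsInstance {k : ℕ} (N : ℕ) (S : Fin k → Finset ℕ) : Prop where
  pos : 0 < k
  nonempty : ∀ i, (S i).Nonempty
  shrinking : ∃ n : Fin k → ℕ, Monotone n ∧ (∀ i, 1 ≤ n i) ∧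
    (∀ i, S i ⊆ Finset.Icc (n i) N) ∧
    (∀ i j : Fin k, (i : ℕ) + 1 = (j : ℕ) → S i ∩ Finset.Icc (n j) N ⊆ S j)

/-- `L` lists the elements of every `S i`, without repetition and in an arbitrary order. -/
def Lists {k : ℕ} (L : Fin k → List ℕ) (S : Fin k → Finset ℕ) : Prop :=
  ∀ i, (L i).Nodup ∧ (L i).toFinset = S i

/-- The input as a sequence of words: `N`, `k`, the `k` cardinalities, and then the elements of
the first set, of the second set, and so on. -/
def inputWords {k : ℕ} (N : ℕ) (L : Fin k → List ℕ) : List ℕ :=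
  N :: k :: (List.ofFn fun i => (L i).length) ++ (List.ofFn L).flatten

/-- The configuration before the preprocessing: the input occupies the first memory cells, all
other cells and all registers are `0`. -/
def inputState {k : ℕ} (N : ℕ) (L : Fin k → List ℕ) : WordRAM.State :=
  ⟨fun _ => 0, fun a => (inputWords N L).getD a 0⟩

/-- The configuration before a query: register `0` holds the index `i` of the set (counted from
`0`), register `1` the value `x`, every other register `0`, and the memory is `mem`. -/
def queryState (mem : ℕ → ℕ) (i x : ℕ) : WordRAM.State :=
  ⟨Function.update (Function.update (fun _ => 0) 0 i) 1 x, mem⟩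

/-- The rank of the predecessor of `x` in `A`, the largest element that is at most `x`: the
number of elements of `A` that are at most `x` (`0` if and only if `x` has no predecessor). -/
def predRank (A : Finset ℕ) (x : ℕ) : ℕ := (A.filter (· ≤ x)).card

/-- The quantity `N / W ^ t + ∑ |S_i|`. -/
noncomputable def bound {k : ℕ} (t : ℝ) (W N : ℕ) (S : Fin k → Finset ℕ) : ℝ :=
  (N : ℝ) / (W : ℝ) ^ t + ∑ i, ((S i).card : ℝ)

end PISNS

/-! Cut the universe into `M = N / B + 1` blocks of length `B = W ^ tt`, where `tt = ⌈t⌉₊ + 1`.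
Suppose that a set with index at most `i` meets the block `b` in a number `x`, and that a set with
index `j ≥ i` has an element `y` in a block before `b`. Then `n_j ≤ y ≤ x`, so the nesting carries
`x` into every set up to `j`, in particular into the set `i`. Let `death b` be one more than the
last set whose first block precedes `b`, and let `birth b` be the first set that meets `b`, cut off
at `death b`. Every set in `[birth b, death b)` meets `b` (`Family.meets_of_alive`). Conversely, a
set `i` whose first block precedes `b` meets `b` exactly when `birth b ≤ i` (`Family.birth_le_iff`).
These lifetimes have total length at most `n = ∑ |S_i|` (`Family.life_M_le`), and `death` is
monotone in `b`.

A query whose block `b` is not beyond the first block of its set needs one comparison. Otherwise it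
needs the first block `s ≥ b` born by time `i`, which is `next b i`; a sentinel block `M`, alive all
the time, makes it exist. It is found as in level-ancestor structures. Each block has jump pointers
to the next block born `2 ^ j` earlier, and a ladder of at most the length of its lifetime. After a
jump by the largest power of two that does not overshoot `i`, monotonicity of `death` makes the
lifetime of the block reached at least as long as the jump, so its ladder covers the rest
(`Family.next_jump`, `find_wp`). The jump pointers take about `(N / B) * log k ≤ N / W ^ ⌈t⌉₊`
words, which is why `tt` exceeds `⌈t⌉₊` by one. The ladders take `O(n + k)` words.

The pairs of a set and a block that it meets receive numbers below `2 * n` in increasing order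
(`Family.top_spec`). Each is the root of a trie with `tt` levels over the base-`W` digits inside the
block; a node is one word, and `rank` numbers the children of all nodes consecutively
(`descend_spec`). At the bottom every node holds one element, so the number reached by a query
counts the elements of the earlier sets and the smaller ones of its own set (`card_descend`).
Subtracting the former gives the rank.

The algorithms are verified in a small language with arrays and exact arithmetic on natural numbers.
`Run.exec` transfers its runs, with the same number of steps, to the word-RAM. -/

namespace WordRAM

/-! ## Arithmetic without overflow -/

/-- The value of an instruction over the natural numbers, without reduction modulo `2 ^ W`. -/
noncomputable def Op.nat (W : ℕ) : Op → ℕ → ℕ → ℕ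
  | .add, a, b => a + b
  | .sub, a, b => a - b
  | .mul, a, b => a * b
  | .shl, a, b => a * 2 ^ b
  | o, a, b => o.eval W a b

/-- The number of words. -/
def cap (W : ℕ) : ℕ := 2 ^ W

/-- The instruction does not overflow on the given arguments. -/
def Op.Fits (W : ℕ) : Op → ℕ → ℕ → Prop
  | .add, a, b => a + b < cap W
  | .sub, a, b => b ≤ a ∧ a < cap W
  | .mul, a, b => a * b < cap W
  | .shl, a, b => a * 2 ^ b < cap W
  | _, _, _ => True

/-- The value of an expression over the natural numbers. -/
noncomputable def Expr.nat (W : ℕ) (ρ : ℕ → ℕ) : Expr → ℕ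
  | .const c => c
  | .wordSize => W
  | .reg r => ρ r
  | .bin o e₁ e₂ => o.nat W (e₁.nat W ρ) (e₂.nat W ρ)

/-- No instruction of the expression overflows. -/
def Expr.Fits (W : ℕ) (ρ : ℕ → ℕ) : Expr → Prop
  | .const c => c < cap W
  | .wordSize => True
  | .reg _ => True
  | .bin o e₁ e₂ => e₁.Fits W ρ ∧ e₂.Fits W ρ ∧ o.Fits W (e₁.nat W ρ) (e₂.nat W ρ)

theorem Op.eval_eq_nat {W : ℕ} {o : Op} {a b : ℕ} (h : o.Fits W a b) :
    o.eval W a b = o.nat W a b := by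
  cases o <;> simp only [Op.Fits, Op.eval, Op.nat, cap] at *
  · exact Nat.mod_eq_of_lt h
  · obtain ⟨h1, h2⟩ := h
    have : a + (2 ^ W - b) = (a - b) + 2 ^ W := by omega
    rw [this, Nat.add_mod_right, Nat.mod_eq_of_lt (by omega)]
  · exact Nat.mod_eq_of_lt h
  · rw [Nat.shiftLeft_eq]; exact Nat.mod_eq_of_lt h

theorem Expr.eval_eq_nat {W : ℕ} {ρ : ℕ → ℕ} {e : Expr} (h : e.Fits W ρ) :
    e.eval W ρ = e.nat W ρ := by
  induction e with
  | const c => exact Nat.mod_eq_of_lt h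
  | wordSize => rfl
  | reg r => rfl
  | bin o e₁ e₂ h₁ h₂ =>
    obtain ⟨k₁, k₂, k₃⟩ := h
    simp only [Expr.eval, Expr.nat, h₁ k₁, h₂ k₂]
    exact Op.eval_eq_nat k₃

instance : Add Expr := ⟨.bin .add⟩
instance : Sub Expr := ⟨.bin .sub⟩
instance : Mul Expr := ⟨.bin .mul⟩
instance : Div Expr := ⟨.bin .div⟩

section simpLemmas
variable (W : ℕ) (ρ : ℕ → ℕ) (a b : Expr) (c : ℕ)

@[simp] theorem Expr.nat_const : (Expr.const c).nat W ρ = c := rfl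
@[simp] theorem Expr.nat_wordSize : Expr.wordSize.nat W ρ = W := rfl
@[simp] theorem Expr.nat_reg : (Expr.reg c).nat W ρ = ρ c := rfl
@[simp] theorem Expr.nat_add : (a + b).nat W ρ = a.nat W ρ + b.nat W ρ := rfl
@[simp] theorem Expr.nat_sub : (a - b).nat W ρ = a.nat W ρ - b.nat W ρ := rfl
@[simp] theorem Expr.nat_mul : (a * b).nat W ρ = a.nat W ρ * b.nat W ρ := rfl
@[simp] theorem Expr.nat_div : (a / b).nat W ρ = a.nat W ρ / b.nat W ρ := rfl
@[simp] theorem Expr.nat_mod :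
    (Expr.bin .mod a b).nat W ρ = a.nat W ρ % b.nat W ρ := rfl
@[simp] theorem Expr.nat_and :
    (Expr.bin .and a b).nat W ρ = a.nat W ρ &&& b.nat W ρ := rfl
@[simp] theorem Expr.nat_or :
    (Expr.bin .or a b).nat W ρ = a.nat W ρ ||| b.nat W ρ := rfl
@[simp] theorem Expr.nat_shl :
    (Expr.bin .shl a b).nat W ρ = a.nat W ρ * 2 ^ b.nat W ρ := rfl
@[simp] theorem Expr.nat_shr :
    (Expr.bin .shr a b).nat W ρ = a.nat W ρ >>> b.nat W ρ := rfl
@[simp] theorem Expr.nat_lt :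
    (Expr.bin .lt a b).nat W ρ = if a.nat W ρ < b.nat W ρ then 1 else 0 := rfl
@[simp] theorem Expr.nat_eq :
    (Expr.bin .eq a b).nat W ρ = if a.nat W ρ = b.nat W ρ then 1 else 0 := rfl
@[simp] theorem Expr.nat_rank :
    (Expr.bin .rank a b).nat W ρ = WordRAM.rank (a.nat W ρ) (b.nat W ρ) := rfl
@[simp] theorem Expr.nat_select :
    (Expr.bin .select a b).nat W ρ = WordRAM.select W (a.nat W ρ) (b.nat W ρ) := rfl

@[simp] theorem Expr.fits_const : (Expr.const c).Fits W ρ ↔ c < cap W := Iff.rfl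
@[simp] theorem Expr.fits_wordSize : Expr.wordSize.Fits W ρ := trivial
@[simp] theorem Expr.fits_reg : (Expr.reg c).Fits W ρ := trivial
@[simp] theorem Expr.fits_add : (a + b).Fits W ρ ↔
    a.Fits W ρ ∧ b.Fits W ρ ∧ a.nat W ρ + b.nat W ρ < cap W := Iff.rfl
@[simp] theorem Expr.fits_sub : (a - b).Fits W ρ ↔
    a.Fits W ρ ∧ b.Fits W ρ ∧ b.nat W ρ ≤ a.nat W ρ ∧ a.nat W ρ < cap W := Iff.rfl
@[simp] theorem Expr.fits_mul : (a * b).Fits W ρ ↔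
    a.Fits W ρ ∧ b.Fits W ρ ∧ a.nat W ρ * b.nat W ρ < cap W := Iff.rfl
@[simp] theorem Expr.fits_div : (a / b).Fits W ρ ↔ a.Fits W ρ ∧ b.Fits W ρ := by
  change _ ∧ _ ∧ True ↔ _; simp
@[simp] theorem Expr.fits_shl : (Expr.bin .shl a b).Fits W ρ ↔
    a.Fits W ρ ∧ b.Fits W ρ ∧ a.nat W ρ * 2 ^ b.nat W ρ < cap W := Iff.rfl
@[simp] theorem Expr.fits_mod : (Expr.bin .mod a b).Fits W ρ ↔ a.Fits W ρ ∧ b.Fits W ρ := by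
  change _ ∧ _ ∧ True ↔ _; simp
@[simp] theorem Expr.fits_and : (Expr.bin .and a b).Fits W ρ ↔ a.Fits W ρ ∧ b.Fits W ρ := by
  change _ ∧ _ ∧ True ↔ _; simp
@[simp] theorem Expr.fits_or : (Expr.bin .or a b).Fits W ρ ↔ a.Fits W ρ ∧ b.Fits W ρ := by
  change _ ∧ _ ∧ True ↔ _; simp
@[simp] theorem Expr.fits_shr : (Expr.bin .shr a b).Fits W ρ ↔ a.Fits W ρ ∧ b.Fits W ρ := by
  change _ ∧ _ ∧ True ↔ _; simp
@[simp] theorem Expr.fits_lt : (Expr.bin .lt a b).Fits W ρ ↔ a.Fits W ρ ∧ b.Fits W ρ := by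
  change _ ∧ _ ∧ True ↔ _; simp
@[simp] theorem Expr.fits_eq : (Expr.bin .eq a b).Fits W ρ ↔ a.Fits W ρ ∧ b.Fits W ρ := by
  change _ ∧ _ ∧ True ↔ _; simp
@[simp] theorem Expr.fits_rank : (Expr.bin .rank a b).Fits W ρ ↔ a.Fits W ρ ∧ b.Fits W ρ := by
  change _ ∧ _ ∧ True ↔ _; simp
@[simp] theorem Expr.fits_select : (Expr.bin .select a b).Fits W ρ ↔ a.Fits W ρ ∧ b.Fits W ρ := by
  change _ ∧ _ ∧ True ↔ _; simp

end simpLemmas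

/-! ## Programs with arrays

The memory behind a read-only region of `H` cells is divided into `C` interleaved arrays of
length `X`; the cell with index `i` of array `q` has the address `H + C * i + q`.  Register `100`
holds `H`. -/

/-- The division of the memory into a read-only region and arrays. -/
structure Layout where
  W : ℕ
  H : ℕ
  C : ℕ
  X : ℕ
  inp : ℕ → ℕ

/-- The contents of the registers and of the arrays. -/
structure Store where
  regs : ℕ → ℕ
  arr : ℕ → ℕ → ℕ

/-- Put a value into a register. -/
def Store.put (σ : Store) (r v : ℕ) : Store := ⟨Function.update σ.regs r v, σ.arr⟩

/-- Put a value into a cell of an array. -/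
def Store.write (σ : Store) (q i v : ℕ) : Store :=
  ⟨σ.regs, Function.update σ.arr q (Function.update (σ.arr q) i v)⟩

@[simp] theorem Store.put_regs (σ : Store) (r v r' : ℕ) :
    (σ.put r v).regs r' = if r' = r then v else σ.regs r' := by
  simp [Store.put, Function.update_apply]

@[simp] theorem Store.put_arr (σ : Store) (r v : ℕ) : (σ.put r v).arr = σ.arr := rfl

@[simp] theorem Store.write_regs (σ : Store) (q i v : ℕ) : (σ.write q i v).regs = σ.regs := rfl

theorem Store.write_arr (σ : Store) (q i v q' i' : ℕ) :
    (σ.write q i v).arr q' i' = if q' = q ∧ i' = i then v else σ.arr q' i' := by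
  unfold Store.write
  by_cases h : q' = q
  · subst h; simp [Function.update_apply]
  · simp [h]

@[simp] theorem Store.write_arr_self (σ : Store) (q i v : ℕ) :
    (σ.write q i v).arr q = Function.update (σ.arr q) i v := by
  simp [Store.write]

@[simp] theorem Store.write_arr_ne (σ : Store) {q q' : ℕ} (i v : ℕ) (h : (q' == q) = false) :
    (σ.write q i v).arr q' = σ.arr q' := by
  simp only [beq_eq_false_iff_ne] at h
  simp [Store.write, h]

theorem update_upto {f g : ℕ → ℕ} {i v : ℕ} (h : ∀ j < i, f j = g j) (hv : v = g i) :
    ∀ j < i + 1, Function.update f i v j = g j := by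
  intro j hj
  by_cases hji : j = i
  · rw [hji, Function.update_self, hv]
  · rw [Function.update_of_ne hji]; exact h j (by omega)

/-- Programs with arrays. -/
inductive Cmd
  | skip
  | set (r : ℕ) (e : Expr)
  | ld (r q : ℕ) (e : Expr)
  | st (q : ℕ) (e e' : Expr)
  | inp (r : ℕ) (e : Expr)
  | seq (a b : Cmd)
  | ite (e : Expr) (a b : Cmd)
  | whl (e : Expr) (a : Cmd)

infixr:60 " ;; " => Cmd.seq

/-- The expression for the address of an array cell. -/
def cell (C q : ℕ) (e : Expr) : Expr := .reg 100 + (.const C * e + .const q)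

/-- Translation into word-RAM programs. -/
def Cmd.toStmt (C : ℕ) : Cmd → Stmt
  | .skip => .skip
  | .set r e => .assign r e
  | .ld r q e => .load r (cell C q e)
  | .st q e e' => .store (cell C q e) e'
  | .inp r e => .load r e
  | .seq a b => .seq (a.toStmt C) (b.toStmt C)
  | .ite e a b => .cond e (a.toStmt C) (b.toStmt C)
  | .whl e a => .loop e (a.toStmt C)

/-- `Run G c σ T σ'`: the program `c` started in `σ` halts in `σ'` after `T` steps, without
overflow and within the bounds of the arrays. -/
inductive Run (G : Layout) : Cmd → Store → ℕ → Store → Prop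
  | skip (σ) : Run G .skip σ 1 σ
  | set (r e) (σ : Store) (h : e.Fits G.W σ.regs) :
      Run G (.set r e) σ (e.cost + 1) (σ.put r (e.nat G.W σ.regs))
  | ld (r q e) (σ : Store) (h : e.Fits G.W σ.regs) (hi : e.nat G.W σ.regs < G.X) (hq : q < G.C)
      (hH : σ.regs 100 = G.H) :
      Run G (.ld r q e) σ ((cell G.C q e).cost + 1) (σ.put r (σ.arr q (e.nat G.W σ.regs)))
  | st (q e e') (σ : Store) (h : e.Fits G.W σ.regs) (h' : e'.Fits G.W σ.regs)
      (hi : e.nat G.W σ.regs < G.X) (hq : q < G.C) (hH : σ.regs 100 = G.H) :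
      Run G (.st q e e') σ ((cell G.C q e).cost + e'.cost + 1)
        (σ.write q (e.nat G.W σ.regs) (e'.nat G.W σ.regs))
  | inp (r e) (σ : Store) (h : e.Fits G.W σ.regs) (hi : e.nat G.W σ.regs < G.H) :
      Run G (.inp r e) σ (e.cost + 1) (σ.put r (G.inp (e.nat G.W σ.regs)))
  | seq {a b σ σ₁ σ₂ T₁ T₂} : Run G a σ T₁ σ₁ → Run G b σ₁ T₂ σ₂ → Run G (.seq a b) σ (T₁ + T₂) σ₂
  | ite_true {e : Expr} {a b} {σ σ' : Store} {T} (h : e.Fits G.W σ.regs)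
      (he : e.nat G.W σ.regs ≠ 0) : Run G a σ T σ' → Run G (.ite e a b) σ (e.cost + 1 + T) σ'
  | ite_false {e : Expr} {a b} {σ σ' : Store} {T} (h : e.Fits G.W σ.regs)
      (he : e.nat G.W σ.regs = 0) : Run G b σ T σ' → Run G (.ite e a b) σ (e.cost + 1 + T) σ'
  | whl_done {e : Expr} {a} {σ : Store} (h : e.Fits G.W σ.regs) (he : e.nat G.W σ.regs = 0) :
      Run G (.whl e a) σ (e.cost + 1) σ
  | whl_step {e : Expr} {a} {σ σ₁ σ₂ : Store} {T₁ T₂} (h : e.Fits G.W σ.regs)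
      (he : e.nat G.W σ.regs ≠ 0) : Run G a σ T₁ σ₁ → Run G (.whl e a) σ₁ T₂ σ₂ →
      Run G (.whl e a) σ (e.cost + 1 + T₁ + T₂) σ₂

/-- The memory `m` holds the read-only region and the arrays `A`. -/
def Represents (G : Layout) (m : ℕ → ℕ) (A : ℕ → ℕ → ℕ) : Prop :=
  (∀ a < G.H, m a = G.inp a) ∧ ∀ q < G.C, ∀ i < G.X, m (G.H + (G.C * i + q)) = A q i

theorem cell_eval {G : Layout} {cells q : ℕ} {e : Expr} {ρ : ℕ → ℕ} (hc : G.H + G.C * G.X ≤ cells)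
    (hW : cells ≤ cap G.W) (h0 : 0 < G.H) (h : e.Fits G.W ρ)
    (hi : e.nat G.W ρ < G.X) (hq : q < G.C) (hH : ρ 100 = G.H) :
    (cell G.C q e).eval G.W ρ = G.H + (G.C * e.nat G.W ρ + q) ∧
      G.H + (G.C * e.nat G.W ρ + q) < cells := by
  have h1 : G.C * e.nat G.W ρ + q < G.C * G.X := by
    calc _ < G.C * e.nat G.W ρ + G.C := by omega
      _ = G.C * (e.nat G.W ρ + 1) := by ring
      _ ≤ _ := Nat.mul_le_mul_left _ hi
  have h2 : G.C ≤ G.C * G.X := Nat.le_mul_of_pos_right _ (by omega)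
  refine ⟨?_, by omega⟩
  rw [Expr.eval_eq_nat]
  · simp [cell, hH]
  · simp only [cell, Expr.fits_add, Expr.fits_mul, Expr.fits_const, Expr.fits_reg, Expr.nat_add,
      Expr.nat_mul, Expr.nat_const, Expr.nat_reg, hH, h]
    refine ⟨trivial, ⟨⟨by omega, trivial, by omega⟩, by omega, by omega⟩, by omega⟩

/-- An address `H + (C * i + q)` with `q < C` determines `i` and `q` by division with remainder, so
a write disturbs no other array cell and nothing below `H`. -/
theorem Represents.write {G : Layout} {m : ℕ → ℕ} {σ : Store} (hm : Represents G m σ.arr)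
    {q i v : ℕ} (hq : q < G.C) :
    Represents G (Function.update m (G.H + (G.C * i + q)) v) (σ.write q i v).arr := by
  refine ⟨fun a ha => ?_, fun q' hq' i' hi' => ?_⟩
  · rw [Function.update_of_ne (by omega)]; exact hm.1 a ha
  · rw [Store.write_arr]
    split_ifs with h
    · rw [h.1, h.2, Function.update_self]
    · rw [Function.update_of_ne]
      · exact hm.2 q' hq' i' hi'
      · intro h'
        apply h
        have h' : G.C * i' + q' = G.C * i + q := by omega
        have hi : i' = i := by
          have := congrArg (· / G.C) h'
          simpa [Nat.mul_add_div (show 0 < G.C by omega), Nat.div_eq_of_lt hq,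
            Nat.div_eq_of_lt hq'] using this
        subst hi
        exact ⟨by omega, rfl⟩

/-- The bridge to the machine: a run excludes overflow and out-of-range indices, and a memory of at
most `2 ^ W` cells makes every cell address exact. The step counts agree, so time bounds carry over
unchanged. -/
theorem Run.exec {G : Layout} {cells : ℕ} (hc : G.H + G.C * G.X ≤ cells) (hW : cells ≤ cap G.W)
    (h0 : 0 < G.H) {c : Cmd} {σ σ' : Store} {T : ℕ} (h : Run G c σ T σ') :
    ∀ m, Represents G m σ.arr → ∃ m', Exec G.W cells (c.toStmt G.C) ⟨σ.regs, m⟩ T ⟨σ'.regs, m'⟩ ∧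
      Represents G m' σ'.arr := by
  induction h with
  | skip σ => exact fun m hm => ⟨m, .skip _, hm⟩
  | set r e σ h =>
    intro m hm
    refine ⟨m, ?_, hm⟩
    have := Exec.assign (W := G.W) (M := cells) r e ⟨σ.regs, m⟩
    rwa [Expr.eval_eq_nat h] at this
  | ld r q e σ h hi hq hH =>
    intro m hm
    refine ⟨m, ?_, hm⟩
    obtain ⟨h1, h2⟩ := cell_eval hc hW h0 h hi hq hH
    have := Exec.load (W := G.W) (M := cells) r (cell G.C q e) ⟨σ.regs, m⟩
      (by simp only [h1]; exact h2)
    simp only [h1, hm.2 q hq _ hi] at this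
    exact this
  | st q e e' σ h h' hi hq hH =>
    intro m hm
    obtain ⟨h1, h2⟩ := cell_eval hc hW h0 h hi hq hH
    have := Exec.store (W := G.W) (M := cells) (cell G.C q e) e' ⟨σ.regs, m⟩
      (by simp only [h1]; exact h2)
    simp only [h1, Expr.eval_eq_nat h'] at this
    exact ⟨_, this, hm.write hq⟩
  | inp r e σ h hi =>
    intro m hm
    refine ⟨m, ?_, hm⟩
    have := Exec.load (W := G.W) (M := cells) r e ⟨σ.regs, m⟩
      (by simp only [Expr.eval_eq_nat h]; omega)
    simp only [Expr.eval_eq_nat h, hm.1 _ hi] at this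
    exact this
  | seq _ _ ih1 ih2 =>
    intro m hm
    obtain ⟨m1, e1, r1⟩ := ih1 m hm
    obtain ⟨m2, e2, r2⟩ := ih2 m1 r1
    exact ⟨m2, .seq e1 e2, r2⟩
  | ite_true h he _ ih =>
    intro m hm
    obtain ⟨m1, e1, r1⟩ := ih m hm
    exact ⟨m1, .cond_true (by rwa [Expr.eval_eq_nat h]) e1, r1⟩
  | ite_false h he _ ih =>
    intro m hm
    obtain ⟨m1, e1, r1⟩ := ih m hm
    exact ⟨m1, .cond_false (by rwa [Expr.eval_eq_nat h]) e1, r1⟩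
  | whl_done h he =>
    intro m hm
    exact ⟨m, .loop_done (by rwa [Expr.eval_eq_nat h]), hm⟩
  | whl_step h he _ _ ih1 ih2 =>
    intro m hm
    obtain ⟨m1, e1, r1⟩ := ih1 m hm
    obtain ⟨m2, e2, r2⟩ := ih2 m1 r1
    exact ⟨m2, .loop_step (by rwa [Expr.eval_eq_nat h]) e1 e2, r2⟩

/-! ### Frame conditions, total correctness and counting loops -/

/-- The registers that a program writes. -/
def Cmd.regs : Cmd → List ℕ
  | .skip => []
  | .set r _ => [r]
  | .ld r _ _ => [r]
  | .st _ _ _ => []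
  | .inp r _ => [r]
  | .seq a b => a.regs ++ b.regs
  | .ite _ a b => a.regs ++ b.regs
  | .whl _ a => a.regs

/-- The arrays that a program writes. -/
def Cmd.arrs : Cmd → List ℕ
  | .skip => []
  | .set _ _ => []
  | .ld _ _ _ => []
  | .st q _ _ => [q]
  | .inp _ _ => []
  | .seq a b => a.arrs ++ b.arrs
  | .ite _ a b => a.arrs ++ b.arrs
  | .whl _ a => a.arrs

/-- `σ'` agrees with `σ` on the registers and arrays that `c` does not write. -/
def Cmd.Frame (c : Cmd) (σ σ' : Store) : Prop :=
  (∀ r, r ∉ c.regs → σ'.regs r = σ.regs r) ∧ ∀ q, q ∉ c.arrs → σ'.arr q = σ.arr q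

/-- Allows a specification to mention only what a program changes; that everything else is preserved
follows from the syntactic lists of written registers and arrays. -/
theorem Run.frame {G : Layout} {c : Cmd} {σ σ' : Store} {T : ℕ} (h : Run G c σ T σ') :
    c.Frame σ σ' := by
  induction h with
  | skip σ => exact ⟨fun _ _ => rfl, fun _ _ => rfl⟩
  | set r e σ h =>
    refine ⟨fun r' hr => ?_, fun _ _ => rfl⟩
    simp [Cmd.regs] at hr; simp [hr]
  | ld r q e σ h hi hq hH =>
    refine ⟨fun r' hr => ?_, fun _ _ => rfl⟩
    simp [Cmd.regs] at hr; simp [hr]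
  | st q e e' σ h h' hi hq hH =>
    refine ⟨fun _ _ => rfl, fun q' hq => ?_⟩
    simp [Cmd.arrs] at hq; funext j; simp [Store.write_arr, hq]
  | inp r e σ h hi =>
    refine ⟨fun r' hr => ?_, fun _ _ => rfl⟩
    simp [Cmd.regs] at hr; simp [hr]
  | seq _ _ ih1 ih2 =>
    refine ⟨fun r hr => ?_, fun q hq => ?_⟩
    · simp [Cmd.regs] at hr; rw [ih2.1 r hr.2, ih1.1 r hr.1]
    · simp [Cmd.arrs] at hq; rw [ih2.2 q hq.2, ih1.2 q hq.1]
  | ite_true h he _ ih =>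
    exact ⟨fun r hr => ih.1 r (by simp [Cmd.regs] at hr; exact hr.1),
      fun q hq => ih.2 q (by simp [Cmd.arrs] at hq; exact hq.1)⟩
  | ite_false h he _ ih =>
    exact ⟨fun r hr => ih.1 r (by simp [Cmd.regs] at hr; exact hr.2),
      fun q hq => ih.2 q (by simp [Cmd.arrs] at hq; exact hq.2)⟩
  | whl_done h he => exact ⟨fun _ _ => rfl, fun _ _ => rfl⟩
  | whl_step h he _ _ ih1 ih2 =>
    exact ⟨fun r hr => (ih2.1 r hr).trans (ih1.1 r hr), fun q hq => (ih2.2 q hq).trans (ih1.2 q hq)⟩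

/-- The program `c` started in `σ` halts within `T` steps in a state satisfying `Q`. -/
def Does (G : Layout) (c : Cmd) (T : ℕ) (σ : Store) (Q : Store → Prop) : Prop :=
  ∃ T' ≤ T, ∃ σ', Run G c σ T' σ' ∧ Q σ'

theorem Does.mono {G : Layout} {c : Cmd} {T T' : ℕ} {σ : Store} {Q Q' : Store → Prop}
    (h : Does G c T σ Q) (hT : T ≤ T') (hQ : ∀ σ', c.Frame σ σ' → Q σ' → Q' σ') :
    Does G c T' σ Q' := by
  obtain ⟨T₁, h1, σ', h2, h3⟩ := h
  exact ⟨T₁, h1.trans hT, σ', h2, hQ _ h2.frame h3⟩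

theorem Does.seq {G : Layout} {a b : Cmd} {T₁ T₂ : ℕ} {σ : Store} {P Q : Store → Prop}
    (h : Does G a T₁ σ P) (h' : ∀ σ', a.Frame σ σ' → P σ' → Does G b T₂ σ' Q) :
    Does G (a ;; b) (T₁ + T₂) σ Q := by
  obtain ⟨t₁, h1, σ₁, h2, h3⟩ := h
  obtain ⟨t₂, h4, σ₂, h5, h6⟩ := h' σ₁ h2.frame h3
  exact ⟨t₁ + t₂, by omega, σ₂, .seq h2 h5, h6⟩

/-- The weakest precondition of a program without loops. -/
def Cmd.wp (G : Layout) : Cmd → (Store → Prop) → Store → Prop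
  | .skip, Q, σ => Q σ
  | .set r e, Q, σ => e.Fits G.W σ.regs ∧ Q (σ.put r (e.nat G.W σ.regs))
  | .ld r q e, Q, σ => (e.Fits G.W σ.regs ∧ e.nat G.W σ.regs < G.X ∧ q < G.C ∧
      σ.regs 100 = G.H) ∧ Q (σ.put r (σ.arr q (e.nat G.W σ.regs)))
  | .st q e e', Q, σ => (e.Fits G.W σ.regs ∧ e'.Fits G.W σ.regs ∧ e.nat G.W σ.regs < G.X ∧
      q < G.C ∧ σ.regs 100 = G.H) ∧ Q (σ.write q (e.nat G.W σ.regs) (e'.nat G.W σ.regs))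
  | .inp r e, Q, σ => (e.Fits G.W σ.regs ∧ e.nat G.W σ.regs < G.H) ∧
      Q (σ.put r (G.inp (e.nat G.W σ.regs)))
  | .seq a b, Q, σ => a.wp G (b.wp G Q) σ
  | .ite e a b, Q, σ => e.Fits G.W σ.regs ∧ (e.nat G.W σ.regs ≠ 0 → a.wp G Q σ) ∧
      (e.nat G.W σ.regs = 0 → b.wp G Q σ)
  | .whl _ _, _, _ => False

/-- A bound for the number of steps of a program without loops. -/
def Cmd.cost : Cmd → ℕ
  | .skip => 1
  | .set _ e => e.cost + 1
  | .ld _ _ e => e.cost + 7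
  | .st _ e e' => e.cost + e'.cost + 7
  | .inp _ e => e.cost + 1
  | .seq a b => a.cost + b.cost
  | .ite e a b => e.cost + 1 + (a.cost + b.cost)
  | .whl _ _ => 0

theorem cell_cost (C q : ℕ) (e : Expr) : (cell C q e).cost = e.cost + 6 := by
  change 1 + ((1 + e.cost + 1) + 1 + 1) + 1 = _
  omega

theorem Does.of_wp {G : Layout} {c : Cmd} {σ : Store} {Q : Store → Prop} (h : c.wp G Q σ) :
    Does G c c.cost σ Q := by
  induction c generalizing σ Q with
  | skip => exact ⟨_, le_rfl, _, .skip _, h⟩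
  | set r e => exact ⟨_, le_rfl, _, .set _ _ _ h.1, h.2⟩
  | ld r q e =>
    obtain ⟨⟨h1, h2, h3, h4⟩, h5⟩ := h
    exact ⟨_, by rw [cell_cost, Cmd.cost], _, .ld _ _ _ _ h1 h2 h3 h4, h5⟩
  | st q e e' =>
    obtain ⟨⟨h1, h2, h3, h4, h6⟩, h5⟩ := h
    exact ⟨_, by rw [cell_cost, Cmd.cost]; omega, _, .st _ _ _ _ h1 h2 h3 h4 h6, h5⟩
  | inp r e => exact ⟨_, le_rfl, _, .inp _ _ _ h.1.1 h.1.2, h.2⟩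
  | seq a b iha ihb => exact (iha h).seq fun σ' _ h' => ihb h'
  | ite e a b iha ihb =>
    obtain ⟨h1, h2, h3⟩ := h
    by_cases he : e.nat G.W σ.regs = 0
    · obtain ⟨t, k1, σ', k2, k3⟩ := ihb (h3 he)
      exact ⟨_, by rw [Cmd.cost]; omega, σ', .ite_false h1 he k2, k3⟩
    · obtain ⟨t, k1, σ', k2, k3⟩ := iha (h2 he)
      exact ⟨_, by rw [Cmd.cost]; omega, σ', .ite_true h1 he k2, k3⟩
  | whl e a _ => exact h.elim

/-- The postcondition enters through an arbitrary consequence `Q'`, which stays opaque while the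
weakest precondition is unfolded. -/
theorem Does.block {G : Layout} {c : Cmd} {σ : Store} {Q : Store → Prop} {T : ℕ} (hT : c.cost ≤ T)
    (h : ∀ Q' : Store → Prop, (∀ σ', Q σ' → Q' σ') → c.wp G Q' σ) : Does G c T σ Q :=
  (Does.of_wp (h Q fun _ h => h)).mono hT fun _ _ h => h

/-- Run `a` with register `r` holding `0, 1, …` up to the content of register `lim`. -/
def Cmd.for (r lim : ℕ) (a : Cmd) : Cmd :=
  .set r (.const 0) ;; .whl (.bin .lt (.reg r) (.reg lim)) (a ;; .set r (.reg r + .const 1))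

/-- Each round pays `8` besides its body: `4` for the test and `4` for the increment. The final `6`
are the initialisation (`2`) and the failing test (`4`). The bound `T i` depends on the round, so
that nested loops can be charged to the total of their lengths. -/
theorem Does.for {G : Layout} {r lim : ℕ} {a : Cmd} {σ : Store} (I : ℕ → Store → Prop)
    (T : ℕ → ℕ) (n : ℕ) (hn : σ.regs lim = n) (hlim : lim ∉ a.regs) (hr : r ∉ a.regs)
    (hne : lim ≠ r) (hW : n < cap G.W) (h0 : I 0 (σ.put r 0))
    (hs : ∀ i < n, ∀ σ', I i σ' → σ'.regs r = i → (∀ r', r' ∉ a.regs → r' ≠ r →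
      σ'.regs r' = σ.regs r') → (∀ q, q ∉ a.arrs → σ'.arr q = σ.arr q) →
      Does G a (T i) σ' fun σ'' => I (i + 1) (σ''.put r (i + 1))) :
    Does G (.for r lim a) (∑ i ∈ Finset.range n, (T i + 8) + 6) σ fun σ' => I n σ' := by
  have h2 : 0 < cap G.W := by unfold cap; positivity
  have key : ∀ m i, i + m = n → ∀ σ', I i σ' → σ'.regs r = i → (∀ r', r' ∉ a.regs → r' ≠ r →
      σ'.regs r' = σ.regs r') → (∀ q, q ∉ a.arrs → σ'.arr q = σ.arr q) →
      Does G (.whl (.bin .lt (.reg r) (.reg lim)) (a ;; .set r (.reg r + .const 1)))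
        (∑ j ∈ Finset.range m, (T (i + j) + 8) + 4) σ' (I n) := by
    intro m
    induction m with
    | zero =>
      intro i him σ' hI hri hfr hfa
      obtain rfl : i = n := by omega
      refine ⟨_, ?_, σ', .whl_done (by simp) ?_, hI⟩
      · simp [Expr.cost]
      · simp [hri, hfr lim hlim hne, hn]
    | succ m ih =>
      intro i him σ' hI hri hfr hfa
      obtain ⟨t1, k1, σ1, k2, k3⟩ := hs i (by omega) σ' hI hri hfr hfa
      have hf := k2.frame
      have hr1 : σ1.regs r = i := (hf.1 r hr).trans hri
      have hput : σ1.put r ((Expr.reg r + Expr.const 1).nat G.W σ1.regs) = σ1.put r (i + 1) := by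
        simp [hr1]
      have hset : Run G (.set r (.reg r + .const 1)) σ1 4 (σ1.put r (i + 1)) := by
        rw [← hput]
        refine .set _ _ _ ?_
        simp [hr1]; omega
      obtain ⟨t2, k4, σ2, k5, k6⟩ := ih (i + 1) (by omega) (σ1.put r (i + 1)) k3 (by simp)
        (fun r' h1 h2 => by simp [h2, hf.1 r' h1, hfr r' h1 h2])
        (fun q h1 => by rw [Store.put_arr, hf.2 q h1, hfa q h1])
      refine ⟨_, ?_, σ2, .whl_step (by simp) ?_ (.seq k2 hset) k5, k6⟩
      · rw [Finset.sum_range_succ']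
        simp only [Expr.cost, Nat.add_zero]
        have : ∀ j, i + (j + 1) = i + 1 + j := fun j => by ring
        rw [Finset.sum_congr rfl fun j _ => by rw [this j]]
        omega
      · simp [hri, hfr lim hlim hne, hn]; omega
  obtain ⟨t, k1, σ', k2, k3⟩ := key n 0 (by omega) (σ.put r 0) h0 (by simp)
    (fun r' _ h => by simp [h]) (fun q _ => rfl)
  have hset : Run G (.set r (.const 0)) σ 2 (σ.put r 0) := .set _ _ _ (by simpa using h2)
  refine ⟨_, ?_, σ', .seq hset k2, k3⟩
  simp only [Nat.zero_add] at k1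
  omega

/-- Running a program that contains no store instruction leaves the memory unchanged. -/
theorem Run.exec_readonly {G : Layout} {cells : ℕ} (hc : G.H + G.C * G.X ≤ cells)
    (hW : cells ≤ cap G.W) (h0 : 0 < G.H) {c : Cmd} {σ σ' : Store} {T : ℕ} (h : Run G c σ T σ')
    (hst : c.arrs = []) {m : ℕ → ℕ} (hm : Represents G m σ.arr) :
    Exec G.W cells (c.toStmt G.C) ⟨σ.regs, m⟩ T ⟨σ'.regs, m⟩ := by
  obtain ⟨m', h1, -⟩ := h.exec hc hW h0 m hm
  -- The simulation provides only some final memory; that it is the initial one is read off the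
  -- execution, since the translated program has no store instruction.
  have key : ∀ {s : Stmt} {τ τ' : State} {T : ℕ}, Exec G.W cells s τ T τ' →
      ∀ c : Cmd, s = c.toStmt G.C → c.arrs = [] → τ'.mem = τ.mem := by
    intro s τ τ' T h
    induction h with
    | skip | assign | load => intros; rfl
    | store a e σ h => intro c hc hst; cases c <;> simp [Cmd.toStmt, Cmd.arrs] at *
    | seq _ _ ih1 ih2 =>
      intro c hc hst
      cases c <;> simp [Cmd.toStmt, Cmd.arrs] at *
      rw [ih2 _ hc.2 hst.2, ih1 _ hc.1 hst.1]
    | cond_true _ _ ih =>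
      intro c hc hst
      cases c <;> simp [Cmd.toStmt, Cmd.arrs] at *
      exact ih _ hc.2.1 hst.1
    | cond_false _ _ ih =>
      intro c hc hst
      cases c <;> simp [Cmd.toStmt, Cmd.arrs] at *
      exact ih _ hc.2.2 hst.2
    | loop_done => intros; rfl
    | loop_step _ _ _ ih1 ih2 =>
      intro c hc hst
      have hc' := hc
      cases c <;> simp [Cmd.toStmt] at hc
      rw [ih2 _ hc' hst, ih1 _ hc.2 (by simpa [Cmd.arrs] using hst)]
  have : m' = m := key h1 c rfl hst
  rwa [this] at h1

end WordRAM

namespace PISNS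

open WordRAM

/-! ## One level of the trie

Elements `e < n` sit in nodes `v e`; inside its node an element has the digit `dg e`.  The bitmap
`bm u` of a node records the digits that occur, and the children of all nodes are numbered
consecutively. -/

/-- The number of the first child of the node `r`. -/
def baseOf (W : ℕ) (bm : ℕ → ℕ) (r : ℕ) : ℕ := ∑ u ∈ Finset.range r, rank (bm u) W

/-- The number of the child of `r` for the digit `d`. -/
def child (W : ℕ) (bm : ℕ → ℕ) (r d : ℕ) : ℕ := baseOf W bm r + rank (bm r) d

theorem rank_mono (v : ℕ) {d d' : ℕ} (h : d ≤ d') : rank v d ≤ rank v d' :=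
  Nat.count_monotone _ h

theorem rank_lt {v d d' : ℕ} (h : v.testBit d = true) (hd : d < d') : rank v d < rank v d' :=
  Nat.count_strict_mono h hd

theorem rank_zero (v : ℕ) : rank v 0 = 0 := rfl

theorem baseOf_succ (W : ℕ) (bm : ℕ → ℕ) (r : ℕ) :
    baseOf W bm (r + 1) = baseOf W bm r + rank (bm r) W := Finset.sum_range_succ _ _

theorem baseOf_mono (W : ℕ) (bm : ℕ → ℕ) {r r' : ℕ} (h : r ≤ r') :
    baseOf W bm r ≤ baseOf W bm r' :=
  Finset.sum_le_sum_of_subset (Finset.range_mono h)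

theorem child_le {W : ℕ} {bm : ℕ → ℕ} {r d : ℕ} (hd : d ≤ W) :
    child W bm r d ≤ baseOf W bm (r + 1) := by
  rw [baseOf_succ]
  exact Nat.add_le_add_left (rank_mono _ hd) _

theorem child_lt {W : ℕ} {bm : ℕ → ℕ} {r d : ℕ} (hd : d < W) (h : (bm r).testBit d = true) :
    child W bm r d < baseOf W bm (r + 1) := by
  rw [baseOf_succ]
  exact Nat.add_lt_add_left (rank_lt h hd) _

/-- The children of a node fill an interval of numbers, ordered by digit, and the intervals follow
the order of the nodes. Hence the numbering is lexicographic. The right-hand child need not exist,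
because `rank` counts only the strictly smaller digits. -/
theorem child_lt_child_iff {W : ℕ} {bm : ℕ → ℕ} {u d r δ : ℕ} (hd : d < W)
    (h : (bm u).testBit d = true) (hδ : δ ≤ W) :
    child W bm u d < child W bm r δ ↔ u < r ∨ u = r ∧ d < δ := by
  constructor
  · intro hlt
    rcases lt_trichotomy u r with h1 | h1 | h1
    · exact Or.inl h1
    · subst h1
      refine Or.inr ⟨rfl, ?_⟩
      by_contra hc
      have := rank_mono (bm u) (not_lt.mp hc)
      unfold child at hlt
      omega
    · exfalso
      have h2 : child W bm r δ ≤ baseOf W bm (r + 1) := child_le hδ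
      have h3 : baseOf W bm (r + 1) ≤ baseOf W bm u := baseOf_mono W bm h1
      have h4 : baseOf W bm u ≤ child W bm u d := Nat.le_add_right _ _
      omega
  · rintro (h1 | ⟨rfl, h1⟩)
    · have h2 := child_lt hd h
      have h3 : baseOf W bm (u + 1) ≤ baseOf W bm r := baseOf_mono W bm h1
      have h4 : baseOf W bm r ≤ child W bm r δ := Nat.le_add_right _ _
      omega
    · exact Nat.add_lt_add_left (rank_lt h h1) _

theorem child_eq_child_iff {W : ℕ} {bm : ℕ → ℕ} {u d r δ : ℕ} (hd : d < W)
    (h : (bm u).testBit d = true) (hδ : δ < W) (h' : (bm r).testBit δ = true) :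
    child W bm u d = child W bm r δ ↔ u = r ∧ d = δ := by
  have h1 := child_lt_child_iff (r := r) hd h hδ.le
  have h2 := child_lt_child_iff (r := u) hδ h' hd.le
  constructor
  · intro he
    rw [he] at h1 h2
    simp only [lt_irrefl, false_iff] at h1 h2
    omega
  · rintro ⟨rfl, rfl⟩; rfl

section Level

variable {W n : ℕ} {v dg bm : ℕ → ℕ}

/-- The child of `r` for the digit `δ` if `ex` holds, and the first child of `r` otherwise. -/
noncomputable def descend (W : ℕ) (bm : ℕ → ℕ) (r δ : ℕ) (ex : Prop) [Decidable ex] : ℕ :=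
  child W bm r (if ex then δ else 0)

/-- One step of a lexicographic comparison. If the digit `δ` is absent in `r`, no element lies in
the target, and the elements of `r` with smaller digits are those before it. If `ex` fails, the
first child of `r` is the boundary, so that exactly the elements in nodes before `r` are counted. -/
theorem descend_spec (hbm : ∀ u d, (bm u).testBit d = true ↔ ∃ e < n, v e = u ∧ dg e = d)
    (hdg : ∀ e < n, dg e < W) (r : ℕ) {δ : ℕ} (hδ : δ < W) (ex : Prop) [Decidable ex]
    {e : ℕ} (he : e < n) (p : Prop) :
    (v e < r ∨ ex ∧ v e = r ∧ (dg e < δ ∨ dg e = δ ∧ p)) ↔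
      (child W bm (v e) (dg e) < descend W bm r δ ex ∨
        (ex ∧ (bm r).testBit δ = true) ∧ child W bm (v e) (dg e) = descend W bm r δ ex ∧ p) := by
  have ht : (bm (v e)).testBit (dg e) = true := (hbm _ _).2 ⟨e, he, rfl, rfl⟩
  unfold descend
  rw [child_lt_child_iff (hdg e he) ht (by split_ifs <;> omega)]
  by_cases hex : ex
  · simp only [hex, if_true, true_and]
    by_cases hb : (bm r).testBit δ = true
    · rw [child_eq_child_iff (hdg e he) ht hδ hb]
      tauto
    · have : ¬ (v e = r ∧ dg e = δ) := fun h => hb ((hbm _ _).2 ⟨e, he, h.1, h.2⟩)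
      tauto
  · simp [hex]

theorem child_injective (hbm : ∀ u d, (bm u).testBit d = true ↔ ∃ e < n, v e = u ∧ dg e = d)
    (hdg : ∀ e < n, dg e < W) {e e' : ℕ} (he : e < n) (he' : e' < n)
    (h : child W bm (v e) (dg e) = child W bm (v e') (dg e')) : v e = v e' ∧ dg e = dg e' :=
  (child_eq_child_iff (hdg e he) ((hbm _ _).2 ⟨e, he, rfl, rfl⟩) (hdg e' he')
    ((hbm _ _).2 ⟨e', he', rfl, rfl⟩)).1 h

/-- Every set bit belongs to some element. -/
theorem rank_le_card (hbm : ∀ u d, (bm u).testBit d = true ↔ ∃ e < n, v e = u ∧ dg e = d)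
    (u δ : ℕ) : rank (bm u) δ ≤ ((Finset.range n).filter fun e => v e = u ∧ dg e < δ).card := by
  rw [rank, Nat.count_eq_card_filter_range]
  refine (Finset.card_le_card ?_).trans (Finset.card_image_le (f := dg))
  intro d hd
  simp only [Finset.mem_filter, Finset.mem_range, Finset.mem_image] at *
  obtain ⟨e, h1, h2, h3⟩ := (hbm _ _).1 hd.2
  exact ⟨e, ⟨h1, h2, by omega⟩, h3⟩

theorem rank_eq_card (hbm : ∀ u d, (bm u).testBit d = true ↔ ∃ e < n, v e = u ∧ dg e = d)
    (hinj : ∀ e < n, ∀ e' < n, v e = v e' → dg e = dg e' → e = e')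
    (u δ : ℕ) : rank (bm u) δ = ((Finset.range n).filter fun e => v e = u ∧ dg e < δ).card := by
  refine le_antisymm (rank_le_card hbm u δ) ?_
  rw [rank, Nat.count_eq_card_filter_range]
  refine Finset.card_le_card_of_injOn dg ?_ ?_
  · intro e he
    simp only [Finset.coe_filter, Finset.mem_range, Set.mem_ofPred_eq] at *
    exact ⟨he.2.2, (hbm _ _).2 ⟨e, he.1, he.2.1, rfl⟩⟩
  · intro e he e' he' h
    simp only [Finset.coe_filter, Finset.mem_range, Set.mem_ofPred_eq] at *
    exact hinj e he.1 e' he'.1 (by omega) h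

/-- Every child holds an element, so there are at most `n` children in all; thus no level needs
longer tables than the top one. -/
theorem baseOf_le (hbm : ∀ u d, (bm u).testBit d = true ↔ ∃ e < n, v e = u ∧ dg e = d)
    (r : ℕ) : baseOf W bm r ≤ n := by
  calc baseOf W bm r ≤ ∑ u ∈ Finset.range r, ((Finset.range n).filter fun e => v e = u).card := by
        refine Finset.sum_le_sum fun u _ => (rank_le_card hbm u W).trans (Finset.card_le_card ?_)
        intro e; simp only [Finset.mem_filter]; tauto
    _ = ((Finset.range n).filter fun e => v e < r).card := by
        rw [Finset.card_eq_sum_card_fiberwise (f := v) (t := Finset.range r)]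
        · refine Finset.sum_congr rfl fun u hu => ?_
          congr 1; ext e
          simp only [Finset.mem_filter, Finset.mem_range] at *
          constructor
          · rintro ⟨h1, rfl⟩; exact ⟨⟨h1, hu⟩, rfl⟩
          · rintro ⟨⟨h1, _⟩, h2⟩; exact ⟨h1, h2⟩
        · intro e he; simpa using (Finset.mem_filter.1 he).2
    _ ≤ n := (Finset.card_filter_le _ _).trans (by simp)

/-- If every node of the next level holds at most one element, then the nodes are numbered in
the order of the elements. -/
theorem card_child_lt (hbm : ∀ u d, (bm u).testBit d = true ↔ ∃ e < n, v e = u ∧ dg e = d)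
    (hdg : ∀ e < n, dg e < W)
    (hinj : ∀ e < n, ∀ e' < n, v e = v e' → dg e = dg e' → e = e') (r : ℕ) {δ : ℕ} (hδ : δ ≤ W) :
    ((Finset.range n).filter fun e => child W bm (v e) (dg e) < child W bm r δ).card =
      child W bm r δ := by
  have h1 : ((Finset.range n).filter fun e => child W bm (v e) (dg e) < child W bm r δ) =
      ((Finset.range n).filter fun e => v e < r) ∪
        ((Finset.range n).filter fun e => v e = r ∧ dg e < δ) := by
    ext e
    simp only [Finset.mem_filter, Finset.mem_union, Finset.mem_range]
    constructor
    · rintro ⟨he, h⟩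
      rw [child_lt_child_iff (hdg e he) ((hbm _ _).2 ⟨e, he, rfl, rfl⟩) hδ] at h
      tauto
    · intro h
      have he : e < n := by tauto
      rw [child_lt_child_iff (hdg e he) ((hbm _ _).2 ⟨e, he, rfl, rfl⟩) hδ]
      tauto
  rw [h1, Finset.card_union_of_disjoint, ← rank_eq_card hbm hinj, child, baseOf]
  · congr 1
    rw [Finset.card_eq_sum_card_fiberwise (f := v) (t := Finset.range r)]
    · refine Finset.sum_congr rfl fun u hu => ?_
      rw [rank_eq_card hbm hinj]
      congr 1; ext e
      simp only [Finset.mem_filter, Finset.mem_range] at *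
      constructor
      · rintro ⟨⟨h1, _⟩, h2⟩; exact ⟨h1, h2, hdg e h1⟩
      · rintro ⟨h1, rfl, _⟩; exact ⟨⟨h1, hu⟩, rfl⟩
    · intro e he; simpa using (Finset.mem_filter.1 he).2
  · rw [Finset.disjoint_filter]
    intro e _ h2 h3; omega

theorem card_descend (hbm : ∀ u d, (bm u).testBit d = true ↔ ∃ e < n, v e = u ∧ dg e = d)
    (hdg : ∀ e < n, dg e < W)
    (hinj : ∀ e < n, ∀ e' < n, v e = v e' → dg e = dg e' → e = e') (r : ℕ) {δ : ℕ} (hδ : δ < W)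
    (ex : Prop) [Decidable ex] :
    ((Finset.range n).filter fun e => child W bm (v e) (dg e) < descend W bm r δ ex ∨
        (ex ∧ (bm r).testBit δ = true) ∧ child W bm (v e) (dg e) = descend W bm r δ ex).card =
      descend W bm r δ ex + if ex ∧ (bm r).testBit δ = true then 1 else 0 := by
  rw [Finset.filter_or, Finset.card_union_of_disjoint]
  · congr 1
    · exact card_child_lt hbm hdg hinj r (by split_ifs <;> omega)
    · split_ifs with h
      · obtain ⟨e, h1, h2, h3⟩ := (hbm _ _).1 h.2
        rw [Finset.card_eq_one]
        refine ⟨e, ?_⟩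
        ext e'
        simp only [Finset.mem_filter, Finset.mem_range, Finset.mem_singleton]
        unfold descend
        simp only [h, true_and, if_true]
        constructor
        · rintro ⟨h4, h5⟩
          rw [← h2, ← h3] at h5
          obtain ⟨h6, h7⟩ := child_injective hbm hdg h4 h1 h5
          exact hinj _ h4 _ h1 h6 h7
        · rintro rfl
          exact ⟨h1, by rw [h2, h3]⟩
      · simp [h]
  · rw [Finset.disjoint_filter]
    intro e _ h2 h3; omega

end Level

end PISNS

namespace PISNS

open WordRAM

/-! ## Families of shrinking nested sets, listed one after the other -/

/-- `k` sets with `cnt i` elements each; `xs e` is the `e`-th element of the concatenated lists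
and `own e` the index of its set. -/
structure Family where
  N : ℕ
  k : ℕ
  n : ℕ
  B : ℕ
  cnt : ℕ → ℕ
  xs : ℕ → ℕ
  own : ℕ → ℕ
  B_pos : 0 < B
  k_pos : 0 < k
  cnt_pos : ∀ i < k, 1 ≤ cnt i
  sum_cnt : ∑ i ∈ Finset.range k, cnt i = n
  own_lt : ∀ e < n, own e < k
  own_iff : ∀ e < n, ∀ i < k, own e = i ↔
    ∑ j ∈ Finset.range i, cnt j ≤ e ∧ e < ∑ j ∈ Finset.range (i + 1), cnt j
  xs_le : ∀ e < n, xs e ≤ N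
  inj : ∀ e < n, ∀ e' < n, own e = own e' → xs e = xs e' → e = e'
  -- The shrinking condition without the thresholds: a number persists until any later set that
  -- still has an element not exceeding it.
  nest : ∀ e < n, ∀ e' < n, ∀ i, own e ≤ i → i ≤ own e' → xs e' ≤ xs e →
    ∃ e'' < n, own e'' = i ∧ xs e'' = xs e

namespace Family

variable (D : Family)

/-- The number of elements of the first `i` sets. -/
def off (i : ℕ) : ℕ := ∑ j ∈ Finset.range i, D.cnt j

/-- The block of an element. -/
def blk (e : ℕ) : ℕ := D.xs e / D.B

/-- The number of blocks. -/
def M : ℕ := D.N / D.B + 1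

/-- The first block met by the set `i`, as far as the elements below `m` are concerned. -/
def firstUpTo (i : ℕ) : ℕ → ℕ
  | 0 => D.M
  | e + 1 => if D.own e = i ∧ D.blk e < firstUpTo i e then D.blk e else firstUpTo i e

/-- The first block met by the set `i`. -/
def first (i : ℕ) : ℕ := D.firstUpTo i D.n

/-- One more than the last set below `m` whose first block is `b`. -/
def lastUpTo (b : ℕ) : ℕ → ℕ
  | 0 => 0
  | j + 1 => if D.first j = b then j + 1 else lastUpTo b j

/-- One more than the last set whose first block is less than `b`. -/
def death : ℕ → ℕ
  | 0 => 0
  | b + 1 => max (death b) (D.lastUpTo b D.k)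

/-- One more than the first set that meets the block `b`, as far as the elements below `m` are
concerned. -/
def meetUpTo (b : ℕ) : ℕ → ℕ
  | 0 => 0
  | e + 1 => if D.blk e = b ∧ meetUpTo b e = 0 then D.own e + 1 else meetUpTo b e

/-- One more than the first set that meets the block `b`; all sets meet the sentinel block. -/
def meet (b : ℕ) : ℕ := if b = D.M then 1 else D.meetUpTo b D.n

/-- The first set from which on the block `b` is met, until its death. -/
def birth (b : ℕ) : ℕ :=
  if D.meet b = 0 then D.death b else if D.death b < D.meet b then D.death b else D.meet b - 1

/-- The sum of the lifetimes of the blocks before `b`. -/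
def life (b : ℕ) : ℕ := ∑ b' ∈ Finset.range b, (D.death b' - D.birth b')

/-- The number of blocks before `b` alive at `i`. -/
def alive (b i : ℕ) : ℕ :=
  ((Finset.range b).filter fun b' => D.birth b' ≤ i ∧ i < D.death b').card

/-- The number of the top node for block `b` of the set `i`. -/
def top (i b : ℕ) : ℕ := if b ≤ D.first i then 2 * D.off i else 2 * D.off i + 1 + D.alive b i

theorem off_succ (i : ℕ) : D.off (i + 1) = D.off i + D.cnt i := Finset.sum_range_succ _ _

theorem off_zero : D.off 0 = 0 := rfl

theorem off_mono {i j : ℕ} (h : i ≤ j) : D.off i ≤ D.off j :=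
  Finset.sum_le_sum_of_subset (Finset.range_mono h)

theorem off_k : D.off D.k = D.n := D.sum_cnt

theorem off_le {i : ℕ} (h : i ≤ D.k) : D.off i ≤ D.n := D.off_k ▸ D.off_mono h

theorem own_eq {e i : ℕ} (hi : i < D.k) (h1 : D.off i ≤ e) (h2 : e < D.off (i + 1)) :
    D.own e = i :=
  (D.own_iff e (h2.trans_le (D.off_le hi)) i hi).2 ⟨h1, h2⟩

theorem off_own_le {e : ℕ} (he : e < D.n) : D.off (D.own e) ≤ e :=
  ((D.own_iff e he _ (D.own_lt e he)).1 rfl).1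

theorem lt_off_own {e : ℕ} (he : e < D.n) : e < D.off (D.own e + 1) :=
  ((D.own_iff e he _ (D.own_lt e he)).1 rfl).2

theorem own_mono {e e' : ℕ} (h : e ≤ e') (he : e' < D.n) : D.own e ≤ D.own e' := by
  by_contra hc
  have h1 := D.off_own_le (h.trans_lt he)
  have h2 := D.lt_off_own he
  have h3 := D.off_mono (show D.own e' + 1 ≤ D.own e by omega)
  omega

theorem k_le_n : D.k ≤ D.n := by
  rw [← D.sum_cnt]
  calc D.k = ∑ i ∈ Finset.range D.k, 1 := by simp
    _ ≤ _ := Finset.sum_le_sum fun i hi => D.cnt_pos i (Finset.mem_range.1 hi)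

theorem blk_lt {e : ℕ} (he : e < D.n) : D.blk e < D.M :=
  Nat.lt_succ_of_le (Nat.div_le_div_right (D.xs_le e he))

theorem firstUpTo_le {i m e : ℕ} (he : e < m) (ho : D.own e = i) :
    D.firstUpTo i m ≤ D.blk e := by
  induction m with
  | zero => omega
  | succ m ih =>
    rw [firstUpTo]
    rcases Nat.lt_succ_iff_lt_or_eq.1 he with h | rfl
    · have := ih h
      split_ifs with h1 <;> omega
    · split_ifs with h1
      · exact le_rfl
      · have : ¬ D.blk e < D.firstUpTo i e := fun h => h1 ⟨ho, h⟩
        omega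

/-- The initial value `M` exceeds every block, so for a nonempty set the minimum is eventually
attained. -/
theorem firstUpTo_attained (i m : ℕ) :
    D.firstUpTo i m = D.M ∨ ∃ e < m, D.own e = i ∧ D.firstUpTo i m = D.blk e := by
  induction m with
  | zero => exact Or.inl rfl
  | succ m ih =>
    rw [firstUpTo]
    split_ifs with h1
    · exact Or.inr ⟨m, by omega, h1.1, rfl⟩
    · rcases ih with h | ⟨e, h2, h3⟩
      · exact Or.inl h
      · exact Or.inr ⟨e, by omega, h3⟩

theorem first_le {e : ℕ} (he : e < D.n) : D.first (D.own e) ≤ D.blk e :=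
  D.firstUpTo_le he rfl

theorem first_attained {i : ℕ} (hi : i < D.k) : ∃ e < D.n, D.own e = i ∧ D.blk e = D.first i := by
  have h1 : D.off i < D.off (i + 1) := by
    have := D.cnt_pos i hi
    rw [off_succ]; omega
  have h2 : D.off i < D.n := h1.trans_le (D.off_le hi)
  have h3 : D.own (D.off i) = i := D.own_eq hi le_rfl h1
  rcases D.firstUpTo_attained i D.n with h | ⟨e, h4, h5, h6⟩
  · have h4 := D.firstUpTo_le h2 h3
    have h5 := D.blk_lt h2
    omega
  · exact ⟨e, h4, h5, h6.symm⟩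

theorem first_lt {i : ℕ} (hi : i < D.k) : D.first i < D.M := by
  obtain ⟨e, h1, -, h2⟩ := D.first_attained hi
  exact h2 ▸ D.blk_lt h1

theorem lt_lastUpTo_iff (b m i : ℕ) :
    i < D.lastUpTo b m ↔ ∃ j, i ≤ j ∧ j < m ∧ D.first j = b := by
  induction m with
  | zero => simp [lastUpTo]
  | succ m ih =>
    rw [lastUpTo]
    split_ifs with h
    · constructor
      · intro h1; exact ⟨m, by omega, by omega, h⟩
      · rintro ⟨j, h1, h2, -⟩; omega
    · rw [ih]
      constructor
      · rintro ⟨j, h1, h2, h3⟩; exact ⟨j, h1, by omega, h3⟩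
      · rintro ⟨j, h1, h2, h3⟩
        have : j ≠ m := by rintro rfl; exact h h3
        exact ⟨j, h1, by omega, h3⟩

/-- `death b` is the running maximum of `lastUpTo b' k` over `b' < b`. This form gives monotonicity
in `b` and supplies the later set with a smaller element that the nesting argument needs. -/
theorem lt_death_iff (b i : ℕ) : i < D.death b ↔ ∃ j, i ≤ j ∧ j < D.k ∧ D.first j < b := by
  induction b with
  | zero => simp [death]
  | succ b ih =>
    rw [death, lt_max_iff, ih, lt_lastUpTo_iff]
    constructor
    · rintro (⟨j, h1, h2, h3⟩ | ⟨j, h1, h2, h3⟩)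
      · exact ⟨j, h1, h2, by omega⟩
      · exact ⟨j, h1, h2, by omega⟩
    · rintro ⟨j, h1, h2, h3⟩
      rcases Nat.lt_succ_iff_lt_or_eq.1 h3 with h | h
      · exact Or.inl ⟨j, h1, h2, h⟩
      · exact Or.inr ⟨j, h1, h2, h⟩

theorem death_mono {b b' : ℕ} (h : b ≤ b') : D.death b ≤ D.death b' := by
  by_contra hc
  obtain ⟨j, h1, h2, h3⟩ := (D.lt_death_iff b _).1 (not_le.1 hc)
  have := (D.lt_death_iff b' (D.death b')).2 ⟨j, h1, h2, by omega⟩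
  omega

theorem death_le (b : ℕ) : D.death b ≤ D.k := by
  by_contra hc
  obtain ⟨j, h1, h2, -⟩ := (D.lt_death_iff b _).1 (not_le.1 hc)
  omega

theorem death_M : D.death D.M = D.k := by
  refine le_antisymm (D.death_le _) ?_
  have hk := D.k_pos
  have := (D.lt_death_iff D.M (D.k - 1)).2 ⟨D.k - 1, le_rfl, by omega, D.first_lt (by omega)⟩
  omega

/-- The elements are listed set by set, so the first element found in a block belongs to the
earliest set that meets it. -/
theorem meetUpTo_le_iff {m : ℕ} (hm : m ≤ D.n) (b i : ℕ) :
    (D.meetUpTo b m ≠ 0 ∧ D.meetUpTo b m ≤ i + 1) ↔ ∃ e < m, D.blk e = b ∧ D.own e ≤ i := by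
  induction m with
  | zero => simp [meetUpTo]
  | succ m ih =>
    have ih := ih (by omega)
    rw [meetUpTo]
    split_ifs with h
    · constructor
      · intro h1; exact ⟨m, by omega, h.1, by omega⟩
      · rintro ⟨e, h1, h2, h3⟩
        have := D.own_mono (show e ≤ m by omega) (by omega)
        refine ⟨by omega, ?_⟩
        rcases Nat.lt_succ_iff_lt_or_eq.1 h1 with h4 | rfl
        · exact absurd h.2 (ih.2 ⟨e, h4, h2, h3⟩).1
        · omega
    · rw [ih]
      constructor
      · rintro ⟨e, h1, h2⟩; exact ⟨e, by omega, h2⟩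
      · rintro ⟨e, h1, h2, h3⟩
        rcases Nat.lt_succ_iff_lt_or_eq.1 h1 with h4 | rfl
        · exact ⟨e, h4, h2, h3⟩
        · have h5 : D.meetUpTo b e ≠ 0 := fun h5 => h ⟨h2, h5⟩
          by_contra hc
          rw [← ih] at hc
          have h6 : ∀ e' ≤ e, D.own e' ≤ D.own e := fun e' h => D.own_mono h (by omega)
          have h7 : ∃ e' < e, D.blk e' = b ∧ D.own e' ≤ D.own e := by
            -- A nonzero entry stems from an earlier element of the block, and the set of that
            -- element is at most `own e`.
            have h8 : ∀ m' ≤ e, D.meetUpTo b m' ≠ 0 → ∃ e' < m', D.blk e' = b := by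
              intro m'
              induction m' with
              | zero => intro _ h; exact absurd rfl h
              | succ m' ih' =>
                intro h9 h10
                rw [meetUpTo] at h10
                split_ifs at h10 with h11
                · exact ⟨m', by omega, h11.1⟩
                · obtain ⟨e', h12, h13⟩ := ih' (by omega) h10
                  exact ⟨e', by omega, h13⟩
            obtain ⟨e', h9, h10⟩ := h8 e le_rfl h5
            exact ⟨e', h9, h10, h6 e' h9.le⟩
          obtain ⟨e', h8, h9, h10⟩ := h7
          exact hc (ih.2 ⟨e', h8, h9, by omega⟩)

theorem birth_le_death (b : ℕ) : D.birth b ≤ D.death b := by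
  unfold birth; split_ifs <;> omega

theorem birth_M : D.birth D.M = 0 := by
  have h1 : D.meet D.M = 1 := if_pos rfl
  have h2 := D.death_M
  have h3 := D.k_pos
  unfold birth
  rw [h1, h2, if_neg one_ne_zero, if_neg (by omega)]

/-- The heart of the construction. Birth gives an element of the block in a set up to `i`; death
gives a set from `i` on with an element in a smaller block. By nesting, the former number belongs to
every set in between. -/
theorem meets_of_alive {b i : ℕ} (hb : b < D.M) (h1 : D.birth b ≤ i) (h2 : i < D.death b) :
    ∃ e < D.n, D.own e = i ∧ D.blk e = b := by
  have h3 : D.meet b = D.meetUpTo b D.n := if_neg hb.ne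
  have h4 : ∃ e < D.n, D.blk e = b ∧ D.own e ≤ i := by
    rw [← D.meetUpTo_le_iff le_rfl, ← h3]
    unfold birth at h1
    split_ifs at h1 <;> omega
  obtain ⟨e, h5, h6, h7⟩ := h4
  obtain ⟨j, h8, h9, h10⟩ := (D.lt_death_iff _ _).1 h2
  obtain ⟨e', h11, h12, h13⟩ := D.first_attained h9
  have h14 : D.xs e' ≤ D.xs e := by
    by_contra hc
    have : D.blk e ≤ D.blk e' := Nat.div_le_div_right (by omega)
    omega
  obtain ⟨e'', h15, h16, h17⟩ := D.nest e h5 e' h11 i h7 (by omega) h14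
  exact ⟨e'', h15, h16, by rw [← h6, blk, h17, blk]⟩

/-- The first set that meets the block is at most `own e`, hence precedes the death, and the cut-off
in `birth` does not act. -/
theorem birth_le_own {e : ℕ} (he : e < D.n) (h : D.own e < D.death (D.blk e)) :
    D.birth (D.blk e) ≤ D.own e := by
  have h3 : D.meet (D.blk e) = D.meetUpTo (D.blk e) D.n := if_neg (D.blk_lt he).ne
  have h4 := (D.meetUpTo_le_iff le_rfl (D.blk e) (D.own e)).2 ⟨e, he, rfl, le_rfl⟩
  rw [← h3] at h4
  unfold birth
  split_ifs <;> omega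

theorem lt_death {b i : ℕ} (hi : i < D.k) (h : D.first i < b) : i < D.death b :=
  (D.lt_death_iff _ _).2 ⟨i, le_rfl, hi, h⟩

/-- Beyond the first block of a set, meeting a block is a matter of time alone: death lies ahead, so
only the birth has to be tested. -/
theorem birth_le_iff {b i : ℕ} (hi : i < D.k) (h : D.first i < b) (hb : b < D.M) :
    D.birth b ≤ i ↔ ∃ e < D.n, D.own e = i ∧ D.blk e = b := by
  constructor
  · intro h1; exact D.meets_of_alive hb h1 (D.lt_death hi h)
  · rintro ⟨e, h1, rfl, rfl⟩
    exact D.birth_le_own h1 (D.lt_death hi h)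

theorem life_succ (b : ℕ) : D.life (b + 1) = D.life b + (D.death b - D.birth b) :=
  Finset.sum_range_succ _ _

theorem life_mono {b b' : ℕ} (h : b ≤ b') : D.life b ≤ D.life b' :=
  Finset.sum_le_sum_of_subset (Finset.range_mono h)

/-- A pair of a block and a time in its lifetime is the block and the set of some element, so there
are at most `n` such pairs. -/
theorem life_M_le : D.life D.M ≤ D.n := by
  have h1 : D.life D.M =
      ((Finset.range D.M).sigma fun b => Finset.Ico (D.birth b) (D.death b)).card := by
    simp [life, Finset.card_sigma]
  rw [h1, ← Finset.card_range D.n]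
  refine (Finset.card_le_card ?_).trans
    (Finset.card_image_le (f := fun e => (⟨D.blk e, D.own e⟩ : Σ _ : ℕ, ℕ)))
  rintro ⟨b, i⟩ h
  simp only [Finset.mem_sigma, Finset.mem_range, Finset.mem_Ico] at h
  obtain ⟨e, h2, h3, h4⟩ := D.meets_of_alive h.1 h.2.1 h.2.2
  simp only [Finset.mem_image, Finset.mem_range]
  exact ⟨e, h2, by rw [h3, h4]⟩

/-- The extra `k` pays for the sentinel block, which lives through all sets. -/
theorem life_le {b : ℕ} (hb : b ≤ D.M + 1) : D.life b ≤ D.n + D.k := by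
  have h1 := D.life_mono hb
  have h2 := D.life_M_le
  have h3 := D.death_le D.M
  rw [life_succ] at h1
  omega

theorem alive_succ (b i : ℕ) : D.alive (b + 1) i =
    D.alive b i + if D.birth b ≤ i ∧ i < D.death b then 1 else 0 := by
  unfold alive
  rw [Finset.range_add_one, Finset.filter_insert]
  split_ifs with h
  · rw [Finset.card_insert_of_notMem (by simp)]
  · rfl

theorem alive_mono {b b' : ℕ} (h : b ≤ b') (i : ℕ) : D.alive b i ≤ D.alive b' i :=
  Finset.card_le_card (Finset.filter_subset_filter _ (Finset.range_mono h))

theorem alive_eq {b s i : ℕ} (h : b ≤ s) (hs : ∀ s', b ≤ s' → s' < s → i < D.birth s') :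
    D.alive s i = D.alive b i := by
  induction s, h using Nat.le_induction with
  | base => rfl
  | succ s h ih =>
    have := hs s h (by omega)
    rw [alive_succ, ih fun s' h1 h2 => hs s' h1 (by omega), if_neg (by omega), Nat.add_zero]

theorem card_own (i : ℕ) (hi : i < D.k) :
    ((Finset.range D.n).filter fun e => D.own e = i).card = D.cnt i := by
  have h : ((Finset.range D.n).filter fun e => D.own e = i) =
      Finset.Ico (D.off i) (D.off (i + 1)) := by
    ext e
    simp only [Finset.mem_filter, Finset.mem_range, Finset.mem_Ico]
    constructor
    · rintro ⟨h1, rfl⟩; exact ⟨D.off_own_le h1, D.lt_off_own h1⟩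
    · rintro ⟨h1, h2⟩; exact ⟨h2.trans_le (D.off_le hi), D.own_eq hi h1 h2⟩
  rw [h, Nat.card_Ico, off_succ]; omega

theorem alive_le {b i : ℕ} (hb : b ≤ D.M) (hi : i < D.k) : D.alive b i ≤ D.cnt i := by
  rw [← D.card_own i hi]
  refine (Finset.card_le_card ?_).trans (Finset.card_image_le (f := D.blk))
  intro b' h
  simp only [Finset.mem_filter, Finset.mem_range, Finset.mem_image] at *
  obtain ⟨e, h1, h2, h3⟩ := D.meets_of_alive (by omega) h.2.1 h.2.2
  exact ⟨e, ⟨h1, h2⟩, h3⟩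

theorem two_off_le_top (i b : ℕ) : 2 * D.off i ≤ D.top i b := by
  unfold top; split_ifs <;> omega

/-- The largest number used for the set `i` is at most `2 * off i + 1 + cnt i`, and `1 + cnt i ≤ 2 *
cnt i` for a nonempty set. This is the reason for the factor `2` in `top`. -/
theorem top_le {i b : ℕ} (hi : i < D.k) (hb : b ≤ D.M) : D.top i b ≤ 2 * D.off (i + 1) := by
  have h1 := D.alive_le hb hi
  have h2 := D.cnt_pos i hi
  have h3 := D.off_succ i
  unfold top; split_ifs <;> omega

/-- Either the block of `e` is the first one of its set, whose number is below all later ones, or it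
is alive at `own e` and is therefore counted by `alive b`. -/
theorem top_lt_top {e b : ℕ} (he : e < D.n) (hb : D.blk e < b) :
    D.top (D.own e) (D.blk e) < D.top (D.own e) b := by
  have h1 := D.first_le he
  unfold top
  rw [if_neg (show ¬ b ≤ D.first (D.own e) by omega)]
  split_ifs with h
  · omega
  · have h3 := D.lt_death (D.own_lt e he) (not_le.1 h)
    have h2 := D.birth_le_own he h3
    have h4 := D.alive_succ (D.blk e) (D.own e)
    rw [if_pos ⟨h2, h3⟩] at h4
    have h5 := D.alive_mono hb (D.own e)
    simp only [Nat.succ_eq_add_one] at h5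
    omega

theorem top_mono {i b b' : ℕ} (h : b ≤ b') : D.top i b ≤ D.top i b' := by
  have := D.alive_mono h i
  unfold top; split_ifs <;> omega

theorem top_own_lt {e : ℕ} (he : e < D.n) : D.top (D.own e) (D.blk e) < 2 * D.off (D.own e + 1) :=
  (D.top_lt_top he (D.blk_lt he)).trans_le (D.top_le (D.own_lt e he) le_rfl)

theorem top_own_lt_two_mul {e : ℕ} (he : e < D.n) : D.top (D.own e) (D.blk e) < 2 * D.n :=
  (D.top_own_lt he).trans_le (Nat.mul_le_mul_left 2 (D.off_le (D.own_lt e he)))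

theorem top_injective {e e' : ℕ} (he : e < D.n) (he' : e' < D.n)
    (h : D.top (D.own e) (D.blk e) = D.top (D.own e') (D.blk e')) :
    D.own e = D.own e' ∧ D.blk e = D.blk e' := by
  have h1 := D.top_own_lt he
  have h2 := D.top_own_lt he'
  have h3 := D.two_off_le_top (D.own e) (D.blk e)
  have h4 := D.two_off_le_top (D.own e') (D.blk e')
  have h5 : D.own e = D.own e' := by
    rcases lt_trichotomy (D.own e) (D.own e') with h6 | h6 | h6
    · have := D.off_mono (show D.own e + 1 ≤ D.own e' from h6); omega
    · exact h6
    · have := D.off_mono (show D.own e' + 1 ≤ D.own e from h6); omega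
  refine ⟨h5, ?_⟩
  rcases lt_trichotomy (D.blk e) (D.blk e') with h6 | h6 | h6
  · have := D.top_lt_top he h6
    rw [h, h5] at this; omega
  · exact h6
  · have := D.top_lt_top he' h6
    rw [← h, h5] at this; omega

/-- The elements that are counted for a query are those in earlier top nodes and the smaller ones
in the top node of the query. -/
theorem top_spec {i x e : ℕ} (hi : i < D.k) (hx : x ≤ D.N) (he : e < D.n) :
    (D.own e < i ∨ D.own e = i ∧ D.xs e ≤ x) ↔
      (D.top (D.own e) (D.blk e) < D.top i (x / D.B) ∨
        (∃ e' < D.n, D.own e' = i ∧ D.blk e' = x / D.B) ∧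
          D.top (D.own e) (D.blk e) = D.top i (x / D.B) ∧ D.xs e % D.B ≤ x % D.B) := by
  have hb : x / D.B < D.M := Nat.lt_succ_of_le (Nat.div_le_div_right hx)
  set b := x / D.B with hbdef
  have h1 := D.top_own_lt he
  have h2 := D.two_off_le_top i b
  have h3 := D.two_off_le_top (D.own e) (D.blk e)
  have h4 := D.top_le hi hb.le
  rcases lt_trichotomy (D.own e) i with h6 | h6 | h6
  · have := D.off_mono (show D.own e + 1 ≤ i from h6)
    have : D.top (D.own e) (D.blk e) < D.top i b := by omega
    simp [h6, this]
  · have hxe : D.xs e = D.B * D.blk e + D.xs e % D.B := (Nat.div_add_mod _ _).symm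
    have hx' : x = D.B * b + x % D.B := (Nat.div_add_mod _ _).symm
    have hlt := Nat.mod_lt (D.xs e) D.B_pos
    have hlt' := Nat.mod_lt x D.B_pos
    rcases lt_trichotomy (D.blk e) b with h7 | h7 | h7
    · have h8 := D.top_lt_top he h7
      rw [h6] at h8
      have h9 : D.B * (D.blk e + 1) ≤ D.B * b := Nat.mul_le_mul_left _ h7
      rw [Nat.mul_add] at h9
      have h10 : D.xs e ≤ x := by omega
      simp [h6, h8, h10]
    · have h8 : ∃ e' < D.n, D.own e' = i ∧ D.blk e' = b := ⟨e, he, h6, h7⟩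
      rw [h7] at hxe ⊢
      rw [h6]
      simp only [h8, lt_irrefl, true_and, false_or]
      omega
    · have h9 : D.B * (b + 1) ≤ D.B * D.blk e := Nat.mul_le_mul_left _ h7
      rw [Nat.mul_add] at h9
      have h10 : ¬ D.xs e ≤ x := by omega
      have h11 := D.top_mono (i := i) h7.le
      rw [h6]
      simp only [lt_irrefl, h10, and_false, or_self, false_iff, not_or, not_lt]
      -- A later block may share its number with a query block that is not met; this is why the flag
      -- is needed. If `e'` lies in the query block, strict monotonicity separates the two numbers.
      refine ⟨h11, ?_⟩
      rintro ⟨⟨e', h12, h13, h14⟩, h15, -⟩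
      have := D.top_lt_top h12 (h14.trans_lt h7)
      rw [h13, h14] at this
      omega
  · have h7 := D.off_mono (show i + 1 ≤ D.own e from h6)
    have h8 : ¬ D.top (D.own e) (D.blk e) < D.top i b := by omega
    simp only [show ¬ D.own e < i by omega, show ¬ D.own e = i by omega, h8, false_and, or_self,
      false_or, false_iff]
    rintro ⟨⟨e', h12, h13, h14⟩, h15, -⟩
    have := D.top_own_lt h12
    rw [h13, h14] at this
    omega

theorem card_before {i : ℕ} (hi : i < D.k) (x : ℕ) :
    ((Finset.range D.n).filter fun e => D.own e < i ∨ D.own e = i ∧ D.xs e ≤ x).card =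
      D.off i + ((Finset.range D.n).filter fun e => D.own e = i ∧ D.xs e ≤ x).card := by
  rw [Finset.filter_or, Finset.card_union_of_disjoint]
  · congr 1
    have : ((Finset.range D.n).filter fun e => D.own e < i) = Finset.range (D.off i) := by
      ext e
      simp only [Finset.mem_filter, Finset.mem_range]
      constructor
      · rintro ⟨h1, h2⟩
        exact (D.lt_off_own h1).trans_le (D.off_mono h2)
      · intro h
        have h1 : e < D.n := h.trans_le (D.off_le hi.le)
        refine ⟨h1, ?_⟩
        by_contra hc
        have := D.off_mono (not_lt.1 hc)
        have := D.off_own_le h1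
        omega
    rw [this, Finset.card_range]
  · rw [Finset.disjoint_filter]
    intro e _ h2 h3; omega

end Family

end PISNS

/-! ### Word length, base-`W` digits, the nodes of the tries, and the next block born by a given
time -/

namespace PISNS

open WordRAM

/-- The length of a word is the position of its last 1 bit. -/
theorem select_rank {W v : ℕ} (hv : v < 2 ^ W) : select W v (rank v W) = v.size := by
  rcases Nat.eq_zero_or_pos v with rfl | h0
  · have : rank 0 W = 0 := by
      rw [rank, Nat.count_eq_card_filter_range]; simp
    simp [select, this]
  · obtain ⟨m, hm⟩ : ∃ m, v.size = m + 1 := ⟨v.size - 1, by have := Nat.size_pos.2 h0; omega⟩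
    have h1 : v < 2 ^ (m + 1) := by rw [← hm]; exact Nat.lt_size_self v
    have h2 : 2 ^ m ≤ v := Nat.lt_size.1 (by omega)
    have h3 : v.testBit m = true := by
      rw [Nat.testBit_eq_decide_div_mod_eq]
      have : v / 2 ^ m = 1 := by
        rw [Nat.div_eq_iff (by positivity)]
        rw [pow_succ] at h1
        omega
      simp [this]
    have h4 : m < W := (Nat.pow_lt_pow_iff_right (by norm_num)).1 (h2.trans_lt hv)
    have h5 : rank v W = rank v m + 1 := by
      unfold rank
      have h6 : Nat.count (fun b => v.testBit b = true) (m + 1) =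
          Nat.count (fun b => v.testBit b = true) m + 1 := by
        rw [Nat.count_succ, if_pos h3]
      rw [← h6]
      obtain ⟨c, rfl⟩ := Nat.exists_eq_add_of_lt h4
      clear hv h4
      induction c with
      | zero => rfl
      | succ c ih =>
        rw [show m + (c + 1) + 1 = (m + c + 1) + 1 by ring, Nat.count_succ, ih,
          Nat.testBit_lt_two_pow (h1.trans_le (Nat.pow_le_pow_right (by norm_num) (by omega)))]
        rfl
    have h7 : rank v m + 1 ≤ rank v W := h5.ge
    rw [select, if_pos ⟨by omega, le_rfl⟩, h5, Nat.add_sub_cancel, hm]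
    congr 1
    exact Nat.nth_count h3

theorem mod_pow_le_iff {W : ℕ} (hW : 0 < W) (m x y : ℕ) :
    x % W ^ (m + 1) ≤ y % W ^ (m + 1) ↔ x / W ^ m % W < y / W ^ m % W ∨
      x / W ^ m % W = y / W ^ m % W ∧ x % W ^ m ≤ y % W ^ m := by
  rw [Nat.mod_pow_succ, Nat.mod_pow_succ]
  have h1 := Nat.mod_lt x (show 0 < W ^ m by positivity)
  have h2 := Nat.mod_lt y (show 0 < W ^ m by positivity)
  set P := W ^ m
  rcases lt_trichotomy (x / P % W) (y / P % W) with h | h | h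
  · have := Nat.mul_le_mul_left P (show x / P % W + 1 ≤ y / P % W from h)
    rw [Nat.mul_add] at this
    constructor
    · intro; exact Or.inl h
    · intro; omega
  · rw [h]; simp
  · have := Nat.mul_le_mul_left P (show y / P % W + 1 ≤ x / P % W from h)
    rw [Nat.mul_add] at this
    constructor
    · intro; omega
    · intro; omega

/-- The bitmap of the node `u`, as far as the elements below `m` are concerned. -/
def bitsUpTo (v dg : ℕ → ℕ) (u : ℕ) : ℕ → ℕ
  | 0 => 0
  | e + 1 => if v e = u then bitsUpTo v dg u e ||| 2 ^ dg e else bitsUpTo v dg u e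

theorem testBit_bitsUpTo (v dg : ℕ → ℕ) (m u d : ℕ) :
    (bitsUpTo v dg u m).testBit d = true ↔ ∃ e < m, v e = u ∧ dg e = d := by
  induction m with
  | zero => simp [bitsUpTo]
  | succ m ih =>
    have h1 : (∃ e < m + 1, v e = u ∧ dg e = d) ↔
        (∃ e < m, v e = u ∧ dg e = d) ∨ v m = u ∧ dg m = d := by
      constructor
      · rintro ⟨e, h1, h2⟩
        rcases Nat.lt_succ_iff_lt_or_eq.1 h1 with h | rfl
        · exact Or.inl ⟨e, h, h2⟩
        · exact Or.inr h2
      · rintro (⟨e, h1, h2⟩ | h)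
        · exact ⟨e, by omega, h2⟩
        · exact ⟨m, by omega, h⟩
    rw [h1, ← ih, bitsUpTo]
    split_ifs with h
    · simp [Nat.testBit_or, Nat.testBit_two_pow, h]
    · simp [h]

/-- The `j`-th of `tt` digits in base `W`, the most significant first. -/
def digit (W tt j x : ℕ) : ℕ := x / W ^ (tt - 1 - j) % W

namespace Family

variable (D : Family)

/-- The number of the node of an element after `j` levels. -/
noncomputable def node (W tt : ℕ) : ℕ → ℕ → ℕ
  | 0, e => D.top (D.own e) (D.blk e)
  | j + 1, e => child W (fun u => bitsUpTo (node W tt j) (fun e => digit W tt j (D.xs e)) u D.n)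
      (node W tt j e) (digit W tt j (D.xs e))

/-- The bitmap of a node of level `j`. -/
noncomputable def bits (W tt j u : ℕ) : ℕ :=
  bitsUpTo (D.node W tt j) (fun e => digit W tt j (D.xs e)) u D.n

theorem node_succ (W tt j e : ℕ) : D.node W tt (j + 1) e =
    child W (D.bits W tt j) (D.node W tt j e) (digit W tt j (D.xs e)) := rfl

theorem testBit_bits (W tt j u d : ℕ) : (D.bits W tt j u).testBit d = true ↔
    ∃ e < D.n, D.node W tt j e = u ∧ digit W tt j (D.xs e) = d := testBit_bitsUpTo _ _ _ _ _

section

variable {D} {W tt : ℕ}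

theorem digit_lt (hW : 0 < W) (j x : ℕ) : digit W tt j x < W := Nat.mod_lt _ hW

theorem digit_mod_le_iff (hW : 0 < W) {j : ℕ} (hj : j < tt) (x y : ℕ) :
    x % W ^ (tt - j) ≤ y % W ^ (tt - j) ↔ digit W tt j x < digit W tt j y ∨
      digit W tt j x = digit W tt j y ∧ x % W ^ (tt - (j + 1)) ≤ y % W ^ (tt - (j + 1)) := by
  have h := mod_pow_le_iff hW (tt - 1 - j) x y
  rw [show tt - 1 - j + 1 = tt - j by omega] at h
  rw [h, digit, digit, show tt - (j + 1) = tt - 1 - j by omega]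

/-- The top nodes have numbers below `2 * n`, and on deeper levels there are at most `n` nodes. -/
theorem node_lt (hW : 0 < W) {j e : ℕ} (he : e < D.n) : D.node W tt j e < 2 * D.n := by
  cases j with
  | zero => exact D.top_own_lt_two_mul he
  | succ j =>
    rw [node_succ]
    have h1 := child_lt (bm := D.bits W tt j) (digit_lt hW j (D.xs e))
      ((D.testBit_bits W tt j _ _).2 ⟨e, he, rfl, rfl⟩)
    have h2 := baseOf_le (W := W) (D.testBit_bits W tt j) (D.node W tt j e + 1)
    omega

/-- The top node fixes the set and the block, and every level adds one digit; together with the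
unread digits this determines the element. -/
theorem node_injective (hW : 0 < W) (hB : D.B = W ^ tt) {j : ℕ} (hj : j ≤ tt) {e e' : ℕ}
    (he : e < D.n) (he' : e' < D.n)
    (h : D.node W tt j e = D.node W tt j e') (hx : D.xs e % W ^ (tt - j) = D.xs e' % W ^ (tt - j)) :
    e = e' := by
  induction j with
  | zero =>
    obtain ⟨h1, h2⟩ := D.top_injective he he' h
    refine D.inj e he e' he' h1 ?_
    rw [Nat.sub_zero, ← hB] at hx
    rw [← Nat.div_add_mod (D.xs e) D.B, ← Nat.div_add_mod (D.xs e') D.B, hx]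
    change D.B * D.blk e + _ = D.B * D.blk e' + _
    rw [h2]
  | succ j ih =>
    rw [node_succ, node_succ] at h
    obtain ⟨h1, h2⟩ := child_injective (D.testBit_bits W tt j) (fun e _ => digit_lt hW j (D.xs e))
      he he' h
    refine ih (by omega) h1 (le_antisymm ?_ ?_)
    · rw [digit_mod_le_iff hW (by omega)]
      exact Or.inr ⟨h2, hx.le⟩
    · rw [digit_mod_le_iff hW (by omega)]
      exact Or.inr ⟨h2.symm, hx.ge⟩

end

/-- After `j` levels, the elements counted for the query `(i, x)` are those in the nodes before
`r` and, if `ex` holds, the elements of the node `r` with at most the remaining digits of `x`. -/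
def Reached (W tt i x j r : ℕ) (ex : Prop) : Prop :=
  r ≤ 2 * D.n ∧ ∀ e < D.n, (D.own e < i ∨ D.own e = i ∧ D.xs e ≤ x) ↔
    (D.node W tt j e < r ∨ ex ∧ D.node W tt j e = r ∧ D.xs e % W ^ (tt - j) ≤ x % W ^ (tt - j))

variable {D}

theorem reached_zero {W tt i x : ℕ} (hB : D.B = W ^ tt) (hi : i < D.k) (hx : x ≤ D.N) :
    D.Reached W tt i x 0 (D.top i (x / D.B)) (∃ e < D.n, D.own e = i ∧ D.blk e = x / D.B) := by
  refine ⟨(D.top_le hi (Nat.le_succ_of_le (Nat.div_le_div_right hx))).trans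
    (Nat.mul_le_mul_left 2 (D.off_le hi)), fun e he => ?_⟩
  rw [D.top_spec hi hx he, Nat.sub_zero, ← hB]
  rfl

/-- One digit of the comparison with `x` moves from the unread remainder into the node number. -/
theorem Reached.succ {W tt i x j r : ℕ} {ex : Prop} [Decidable ex]
    (h : D.Reached W tt i x j r ex) (hW : 0 < W) (hj : j < tt) :
    D.Reached W tt i x (j + 1) (descend W (D.bits W tt j) r (digit W tt j x) ex)
      (ex ∧ (D.bits W tt j r).testBit (digit W tt j x) = true) := by
  refine ⟨?_, fun e he => ?_⟩
  · have h1 : descend W (D.bits W tt j) r (digit W tt j x) ex ≤ baseOf W (D.bits W tt j) (r + 1) :=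
      child_le (by split_ifs <;> [exact (digit_lt hW j x).le; exact Nat.zero_le _])
    have h2 := baseOf_le (W := W) (D.testBit_bits W tt j) (r + 1)
    omega
  · rw [h.2 e he, digit_mod_le_iff hW hj, descend_spec (D.testBit_bits W tt j)
      (fun e _ => digit_lt hW j (D.xs e)) r (digit_lt hW j x) ex he]
    rfl

/-- The answer after the last level. -/
theorem Reached.answer {W tt i x j r : ℕ} {ex : Prop} [Decidable ex]
    (h : D.Reached W tt i x j r ex) (hW : 0 < W) (hB : D.B = W ^ tt) (hj : j + 1 = tt)
    (hi : i < D.k) :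
    (descend W (D.bits W tt j) r (digit W tt j x) ex +
      if ex ∧ (D.bits W tt j r).testBit (digit W tt j x) = true then 1 else 0) =
      D.off i + ((Finset.range D.n).filter fun e => D.own e = i ∧ D.xs e ≤ x).card := by
  rw [← D.card_before hi x, ← card_descend (D.testBit_bits W tt j)
      (fun e _ => digit_lt hW j (D.xs e)) _ r (digit_lt hW j x) ex]
  · congr 1
    refine Finset.filter_congr fun e he => ?_
    rw [(h.succ hW (by omega)).2 e (Finset.mem_range.1 he)]
    subst hj
    simp [node_succ, Nat.mod_one]
  · intro e he e' he' h1 h2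
    -- On the last level a single digit is left, so it is the whole remainder.
    refine node_injective hW hB (by omega) he he' h1 ?_
    have : tt - j = 1 := by omega
    rw [this]
    simpa [digit, show tt - 1 - j = 0 by omega] using h2

variable (D)

/-! ## The next block born by a given time -/

open Classical in
/-- The first block from `b` on that is born by the time `τ`. -/
noncomputable def next (b τ : ℕ) : ℕ := sInf {s | b ≤ s ∧ D.birth s ≤ τ}

variable {D}

/-- The sentinel is born at time `0`, so there always is a block to be found. -/
theorem next_spec {b : ℕ} (hb : b ≤ D.M) (τ : ℕ) :
    b ≤ D.next b τ ∧ D.next b τ ≤ D.M ∧ D.birth (D.next b τ) ≤ τ := by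
  have h1 : D.M ∈ {s | b ≤ s ∧ D.birth s ≤ τ} := ⟨hb, by rw [D.birth_M]; exact Nat.zero_le _⟩
  have h2 := Nat.sInf_mem ⟨_, h1⟩
  exact ⟨h2.1, Nat.sInf_le h1, h2.2⟩

theorem lt_birth_of_lt_next {b s τ : ℕ} (h1 : b ≤ s) (h2 : s < D.next b τ) : τ < D.birth s := by
  by_contra hc
  have : D.next b τ ≤ s := Nat.sInf_le ⟨h1, not_lt.1 hc⟩
  omega

theorem next_eq_of {b s τ : ℕ} (h1 : b ≤ s) (h2 : D.birth s ≤ τ)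
    (h3 : ∀ s', b ≤ s' → s' < s → τ < D.birth s') : D.next b τ = s := by
  have h4 : D.next b τ ≤ s := Nat.sInf_le ⟨h1, h2⟩
  have h5 : D.next b τ ∈ {s | b ≤ s ∧ D.birth s ≤ τ} := Nat.sInf_mem ⟨s, h1, h2⟩
  by_contra hc
  have h6 := h3 _ h5.1 (by omega)
  have h7 : D.birth (D.next b τ) ≤ τ := h5.2
  omega

theorem next_self {b τ : ℕ} (h : D.birth b ≤ τ) : D.next b τ = b :=
  next_eq_of le_rfl h fun _ h1 h2 => by omega

theorem next_skip {b s τ : ℕ} (h1 : b ≤ s) (hs : s ≤ D.M)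
    (h : ∀ s', b ≤ s' → s' < s → τ < D.birth s') : D.next b τ = D.next s τ := by
  obtain ⟨h2, h3, h4⟩ := next_spec hs τ
  refine next_eq_of (h1.trans h2) h4 fun s' h5 h6 => ?_
  by_cases h7 : s' < s
  · exact h s' h5 h7
  · exact lt_birth_of_lt_next (not_lt.1 h7) h6

/-- If the time is not yet `τ` at the block `s` reached by a jump over the largest possible power
of two, then the rest of the way is covered by the ladder of `s`. -/
theorem next_jump {b τ : ℕ} (hb : b < D.M) (h : τ < D.birth b) {j : ℕ}
    (h1 : 2 ^ j ≤ D.birth b - τ) (h2 : D.birth b - τ < 2 ^ (j + 1)) :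
    D.birth (D.next (b + 1) (D.birth b - 2 ^ j)) ≤ τ ∧
        D.next b τ = D.next (b + 1) (D.birth b - 2 ^ j) ∨
      τ < D.birth (D.next (b + 1) (D.birth b - 2 ^ j)) ∧
        D.next (b + 1) (D.birth b - 2 ^ j) < D.M ∧
        D.birth (D.next (b + 1) (D.birth b - 2 ^ j)) - τ ≤
          D.death (D.next (b + 1) (D.birth b - 2 ^ j)) -
            D.birth (D.next (b + 1) (D.birth b - 2 ^ j)) ∧
        D.next b τ = D.next (D.next (b + 1) (D.birth b - 2 ^ j) + 1) τ := by
  obtain ⟨h3, h4, h5⟩ := next_spec (show b + 1 ≤ D.M from hb) (D.birth b - 2 ^ j)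
  have h6 : ∀ s', b ≤ s' → s' < D.next (b + 1) (D.birth b - 2 ^ j) → τ < D.birth s' := by
    intro s' h6 h7
    rcases h6.eq_or_lt with rfl | h8
    · exact h
    · have := lt_birth_of_lt_next h8 h7
      omega
  generalize D.next (b + 1) (D.birth b - 2 ^ j) = s at *
  by_cases h7 : D.birth s ≤ τ
  · exact Or.inl ⟨h7, next_eq_of (by omega) h7 h6⟩
  · have h8 : s ≠ D.M := by
      rintro rfl
      rw [D.birth_M] at h7
      omega
    -- Since `birth b ≤ death b ≤ death s`, the lifetime of `s` is at least `birth b - birth s ≥ 2 ^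
    -- j`, whereas the remaining distance `birth s - τ` is less than `2 ^ j`.
    have h9 := D.birth_le_death b
    have h10 := D.death_mono (show b ≤ s by omega)
    rw [pow_succ] at h2
    refine Or.inr ⟨by omega, by omega, by omega, ?_⟩
    refine next_skip (by omega) (by omega) fun s' h11 h12 => ?_
    rcases Nat.lt_succ_iff_lt_or_eq.1 h12 with h13 | rfl
    · exact h6 s' h11 h13
    · omega

/-- The blocks passed over are not yet born, so a table entry at the next born block also serves the
block of the query. -/
theorem alive_next {b τ : ℕ} (hb : b ≤ D.M) : D.alive (D.next b τ) τ = D.alive b τ :=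
  D.alive_eq (next_spec hb τ).1 fun _ h1 h2 => lt_birth_of_lt_next h1 h2

end Family

end PISNS

/-! ### Parameters and registers of the programs -/

namespace PISNS

open WordRAM
open WordRAM.Expr (reg const bin wordSize)

/-- The machine is large enough for the family, and the read-only region holds the input (except
possibly for the universe size). -/
structure Setting (D : Family) (G : Layout) (tt : ℕ) : Prop where
  B_eq : D.B = G.W ^ tt
  W_pos : 0 < G.W
  tt_pos : 0 < tt
  -- The arrays hold: `0` offsets, `1` values, `2` owners, `3` first blocks, `4` last sets, `5`
  -- first meetings, `6` deaths, `7` births, `8` sums of lifetimes, `9` counters, `10` top nodes,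
  -- `11` jumps, `12` ladders, `13` current nodes; then two for each level, `14 + 2 * j` bitmaps and
  -- `15 + 2 * j` first children.
  C_eq : G.C = 14 + 2 * tt
  H_eq : G.H = 2 + D.k + D.n
  two_n_lt : 2 * D.n < G.X
  n_add_k_lt : D.n + D.k < G.X
  M_lt : D.M + 1 < G.X
  jumps_le : (D.M + 1) * D.k.size ≤ G.X
  cap_le : G.H + 14 * G.X + 100 ≤ cap G.W
  N_lt : D.N < cap G.W
  B_lt : D.B < cap G.W
  inp_one : G.inp 1 = D.k
  inp_cnt : ∀ i < D.k, G.inp (2 + i) = D.cnt i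
  inp_xs : ∀ e < D.n, G.inp (2 + D.k + e) = D.xs e

/-- The registers from `100` on hold the parameters of the instance. -/
structure Consts (D : Family) (G : Layout) (σ : Store) : Prop where
  r100 : σ.regs 100 = G.H
  r101 : σ.regs 101 = D.k
  r102 : σ.regs 102 = D.n
  r103 : σ.regs 103 = D.M
  r104 : σ.regs 104 = D.B
  r105 : σ.regs 105 = D.k.size
  r106 : σ.regs 106 = D.M + 1
  r107 : σ.regs 107 = 2 * D.n

/-- The registers needed to access the tables. -/
structure Access (D : Family) (G : Layout) (σ : Store) : Prop where
  r100 : σ.regs 100 = G.H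
  r104 : σ.regs 104 = D.B
  r105 : σ.regs 105 = D.k.size

theorem Consts.access {D : Family} {G : Layout} {σ : Store} (h : Consts D G σ) : Access D G σ :=
  ⟨h.r100, h.r104, h.r105⟩

theorem Access.of_regs {D : Family} {G : Layout} {σ σ' : Store} (h : Access D G σ)
    (hf : ∀ r, 100 ≤ r → σ'.regs r = σ.regs r) : Access D G σ' := by
  constructor
  · rw [hf _ (by norm_num), h.r100]
  · rw [hf _ (by norm_num), h.r104]
  · rw [hf _ (by norm_num), h.r105]

theorem Consts.of_regs {D : Family} {G : Layout} {σ σ' : Store} (h : Consts D G σ)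
    (hf : ∀ r, 100 ≤ r → σ'.regs r = σ.regs r) : Consts D G σ' := by
  constructor
  · rw [hf _ (by norm_num), h.r100]
  · rw [hf _ (by norm_num), h.r101]
  · rw [hf _ (by norm_num), h.r102]
  · rw [hf _ (by norm_num), h.r103]
  · rw [hf _ (by norm_num), h.r104]
  · rw [hf _ (by norm_num), h.r105]
  · rw [hf _ (by norm_num), h.r106]
  · rw [hf _ (by norm_num), h.r107]

theorem Consts.frame {D : Family} {G : Layout} {σ σ' : Store} (h : Consts D G σ) {c : Cmd}
    (hf : c.Frame σ σ') (hc : ∀ r ∈ c.regs, r < 100) : Consts D G σ' :=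
  h.of_regs fun r hr => hf.1 r fun hr' => by have := hc r hr'; omega

theorem Consts.inner {D : Family} {G : Layout} {σ σ' : Store} (h : Consts D G σ) {c : Cmd} {r : ℕ}
    (hf : ∀ r', r' ∉ c.regs → r' ≠ r → σ'.regs r' = σ.regs r') (hc : ∀ r ∈ c.regs, r < 100)
    (hr : r < 100) : Consts D G σ' :=
  h.of_regs fun r' hr' => hf r' (fun h' => by have := hc r' h'; omega) (by omega)

/-- An expression for a power of the word size. -/
def powExpr : ℕ → Expr
  | 0 => const 1
  | m + 1 => powExpr m * wordSize

theorem powExpr_nat (W : ℕ) (ρ : ℕ → ℕ) (m : ℕ) : (powExpr m).nat W ρ = W ^ m := by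
  induction m with
  | zero => rfl
  | succ m ih => simp [powExpr, ih, pow_succ]

theorem powExpr_fits {W : ℕ} (ρ : ℕ → ℕ) {m : ℕ} (hW : 0 < W) (h : W ^ m < cap W) :
    (powExpr m).Fits W ρ := by
  induction m with
  | zero => simpa [powExpr] using h
  | succ m ih =>
    have h1 : W ^ m ≤ W ^ (m + 1) := Nat.pow_le_pow_right hW (by omega)
    simp only [powExpr, Expr.fits_mul, Expr.fits_wordSize, powExpr_nat, Expr.nat_wordSize]
    exact ⟨ih (by omega), trivial, by rwa [← pow_succ]⟩

/-- The number of binary digits of the content of a register. -/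
def sizeExpr (r : ℕ) : Expr := bin .select (reg r) (bin .rank (reg r) wordSize)

theorem sizeExpr_nat {W : ℕ} {ρ : ℕ → ℕ} {r : ℕ} (h : ρ r < cap W) :
    (sizeExpr r).nat W ρ = (ρ r).size := by
  simp [sizeExpr, select_rank h]

@[simp] theorem sizeExpr_fits {W : ℕ} {ρ : ℕ → ℕ} {r : ℕ} : (sizeExpr r).Fits W ρ := by
  simp [sizeExpr]

/-! ## Reading the parameters -/

/-- Register `108` keeps `N` until the blocks are counted. The number `n` is not part of the input;
register `102` accumulates it from the cardinalities. -/
def setupRead : Cmd := .inp 101 (const 1) ;; .inp 108 (const 0) ;; .set 102 (const 0)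

def setupSum : Cmd := .for 2 101 (.inp 3 (const 2 + reg 2) ;; .set 102 (reg 102 + reg 3))

def setupParams (tt : ℕ) : Cmd :=
  .set 100 (const 2 + reg 101 + reg 102) ;; .set 104 (powExpr tt) ;;
  .set 103 (reg 108 / reg 104 + const 1) ;; .set 105 (sizeExpr 101) ;;
  .set 106 (reg 103 + const 1) ;; .set 107 (reg 102 + reg 102)

def setup (tt : ℕ) : Cmd :=
  setupRead ;; setupSum ;; setupParams tt

variable {D : Family} {G : Layout} {tt : ℕ}

theorem setup_does (S : Setting D G tt) (hN : G.inp 0 = D.N) (σ : Store) :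
    Does G (setup tt) (100 * D.k + (100 + (setupParams tt).cost)) σ fun σ' =>
      Consts D G σ' ∧ σ'.arr = σ.arr := by
  have hcap := S.cap_le
  have hn := S.two_n_lt
  have hk := S.n_add_k_lt
  have hH := S.H_eq
  have hM := S.M_lt
  have h1 : Does G setupRead setupRead.cost σ
      fun σ' => σ'.regs 101 = D.k ∧ σ'.regs 108 = D.N ∧ σ'.regs 102 = 0 ∧ σ'.arr = σ.arr := by
    apply Does.of_wp
    simp [setupRead, Cmd.wp, hN, S.inp_one]
    omega
  have h2 : ∀ σ' : Store, σ'.regs 101 = D.k ∧ σ'.regs 108 = D.N ∧ σ'.regs 102 = 0 ∧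
      σ'.arr = σ.arr → Does G setupSum (100 * D.k + 6) σ' fun σ'' => σ''.regs 102 = D.n := by
    intro σ' ⟨k1, k2, k3, k4⟩
    refine (Does.for (fun i σ' => σ'.regs 102 = D.off i) (fun _ => 10) D.k k1 (by decide)
      (by decide) (by decide) (by omega) (by simp [k3, D.off_zero]) ?_).mono ?_ ?_
    · intro i hi σ'' hI hr _ _
      refine (Does.of_wp ?_).mono (show Cmd.cost _ ≤ _ by decide) fun _ _ h => h
      have := D.off_le (show i + 1 ≤ D.k from hi)
      have h3 := D.off_succ i
      simp [Cmd.wp, hI, hr, S.inp_cnt i hi, h3]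
      omega
    · simp; omega
    · intro σ'' _ h
      rw [h, D.off_k]
  refine (Does.seq h1 fun σ1 _ h => Does.seq (h2 σ1 h) (P := fun σ'' => σ''.regs 102 = D.n)
    fun σ2 hf h' => Does.of_wp (Q := fun σ' => Consts D G σ' ∧ σ'.arr = σ.arr) ?_).mono ?_
    fun _ _ h => h
  · obtain ⟨k1, k2, k3, k4⟩ := h
    have k5 : σ2.regs 101 = D.k := by rw [hf.1 _ (by decide), k1]
    have k6 : σ2.regs 108 = D.N := by rw [hf.1 _ (by decide), k2]
    have k7 : σ2.arr = σ.arr := by rw [← k4]; funext q; exact hf.2 q (by decide +revert)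
    have hp := S.B_eq ▸ S.B_lt
    have hM' : D.N / G.W ^ tt + 1 = D.M := by rw [← S.B_eq]; rfl
    simp [setupParams, Cmd.wp, k5, k6, h', powExpr_nat, powExpr_fits _ S.W_pos hp, hM', k7]
    rw [sizeExpr_nat (by simp [k5]; omega)]
    refine ⟨by omega, by omega, by omega, by omega, ?_⟩
    constructor <;> simp [k5, h', S.B_eq, hH]
    omega
  · simp [setupRead, Cmd.cost, Expr.cost]; omega

/-! ## Reading the lists -/

/-- Register `2` runs through all elements. Array `3` starts a minimum at `M`. The counter of a set
in array `9` starts at `2 * off i + 1`, since `2 * off i` is reserved for the blocks up to the first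
one. -/
def listsHead : Cmd :=
  .inp 4 (const 2 + reg 3) ;; .st 0 (reg 3) (reg 2) ;; .st 3 (reg 3) (reg 103) ;;
  .st 9 (reg 3) (reg 2 + reg 2 + const 1)

def listsElem : Cmd :=
  .inp 6 (const 2 + reg 101 + reg 2) ;; .st 1 (reg 2) (reg 6) ;; .st 2 (reg 2) (reg 3) ;;
  .set 2 (reg 2 + const 1)

def lists : Cmd := .set 2 (const 0) ;; .for 3 101 (listsHead ;; .for 5 4 listsElem)

theorem lists_does (S : Setting D G tt) {σ : Store} (hσ : Consts D G σ) :
    Does G lists (100 * (D.k + D.n)) σ fun σ' =>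
      (∀ i < D.k, σ'.arr 0 i = D.off i) ∧ (∀ i < D.k, σ'.arr 3 i = D.M) ∧
      (∀ i < D.k, σ'.arr 9 i = 2 * D.off i + 1) ∧
      (∀ e < D.n, σ'.arr 1 e = D.xs e) ∧ (∀ e < D.n, σ'.arr 2 e = D.own e) := by
  have hcap := S.cap_le
  have hn := S.two_n_lt
  have hk := S.n_add_k_lt
  have hH := S.H_eq
  have hC := S.C_eq
  have h1 : Does G (.set 2 (const 0)) 2 σ fun σ' => σ'.regs 2 = 0 := by
    refine (Does.of_wp ?_).mono (le_of_eq (by decide)) fun _ _ h => h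
    simp [Cmd.wp]; omega
  refine (Does.seq h1 fun σ1 hf1 k1 => (Does.for (fun i σ' => σ'.regs 2 = D.off i ∧
    ((∀ i' < i, σ'.arr 0 i' = D.off i') ∧ (∀ i' < i, σ'.arr 3 i' = D.M) ∧
      (∀ i' < i, σ'.arr 9 i' = 2 * D.off i' + 1)) ∧
      (∀ e < D.off i, σ'.arr 1 e = D.xs e) ∧ (∀ e < D.off i, σ'.arr 2 e = D.own e))
      (fun i => 40 + (∑ r ∈ Finset.range (D.cnt i), (30 + 8) + 6)) D.k
      ((hσ.frame hf1 (by decide)).r101) (by decide) (by decide) (by decide) (by omega)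
      (by simp [k1, D.off_zero]) ?_)).mono ?_ ?_
  · intro i hi σ2 ⟨k2, ⟨k3, k4, k5⟩, k6, k7⟩ hr hf hfa
    have hσ2 : Consts D G σ2 := (hσ.frame hf1 (by decide)).inner hf (by decide) (by decide)
    have hoff := D.off_succ i
    have hoffle := D.off_le (show i + 1 ≤ D.k from hi)
    have h2 : Does G listsHead 40 σ2 fun σ' => σ'.regs 4 = D.cnt i ∧
        (∀ i' < i + 1, σ'.arr 0 i' = D.off i') ∧ (∀ i' < i + 1, σ'.arr 3 i' = D.M) ∧
        (∀ i' < i + 1, σ'.arr 9 i' = 2 * D.off i' + 1) := by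
      refine Does.block (by decide) fun Q' hQ => ?_
      simp [listsHead, Cmd.wp, hr, k2, hσ2.r100, hσ2.r103, S.inp_cnt i hi]
      refine ⟨by omega, by omega, by omega, by omega, hQ _ ⟨rfl, ?_, ?_, ?_⟩⟩ <;>
        simp only [Store.put_arr, Store.write_arr_self, Store.write_arr_ne, Nat.reduceBEq]
      · exact update_upto k3 rfl
      · exact update_upto k4 rfl
      · exact update_upto k5 (by omega)
    refine Does.seq h2 fun σ3 hf3 ⟨k8, k9, k10, k11⟩ => (Does.for (fun r σ' =>
      σ'.regs 2 = D.off i + r ∧ (∀ e < D.off i + r, σ'.arr 1 e = D.xs e) ∧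
        (∀ e < D.off i + r, σ'.arr 2 e = D.own e)) (fun _ => 30) (D.cnt i) k8 (by decide)
        (by decide) (by decide) (by omega) ?_ ?_).mono le_rfl ?_
    · simp [hf3.1 2 (by decide), hf3.2 1 (by decide), hf3.2 2 (by decide), k2]
      exact ⟨k6, k7⟩
    · intro r hr4 σ4 ⟨k12, k13, k14⟩ hr5 hf4 _
      have hσ4 : Consts D G σ4 := (hσ2.frame hf3 (by decide)).inner hf4 (by decide) (by decide)
      have hr3 : σ4.regs 3 = i := by
        rw [hf4 3 (by decide) (by decide), hf3.1 3 (by decide), hr]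
      have := S.inp_xs (D.off i + r) (by omega)
      have hown : D.own (D.off i + r) = i := D.own_eq hi (by omega) (by omega)
      refine Does.block (by decide) fun Q' hQ => ?_
      simp [listsElem, Cmd.wp, hr3, k12, hσ4.r100, hσ4.r101, this]
      refine ⟨by omega, by omega, by omega, by omega, hQ _ ⟨by simp; omega, ?_, ?_⟩⟩ <;>
        simp only [Store.put_arr, Store.write_arr_self, Store.write_arr_ne, Nat.reduceBEq]
      · exact update_upto k13 rfl
      · exact update_upto k14 hown.symm
    · intro σ5 hf5 ⟨k15, k16, k17⟩
      rw [← hoff] at k15 k16 k17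
      refine ⟨by simpa using k15, ⟨?_, ?_, ?_⟩, k16, k17⟩
      · rwa [Store.put_arr, hf5.2 0 (by decide)]
      · rwa [Store.put_arr, hf5.2 3 (by decide)]
      · rwa [Store.put_arr, hf5.2 9 (by decide)]
  · have : ∑ i ∈ Finset.range D.k, (40 + (∑ r ∈ Finset.range (D.cnt i), (30 + 8) + 6) + 8) =
        54 * D.k + 38 * D.n := by
      rw [← D.sum_cnt, Finset.mul_sum]
      simp only [Finset.sum_const, Finset.card_range, smul_eq_mul, Finset.sum_add_distrib]
      rw [Finset.sum_congr rfl fun i _ =>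
        mul_comm (D.cnt i) (30 + 8)]
      norm_num
      omega
    rw [this]
    have := D.k_pos
    omega
  · rintro σ' - ⟨-, ⟨k3, k4, k5⟩, k6, k7⟩
    rw [D.off_k] at k6 k7
    exact ⟨k3, k4, k5, k6, k7⟩

/-! ## First blocks, births and deaths -/

def meetsElem : Cmd :=
  .ld 3 1 (reg 2) ;; .set 4 (reg 3 / reg 104) ;; .ld 5 2 (reg 2) ;; .ld 6 3 (reg 5) ;;
  .ld 7 5 (reg 4) ;; .ite (bin .lt (reg 4) (reg 6)) (.st 3 (reg 5) (reg 4)) .skip ;;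
  .ite (reg 7) .skip (.st 5 (reg 4) (reg 5 + const 1))

/-- The value `0` in array `5` marks a block not met so far, as provided by the zero memory. The
final store makes the first set meet the sentinel. -/
def meets : Cmd := .for 2 102 meetsElem ;; .st 5 (reg 103) (const 1)

theorem meets_does (S : Setting D G tt) {σ : Store} (hσ : Consts D G σ)
    (hxs : ∀ e < D.n, σ.arr 1 e = D.xs e) (hown : ∀ e < D.n, σ.arr 2 e = D.own e)
    (h3 : ∀ i < D.k, σ.arr 3 i = D.M) (h5 : ∀ b < D.M, σ.arr 5 b = 0) :
    Does G meets (108 * D.n + 20) σ fun σ' =>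
      (∀ i < D.k, σ'.arr 3 i = D.first i) ∧ (∀ b < D.M + 1, σ'.arr 5 b = D.meet b) := by
  have hcap := S.cap_le
  have hn := S.two_n_lt
  have hk := S.n_add_k_lt
  have hM := S.M_lt
  have hC := S.C_eq
  have h1 : Does G (.for 2 102 meetsElem) (108 * D.n + 6) σ fun σ' =>
      (∀ i < D.k, σ'.arr 3 i = D.first i) ∧ (∀ b < D.M, σ'.arr 5 b = D.meetUpTo b D.n) := by
    refine (Does.for (fun e σ' => (∀ i < D.k, σ'.arr 3 i = D.firstUpTo i e) ∧
      (∀ b < D.M, σ'.arr 5 b = D.meetUpTo b e)) (fun _ => 100) D.n hσ.r102 (by decide)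
      (by decide) (by decide) (by omega) ⟨h3, h5⟩ ?_).mono ?_ fun _ _ h => h
    · intro e he σ1 ⟨k1, k2⟩ hr hf hfa
      have hσ1 := hσ.inner hf (by decide) (by decide)
      have hx : σ1.arr 1 e = D.xs e := by rw [hfa 1 (by decide), hxs e he]
      have ho : σ1.arr 2 e = D.own e := by rw [hfa 2 (by decide), hown e he]
      have hb : D.xs e / D.B = D.blk e := rfl
      have hol := D.own_lt e he
      have hbl := D.blk_lt he
      have f1 : D.blk e < D.firstUpTo (D.own e) e → ∀ i < D.k,
          Function.update (σ1.arr 3) (D.own e) (D.blk e) i = D.firstUpTo i (e + 1) := by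
        intro h i hi
        rw [Family.firstUpTo, Function.update_apply, k1 i hi]
        by_cases hi' : i = D.own e
        · subst hi'; simp [h]
        · simp [hi', Ne.symm hi']
      have f2 : D.firstUpTo (D.own e) e ≤ D.blk e → ∀ i < D.k,
          σ1.arr 3 i = D.firstUpTo i (e + 1) := by
        intro h i hi
        rw [Family.firstUpTo, k1 i hi, if_neg]
        rintro ⟨rfl, h'⟩
        omega
      have m1 : ¬ D.meetUpTo (D.blk e) e = 0 → ∀ b < D.M,
          σ1.arr 5 b = D.meetUpTo b (e + 1) := by
        intro h b hb
        rw [Family.meetUpTo, k2 b hb, if_neg]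
        rintro ⟨rfl, h'⟩
        exact h h'
      have m2 : D.meetUpTo (D.blk e) e = 0 → ∀ b < D.M,
          Function.update (σ1.arr 5) (D.blk e) (D.own e + 1) b = D.meetUpTo b (e + 1) := by
        intro h b hb
        rw [Family.meetUpTo, Function.update_apply, k2 b hb]
        by_cases hb' : b = D.blk e
        · subst hb'; simp [h]
        · simp [hb', Ne.symm hb']
      refine Does.block (by decide) fun Q' hQ => ?_
      simp [meetsElem, Cmd.wp, hr, hx, ho, hb, hσ1.r100, hσ1.r104, k1 _ hol, k2 _ hbl]
      refine ⟨by omega, by omega, by omega, by omega,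
        fun h => ⟨by omega, fun h' => hQ _ ⟨?_, ?_⟩, fun h' => ⟨by omega, hQ _ ⟨?_, ?_⟩⟩⟩,
        fun h => ⟨fun h' => hQ _ ⟨?_, ?_⟩, fun h' => ⟨by omega, hQ _ ⟨?_, ?_⟩⟩⟩⟩ <;>
        simp only [Store.put_arr, Store.write_arr_self, Store.write_arr_ne, Nat.reduceBEq]
      exacts [f1 h, m1 h', f1 h, m2 h', f2 h, m1 h', f2 h, m2 h']
    · simp; omega
  refine (Does.seq h1 fun σ1 hf ⟨k1, k2⟩ => Does.block (T := 14) (by decide) fun Q' hQ => ?_).mono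
    (by omega) fun _ _ h => h
  have hσ1 := hσ.frame hf (by decide)
  simp [Cmd.wp, hσ1.r100, hσ1.r103]
  refine ⟨by omega, hQ _ ⟨k1, ?_⟩⟩
  rw [Store.write_arr_self]
  refine update_upto (fun b hb => ?_) (by simp [Family.meet])
  rw [k2 b hb, Family.meet, if_neg hb.ne]

/-- Later sets overwrite earlier ones, so the last set starting in a block remains. -/
def lastsSet : Cmd := .ld 3 3 (reg 2) ;; .st 4 (reg 3) (reg 2 + const 1)

def lasts : Cmd := .for 2 101 lastsSet

theorem lasts_does (S : Setting D G tt) {σ : Store} (hσ : Consts D G σ)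
    (h3 : ∀ i < D.k, σ.arr 3 i = D.first i) (h4 : ∀ b < D.M, σ.arr 4 b = 0) :
    Does G lasts (50 * D.k + 6) σ fun σ' => ∀ b < D.M, σ'.arr 4 b = D.lastUpTo b D.k := by
  have hcap := S.cap_le
  have hk := S.n_add_k_lt
  have hM := S.M_lt
  have hC := S.C_eq
  refine (Does.for (fun j σ' => ∀ b < D.M, σ'.arr 4 b = D.lastUpTo b j) (fun _ => 40) D.k hσ.r101
    (by decide) (by decide) (by decide) (by omega) h4 ?_).mono ?_ fun _ _ h => h
  · intro j hj σ1 k1 hr hf hfa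
    have hσ1 := hσ.inner hf (by decide) (by decide)
    have hx : σ1.arr 3 j = D.first j := by rw [hfa 3 (by decide), h3 j hj]
    have hb := D.first_lt hj
    refine Does.block (by decide) fun Q' hQ => ?_
    simp [lastsSet, Cmd.wp, hr, hx, hσ1.r100]
    refine ⟨by omega, by omega, hQ _ fun b hb => ?_⟩
    simp only [Store.put_arr, Store.write_arr_self, Family.lastUpTo]
    by_cases hb' : b = D.first j
    · subst hb'; simp
    · simp [hb', Ne.symm hb', k1 b hb]
  · simp; omega

/-- Register `2` carries the death of the current block, a running maximum, and register `3` the sum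
of the lifetimes so far. -/
def birthsSet : Cmd :=
  .ld 5 5 (reg 4) ;;
  .ite (reg 5) (.ite (bin .lt (reg 2) (reg 5)) (.set 6 (reg 2)) (.set 6 (reg 5 - const 1)))
    (.set 6 (reg 2)) ;;
  .st 6 (reg 4) (reg 2) ;; .st 7 (reg 4) (reg 6) ;; .st 8 (reg 4) (reg 3) ;;
  .set 3 (reg 3 + (reg 2 - reg 6)) ;; .ld 7 4 (reg 4) ;;
  .ite (bin .lt (reg 2) (reg 7)) (.set 2 (reg 7)) .skip

def births : Cmd := (.set 2 (const 0) ;; .set 3 (const 0)) ;; .for 4 106 birthsSet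

theorem births_does (S : Setting D G tt) {σ : Store} (hσ : Consts D G σ)
    (h5 : ∀ b < D.M + 1, σ.arr 5 b = D.meet b) (h4 : ∀ b < D.M, σ.arr 4 b = D.lastUpTo b D.k) :
    Does G births (150 * (D.M + 1) + 10) σ fun σ' =>
      (∀ b < D.M + 1, σ'.arr 6 b = D.death b) ∧ (∀ b < D.M + 1, σ'.arr 7 b = D.birth b) ∧
      (∀ b < D.M + 1, σ'.arr 8 b = D.life b) := by
  have hcap := S.cap_le
  have hk := S.n_add_k_lt
  have hM := S.M_lt
  have hC := S.C_eq
  have h1 : Does G (.set 2 (const 0) ;; .set 3 (const 0)) 4 σ fun σ' =>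
      σ'.regs 2 = 0 ∧ σ'.regs 3 = 0 := by
    refine Does.block (by decide) fun Q' hQ => ?_
    simp [Cmd.wp]
    exact ⟨by omega, hQ _ (by simp)⟩
  refine (Does.seq h1 fun σ0 hf0 ⟨k1, k2⟩ => Does.for (fun b σ' =>
    -- Array `4` is specified only below `M`, so nothing is claimed about register `2` after the
    -- round of the sentinel.
    (b < D.M + 1 → σ'.regs 2 = D.death b) ∧ σ'.regs 3 = D.life b ∧
    (∀ b' < b, σ'.arr 6 b' = D.death b') ∧ (∀ b' < b, σ'.arr 7 b' = D.birth b') ∧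
      (∀ b' < b, σ'.arr 8 b' = D.life b')) (fun _ => 142) (D.M + 1) (hσ.frame hf0 (by decide)).r106
    (by decide) (by decide) (by decide) (by omega) (by simp [k1, k2, Family.death, Family.life])
    ?_).mono ?_ fun _ _ h => h.2.2
  · intro b hb σ1 ⟨k1, k2, k3, k4, k5⟩ hr hf hfa
    have hσ1 := (hσ.frame hf0 (by decide)).inner hf (by decide) (by decide)
    have k1 := k1 hb
    have hx : σ1.arr 5 b = D.meet b := by rw [hfa 5 (by decide), hf0.2 5 (by decide), h5 b hb]
    have hbd := D.birth_le_death b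
    have hlife := D.life_le (show b + 1 ≤ D.M + 1 by omega)
    have hls := D.life_succ b
    have hdk := D.death_le b
    -- The common end of the three cases for the birth.
    have fin : ∀ σ2 : Store, σ2.regs 2 = D.death b → σ2.regs 3 = D.life b → σ2.regs 4 = b →
        σ2.regs 6 = D.birth b → σ2.arr = σ1.arr → σ2.regs 100 = G.H → ∀ Q' : Store → Prop,
        (∀ σ', ((b + 1 < D.M + 1 → (σ'.put 4 (b + 1)).regs 2 = D.death (b + 1)) ∧
          (σ'.put 4 (b + 1)).regs 3 = D.life (b + 1) ∧
          (∀ b' < b + 1, (σ'.put 4 (b + 1)).arr 6 b' = D.death b') ∧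
          (∀ b' < b + 1, (σ'.put 4 (b + 1)).arr 7 b' = D.birth b') ∧
          (∀ b' < b + 1, (σ'.put 4 (b + 1)).arr 8 b' = D.life b')) → Q' σ') →
        (Cmd.st 6 (reg 4) (reg 2) ;; Cmd.st 7 (reg 4) (reg 6) ;; Cmd.st 8 (reg 4) (reg 3) ;;
          Cmd.set 3 (reg 3 + (reg 2 - reg 6)) ;; Cmd.ld 7 4 (reg 4) ;;
          Cmd.ite (bin .lt (reg 2) (reg 7)) (.set 2 (reg 7)) .skip).wp G Q' σ2 := by
      intro σ2 r2 r3 r4 r6 ha r100 Q' hQ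
      have hd : b < D.M → D.death (b + 1) = max (D.death b) (σ1.arr 4 b) := by
        intro hb'
        rw [Family.death, hfa 4 (by decide), hf0.2 4 (by decide), h4 b hb']
      simp [Cmd.wp, r2, r3, r4, r6, ha, r100]
      refine ⟨by omega, by omega, by omega, by omega, by omega, fun h => hQ _ ?_,
        fun h => hQ _ ?_⟩
      · refine ⟨fun h' => ?_, ?_, ?_, ?_, ?_⟩
        · rw [hd (by omega)]; simp; omega
        · simp; omega
        all_goals
          simp only [Store.put_arr, Store.write_arr_self, Store.write_arr_ne, Nat.reduceBEq, ha]
        exacts [update_upto k3 rfl, update_upto k4 rfl, update_upto k5 rfl]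
      · refine ⟨fun h' => ?_, ?_, ?_, ?_, ?_⟩
        · rw [hd (by omega)]; simp [r2]; omega
        · simp; omega
        all_goals
          simp only [Store.put_arr, Store.write_arr_self, Store.write_arr_ne, Nat.reduceBEq, ha]
        exacts [update_upto k3 rfl, update_upto k4 rfl, update_upto k5 rfl]
    refine Does.block (by decide) fun Q' hQ => ?_
    rw [birthsSet]
    rw [Cmd.wp, Cmd.wp, Cmd.wp]
    have hbirth : D.birth b = if D.meet b = 0 then D.death b else
      if D.death b < D.meet b then D.death b else D.meet b - 1 := rfl
    refine ⟨⟨trivial, by simp [hr]; omega, by omega, hσ1.r100⟩, trivial, fun h => ?_, fun h => ?_⟩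
    · simp [hr, hx] at h
      rw [if_neg h] at hbirth
      simp only [Cmd.wp]
      refine ⟨by simp, fun h' => ⟨trivial, fin _ ?_ ?_ ?_ ?_ ?_ ?_ Q' hQ⟩,
        fun h' => ⟨?_, fin _ ?_ ?_ ?_ ?_ ?_ ?_ Q' hQ⟩⟩
      all_goals simp [hr, hx, k1, k2, hσ1.r100] at h' ⊢
      · rw [if_pos h'] at hbirth; exact hbirth.symm
      · rw [if_neg (by omega)] at hbirth; omega
      · rw [if_neg (by omega)] at hbirth; exact hbirth.symm
    · simp [hr, hx] at h
      rw [if_pos h] at hbirth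
      refine ⟨trivial, fin _ ?_ ?_ ?_ ?_ ?_ ?_ Q' hQ⟩
      all_goals simp [hr, k1, k2, hσ1.r100, hbirth]
  · simp; omega

/-! ## Numbering the top nodes -/

/-- The top nodes recorded for the block `b` in the table `f`. -/
def Family.Numbered (D : Family) (f : ℕ → ℕ) (b m : ℕ) : Prop :=
  ∀ r < m, f (D.life b + r) = 2 * D.off (D.birth b + r) + 1 + D.alive b (D.birth b + r)

theorem Family.life_add_lt (D : Family) {b b' r : ℕ} (h : b < b')
    (hr : r < D.death b - D.birth b) : D.life b + r < D.life b' := by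
  have h1 := D.life_succ b
  have h2 := D.life_mono (show b + 1 ≤ b' from h)
  omega

def idsHead : Cmd :=
  .ld 3 7 (reg 2) ;; .ld 4 6 (reg 2) ;; .set 4 (reg 4 - reg 3) ;; .ld 5 8 (reg 2)

/-- The counter of a set in array `9` advances whenever a block alive at that set has been passed,
so its value is the number of the top node for the current block. -/
def idsSet : Cmd :=
  .ld 7 9 (reg 3 + reg 6) ;; .st 10 (reg 5 + reg 6) (reg 7) ;;
  .st 9 (reg 3 + reg 6) (reg 7 + const 1)

def ids : Cmd := .for 2 106 (idsHead ;; .for 6 4 idsSet)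

theorem ids_does (S : Setting D G tt) {σ : Store} (hσ : Consts D G σ)
    (h9 : ∀ i < D.k, σ.arr 9 i = 2 * D.off i + 1) (h6 : ∀ b < D.M + 1, σ.arr 6 b = D.death b)
    (h7 : ∀ b < D.M + 1, σ.arr 7 b = D.birth b) (h8 : ∀ b < D.M + 1, σ.arr 8 b = D.life b) :
    Does G ids (100 * (D.M + 1) + 100 * (D.n + D.k) + 6) σ fun σ' =>
      ∀ b < D.M + 1, D.Numbered (σ'.arr 10) b (D.death b - D.birth b) := by
  have hcap := S.cap_le
  have hn := S.two_n_lt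
  have hk := S.n_add_k_lt
  have hM := S.M_lt
  have hC := S.C_eq
  refine (Does.for (fun b σ' => (∀ i < D.k, σ'.arr 9 i = 2 * D.off i + 1 + D.alive b i) ∧
    ∀ b' < b, D.Numbered (σ'.arr 10) b' (D.death b' - D.birth b'))
    (fun b => 50 + (∑ r ∈ Finset.range (D.death b - D.birth b), (50 + 8) + 6)) (D.M + 1) hσ.r106
    (by decide) (by decide) (by decide) (by omega) ⟨by simpa [Family.alive] using h9, by simp⟩
    ?_).mono ?_ fun _ _ h => h.2
  · intro b hb σ1 ⟨k1, k2⟩ hr hf hfa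
    have hσ1 := hσ.inner hf (by decide) (by decide)
    have x6 : σ1.arr 6 b = D.death b := by rw [hfa 6 (by decide), h6 b hb]
    have x7 : σ1.arr 7 b = D.birth b := by rw [hfa 7 (by decide), h7 b hb]
    have x8 : σ1.arr 8 b = D.life b := by rw [hfa 8 (by decide), h8 b hb]
    have hbd := D.birth_le_death b
    have hdk := D.death_le b
    have hlife := D.life_le (show b + 1 ≤ D.M + 1 by omega)
    have hls := D.life_succ b
    have h1 : Does G idsHead 50 σ1 fun σ' => σ'.regs 4 = D.death b - D.birth b ∧
        σ'.regs 3 = D.birth b ∧ σ'.regs 5 = D.life b := by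
      refine Does.block (by decide) fun Q' hQ => ?_
      simp [idsHead, Cmd.wp, hr, x6, x7, x8, hσ1.r100]
      exact ⟨by omega, by omega, by omega, by omega, hQ _ (by simp)⟩
    refine Does.seq h1 fun σ2 hf2 ⟨k3, k4, k5⟩ => (Does.for (fun r σ' =>
      (∀ i < D.k, σ'.arr 9 i = 2 * D.off i + 1 + D.alive b i +
        if D.birth b ≤ i ∧ i < D.birth b + r then 1 else 0) ∧
      (∀ b' < b, D.Numbered (σ'.arr 10) b' (D.death b' - D.birth b')) ∧
      D.Numbered (σ'.arr 10) b r) (fun _ => 50) (D.death b - D.birth b) k3 (by decide)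
        (by decide) (by decide) (by omega) ?_ ?_).mono le_rfl ?_
    · rw [Store.put_arr, hf2.2 9 (by decide), hf2.2 10 (by decide)]
      refine ⟨fun i hi => ?_, k2, fun r hr => by omega⟩
      rw [k1 i hi, if_neg (by omega)]
      omega
    · intro r hr2 σ3 ⟨k6, k7, k8⟩ hr6 hf3 _
      have hσ3 := (hσ1.frame hf2 (by decide)).inner hf3 (by decide) (by decide)
      have e3 : σ3.regs 3 = D.birth b := by rw [hf3 3 (by decide) (by decide), k4]
      have e5 : σ3.regs 5 = D.life b := by rw [hf3 5 (by decide) (by decide), k5]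
      have h9 := k6 (D.birth b + r) (by omega)
      rw [if_neg (by omega), Nat.add_zero] at h9
      have hal : D.alive b (D.birth b + r) ≤ b :=
        (Finset.card_filter_le _ _).trans (by simp)
      have hoff := D.off_le (show D.birth b + r ≤ D.k by omega)
      refine Does.block (by decide) fun Q' hQ => ?_
      simp [idsSet, Cmd.wp, hr6, e3, e5, hσ3.r100, h9]
      refine ⟨by omega, by omega, by omega, hQ _ ⟨?_, ?_, ?_⟩⟩ <;>
        simp only [Store.put_arr, Store.write_arr_self, Store.write_arr_ne, Nat.reduceBEq]
      · intro i hi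
        rw [Function.update_apply]
        split_ifs with h h' h'
        · rw [h]
        · omega
        · rw [k6 i hi, if_pos (by omega)]
        · rw [k6 i hi, if_neg (by omega)]
      · intro b' hb' r' hr'
        have := D.life_add_lt hb' hr'
        rw [Function.update_of_ne (by omega)]
        exact k7 b' hb' r' hr'
      · intro r' hr'
        rw [Function.update_apply]
        split_ifs with h
        · rw [show r' = r by omega]
        · exact k8 r' (by omega)
    · intro σ4 hf4 ⟨k9, k10, k11⟩
      refine ⟨fun i hi => ?_, fun b' hb' => ?_⟩
      · rw [Store.put_arr, k9 i hi, D.alive_succ, show D.birth b + (D.death b - D.birth b) =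
          D.death b by omega, Nat.add_assoc]
      · rcases Nat.lt_succ_iff_lt_or_eq.1 hb' with h | rfl
        · exact k10 b' h
        · exact k11
  -- The inner loops together run through all lifetimes, whose sum is at most `n + k`.
  · have h1 : D.life (D.M + 1) = ∑ b ∈ Finset.range (D.M + 1), (D.death b - D.birth b) := rfl
    have h2 := D.life_le (le_refl (D.M + 1))
    have h3 : ∑ b ∈ Finset.range (D.M + 1),
        (50 + (∑ r ∈ Finset.range (D.death b - D.birth b), (50 + 8) + 6) + 8) =
        64 * (D.M + 1) + 58 * D.life (D.M + 1) := by
      rw [h1, Finset.mul_sum]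
      simp only [Finset.sum_const, Finset.card_range, smul_eq_mul, Finset.sum_add_distrib]
      rw [Finset.sum_congr rfl fun i _ =>
        mul_comm (D.death i - D.birth i) (50 + 8)]
      norm_num
      omega
    rw [h3]
    omega

/-! ## Jumps and ladders -/

/-- The jump pointers of the block `b` in the table `f`. -/
def Family.Jumps (D : Family) (f : ℕ → ℕ) (b m : ℕ) : Prop :=
  ∀ j < m, f (b * D.k.size + j) = D.next (b + 1) (D.birth b - 2 ^ j)

/-- The ladder of the block `b` in the table `f`. -/
def Family.Ladder (D : Family) (f : ℕ → ℕ) (b m : ℕ) : Prop :=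
  ∀ r < m, f (D.life b + r) = D.next (b + 1) (D.birth b - (r + 1))

/-- The tables for the blocks from `b` on. -/
structure Family.Tables (D : Family) (A : ℕ → ℕ → ℕ) (b : ℕ) : Prop where
  birth : ∀ b < D.M + 1, A 7 b = D.birth b
  life : ∀ b < D.M + 1, A 8 b = D.life b
  jumps : ∀ b', b ≤ b' → b' < D.M → D.Jumps (A 11) b' (D.birth b').size
  ladder : ∀ b', b ≤ b' → b' < D.M →
    D.Ladder (A 12) b' (min (D.death b' - D.birth b') (D.birth b'))

/-- Put the first block from that in register `20` on which is born by the time in register `21`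
into register `22`. -/
def find : Cmd :=
  .ld 23 7 (reg 20) ;; .ite (bin .lt (reg 21) (reg 23))
    (.set 23 (reg 23 - reg 21) ;; .set 24 (sizeExpr 23 - const 1) ;;
      .ld 22 11 (reg 20 * reg 105 + reg 24) ;; .ld 23 7 (reg 22) ;;
      .ite (bin .lt (reg 21) (reg 23))
        (.set 23 (reg 23 - reg 21) ;; .ld 24 8 (reg 22) ;;
          .ld 22 12 (reg 24 + reg 23 - const 1))
        .skip)
    (.set 22 (reg 20))

/-- Births are at most `k`, so a row of length `k.size` holds all jumps of a block, and the rows of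
different blocks are disjoint. -/
theorem jump_index_lt (S : Setting D G tt) {b j : ℕ} (hb : b ≤ D.M) (hj : j < (D.birth b).size) :
    b * D.k.size ≤ b * D.k.size + j ∧ b * D.k.size + j < (b + 1) * D.k.size ∧
      (b + 1) * D.k.size ≤ G.X := by
  have h1 : (D.birth b).size ≤ D.k.size :=
    Nat.size_le_size ((D.birth_le_death b).trans (D.death_le b))
  have h2 : (b + 1) * D.k.size ≤ (D.M + 1) * D.k.size := Nat.mul_le_mul_right _ (by omega)
  have h3 := S.jumps_le
  have h4 : (b + 1) * D.k.size = b * D.k.size + D.k.size := by ring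
  omega

/-- The binary length of the distance, less one, is the exponent of the largest admissible jump. By
`Family.next_jump` one further look-up in a ladder finishes the search. Only tables from `b` on are
used. -/
theorem find_wp (S : Setting D G tt) {σ : Store} (hσ : Access D G σ) {b τ : ℕ}
    (hT : D.Tables σ.arr b) (hb : b ≤ D.M) (h20 : σ.regs 20 = b) (h21 : σ.regs 21 = τ)
    {Q : Store → Prop} (hQ : ∀ σ' : Store, σ'.regs 22 = D.next b τ → σ'.arr = σ.arr →
      (∀ r, r ∉ [22, 23, 24] → σ'.regs r = σ.regs r) → Q σ') : find.wp G Q σ := by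
  have hcap := S.cap_le
  have hk := S.n_add_k_lt
  have hM := S.M_lt
  have hC := S.C_eq
  have hx := hT.birth b (by omega)
  have hdk := D.death_le b
  have hbd := D.birth_le_death b
  rw [find, Cmd.wp]
  refine ⟨⟨trivial, by simp [h20]; omega, by omega, hσ.r100⟩, ?_⟩
  simp only [Expr.nat_reg, h20, hx]
  refine ⟨by simp, fun h => ?_, fun h => ?_⟩
  · have h : τ < D.birth b := by simpa [h21] using h
    have hbM : b < D.M := by
      rcases hb.lt_or_eq with h' | rfl
      · exact h'
      · rw [D.birth_M] at h; omega
    obtain ⟨j, hj⟩ : ∃ j, (D.birth b - τ).size = j + 1 :=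
      ⟨(D.birth b - τ).size - 1, by have := Nat.size_pos.2 (show 0 < D.birth b - τ by omega); omega⟩
    have hj1 : 2 ^ j ≤ D.birth b - τ := Nat.lt_size.1 (by omega)
    have hj2 : D.birth b - τ < 2 ^ (j + 1) := by rw [← hj]; exact Nat.lt_size_self _
    have hjs : j < (D.birth b).size := Nat.lt_size.2 (by omega)
    have hidx := jump_index_lt S hb hjs
    have hjump := hT.jumps b le_rfl hbM j hjs
    have hjmp := Family.next_jump hbM h hj1 hj2
    obtain ⟨hs1, hs2, -⟩ := Family.next_spec (show b + 1 ≤ D.M from hbM) (D.birth b - 2 ^ j)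
    generalize D.next (b + 1) (D.birth b - 2 ^ j) = s at *
    have hxs := hT.birth s (by omega)
    have hls := hT.life s (by omega)
    have hlife := D.life_le (show s + 1 ≤ D.M + 1 by omega)
    have hls' := D.life_succ s
    have hdk := D.death_le s
    have hbd := D.birth_le_death s
    have hsz : ∀ ρ : ℕ → ℕ, ρ 23 = D.birth b - τ → (sizeExpr 23).nat G.W ρ = j + 1 := by
      intro ρ hρ
      rw [sizeExpr_nat (by rw [hρ]; omega), hρ, hj]
    have hjX : j < cap G.W := by omega
    simp [Cmd.wp, h20, h21, hsz, hσ.r100, hσ.r105, hjump, hxs, hls]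
    refine ⟨by omega, by omega, by omega, by omega, fun h' => ?_, fun h' => ?_⟩
    · obtain ⟨h1, h2, h3, h4⟩ | ⟨h1, h2, h3, h4⟩ := hjmp
      · omega
      -- Entry `r` of a ladder belongs to the time `birth s - (r + 1)`, so the time `τ` has the
      -- index `birth s - τ - 1`.
      · have hlad := hT.ladder s (by omega) h2 (D.birth s - τ - 1) (by omega)
        rw [show D.life s + (D.birth s - τ - 1) = D.life s + (D.birth s - τ) - 1 by omega,
          show D.birth s - (D.birth s - τ - 1 + 1) = τ by omega, ← h4] at hlad
        refine ⟨by omega, by omega, by omega, hQ _ ?_ ?_ ?_⟩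
        · simpa using hlad
        · simp
        · intro r hr; simp at hr; simp [hr]
    · obtain ⟨h1, h2⟩ | ⟨h1, h2, h3, h4⟩ := hjmp
      · refine hQ _ (by simp [h2]) (by simp) ?_
        intro r hr; simp at hr; simp [hr]
      · omega
  · have h : D.birth b ≤ τ := by simpa [h21] using h
    refine ⟨trivial, hQ _ ?_ ?_ ?_⟩
    · simp [h20, Family.next_self h]
    · simp
    · intro r hr; simp at hr; simp [hr]

def jumpsHead : Cmd :=
  .set 3 (reg 103 - reg 2) ;; .ld 4 7 (reg 3) ;; .set 5 (sizeExpr 4) ;; .ld 6 6 (reg 3) ;;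
  .set 6 (reg 6 - reg 4) ;; .ite (bin .lt (reg 4) (reg 6)) (.set 6 (reg 4)) .skip ;;
  .ld 7 8 (reg 3)

def jumpsSet : Cmd :=
  (.set 20 (reg 3 + const 1) ;; .set 21 (reg 4 - bin .shl (const 1) (reg 8))) ;; find ;;
  .st 11 (reg 3 * reg 105 + reg 8) (reg 22)

def ladderSet : Cmd :=
  (.set 20 (reg 3 + const 1) ;; .set 21 (reg 4 - (reg 9 + const 1))) ;; find ;;
  .st 12 (reg 7 + reg 9) (reg 22)

/-- The blocks are treated from right to left. An entry of `b` asks for the next block from `b + 1`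
on, which `find` answers from the tables of the later blocks; so every entry takes constant time. -/
def jumps : Cmd := .for 2 106 (jumpsHead ;; .for 8 5 jumpsSet ;; .for 9 6 ladderSet)

theorem jumps_does (S : Setting D G tt) {σ : Store} (hσ : Consts D G σ)
    (h6 : ∀ b < D.M + 1, σ.arr 6 b = D.death b)
    (h7 : ∀ b < D.M + 1, σ.arr 7 b = D.birth b) (h8 : ∀ b < D.M + 1, σ.arr 8 b = D.life b) :
    Does G jumps ((D.M + 1) * (300 * D.k.size + 300) + 300 * (D.n + D.k) + 6) σ
      fun σ' => D.Tables σ'.arr 0 := by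
  have hcap := S.cap_le
  have hn := S.two_n_lt
  have hk := S.n_add_k_lt
  have hM := S.M_lt
  have hC := S.C_eq
  refine (Does.for (fun c σ' => D.Tables σ'.arr (D.M + 1 - c))
    (fun c => 100 + (∑ r ∈ Finset.range D.k.size, (200 + 8) + 6 +
      (∑ r ∈ Finset.range (D.death (D.M - c) - D.birth (D.M - c)), (200 + 8) + 6)))
    (D.M + 1) hσ.r106
    (by decide) (by decide) (by decide) (by omega) ?_
    ?_).mono ?_ fun _ _ h => by rwa [Nat.sub_self] at h
  · exact ⟨h7, h8, fun b h1 h2 => by omega, fun b h1 h2 => by omega⟩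
  · intro c hc σ1 hT hr hf hfa
    have hσ1 := hσ.inner hf (by decide) (by decide)
    obtain ⟨b, hb⟩ : ∃ b, b = D.M - c := ⟨_, rfl⟩
    rw [← hb]
    rw [show D.M + 1 - c = b + 1 by omega] at hT
    have hbM : b ≤ D.M := by omega
    have x6 : σ1.arr 6 b = D.death b := by rw [hfa 6 (by decide), h6 b (by omega)]
    have x7 := hT.birth b (by omega)
    have x8 := hT.life b (by omega)
    have hbd := D.birth_le_death b
    have hdk := D.death_le b
    have hlife := D.life_le (show b + 1 ≤ D.M + 1 by omega)
    have hls := D.life_succ b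
    have hsz : (D.birth b).size ≤ D.k.size := Nat.size_le_size (hbd.trans hdk)
    have hszk : D.k.size < cap G.W := by
      have : D.k.size ≤ D.k := by
        rw [Nat.size_le]; exact Nat.lt_two_pow_self
      omega
    -- The sentinel has birth `0`, hence neither jumps nor a ladder.
    have hne : ∀ {m : ℕ}, m < D.birth b → b < D.M := by
      intro m hm
      rcases hbM.lt_or_eq with h' | rfl
      · exact h'
      · rw [D.birth_M] at hm; omega
    have h1 : Does G jumpsHead 100 σ1 fun σ' => σ'.regs 3 = b ∧ σ'.regs 4 = D.birth b ∧
        σ'.regs 5 = (D.birth b).size ∧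
        σ'.regs 6 = min (D.death b - D.birth b) (D.birth b) ∧ σ'.regs 7 = D.life b := by
      refine Does.block (by decide) fun Q' hQ => ?_
      have hs : ∀ ρ : ℕ → ℕ, ρ 4 = D.birth b → (sizeExpr 4).nat G.W ρ = (D.birth b).size :=
        fun ρ hρ => by rw [sizeExpr_nat (by rw [hρ]; omega), hρ]
      simp [jumpsHead, Cmd.wp, hr, ← hb, x6, x7, x8, hσ1.r100, hσ1.r103, hs]
      exact ⟨by omega, by omega, by omega, by omega,
        fun h => ⟨by omega, hQ _ (by simp; omega)⟩, fun h => ⟨by omega, hQ _ (by simp; omega)⟩⟩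
    refine Does.seq h1 fun σ2 hf2 ⟨r3, r4, r5, r6, r7⟩ => ?_
    have hσ2 := hσ1.frame hf2 (by decide)
    have hT2 : D.Tables σ2.arr (b + 1) := by
      have : σ2.arr = σ1.arr := by funext q; exact hf2.2 q (by decide +revert)
      rwa [this]
    have h2 : Does G (.for 8 5 jumpsSet) (∑ r ∈ Finset.range D.k.size, (200 + 8) + 6) σ2
        fun σ' => D.Tables σ'.arr (b + 1) ∧ (b < D.M → D.Jumps (σ'.arr 11) b (D.birth b).size) := by
      refine (Does.for (fun j σ' => D.Tables σ'.arr (b + 1) ∧ (b < D.M → D.Jumps (σ'.arr 11) b j))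
        (fun _ => 200) (D.birth b).size r5 (by decide) (by decide) (by decide)
        (by omega) ⟨hT2, fun _ j hj => by omega⟩ ?_).mono ?_ fun _ _ h => h
      · intro j hj σ3 ⟨hT3, hJ⟩ hr3 hf3 _
        have hσ3 := hσ2.inner hf3 (by decide) (by decide)
        have e3 : σ3.regs 3 = b := by rw [hf3 3 (by decide) (by decide), r3]
        have e4 : σ3.regs 4 = D.birth b := by rw [hf3 4 (by decide) (by decide), r4]
        have hj' : 2 ^ j ≤ D.birth b := Nat.lt_size.1 hj
        have hbM' : b < D.M := hne (show 0 < D.birth b from lt_of_lt_of_le (by positivity) hj')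
        have hJ := hJ hbM'
        have hidx := jump_index_lt S hbM hj
        refine Does.block (by decide) fun Q' hQ => ?_
        rw [jumpsSet]
        simp only [Cmd.wp, Expr.fits_add, Expr.fits_sub, Expr.fits_shl, Expr.fits_reg,
          Expr.fits_const, Expr.nat_add, Expr.nat_sub, Expr.nat_shl, Expr.nat_reg, Expr.nat_const,
          Store.put_regs, e3, e4, hr3, one_mul, true_and, Nat.reduceEqDiff, if_false]
        refine ⟨by omega, by omega, find_wp S
          (σ := (σ3.put 20 (b + 1)).put 21 (D.birth b - 2 ^ j))
          (hσ3.access.of_regs fun r hr => ?_) hT3 hbM'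
          (by simp) (by simp; rfl) fun σ4 k1 k2 k3 => ?_⟩
        · simp only [Store.put_regs]
          rw [if_neg (by omega), if_neg (by omega)]
        · have hσ4 : Consts D G σ4 := hσ3.of_regs fun r hr => by
            rw [k3 r (by simp; omega)]
            simp only [Store.put_regs]
            rw [if_neg (by omega), if_neg (by omega)]
          have f3 : σ4.regs 3 = b := by rw [k3 3 (by decide)]; simp [e3]
          have f8 : σ4.regs 8 = j := by rw [k3 8 (by decide)]; simp [hr3]
          refine ⟨⟨?_, ?_, by omega, hσ4.r100⟩, hQ _ ⟨?_, fun _ => ?_⟩⟩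
          · simp only [Expr.fits_mul, Expr.fits_reg, Expr.nat_mul, Expr.nat_reg, f3, f8, hσ4.r105]
            exact ⟨⟨trivial, trivial, by omega⟩, by omega⟩
          · simp only [Expr.nat_mul, Expr.nat_reg, f3, f8, hσ4.r105]
            omega
          · simp only [Expr.nat_mul, Expr.nat_reg, f3, f8, hσ4.r105, k1]
            refine ⟨?_, ?_, fun b' h1 h2 => ?_, ?_⟩
            · simpa [k2] using hT3.birth
            · simpa [k2] using hT3.life
            · intro j' hj'
              have hidx' := jump_index_lt S h2.le hj'
              -- The rows of later blocks lie beyond the row that is being written.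
              have hm : (b + 1) * D.k.size ≤ b' * D.k.size := Nat.mul_le_mul_right _ h1
              simp only [Store.put_arr, Store.write_arr_self, k2]
              rw [Function.update_of_ne (by omega)]
              exact hT3.jumps b' h1 h2 j' hj'
            · simpa [k2] using hT3.ladder
          · simp only [Expr.nat_mul, Expr.nat_reg, f3, f8, hσ4.r105, k1,
              Store.put_arr, Store.write_arr_self, k2]
            intro j' hj'
            rw [Function.update_apply]
            split_ifs with h
            · rw [show j' = j by omega]
            · exact hJ j' (by omega)
      · simp only [Finset.sum_const, Finset.card_range, smul_eq_mul]
        have := Nat.mul_le_mul_right (200 + 8) hsz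
        omega
    refine Does.seq h2 fun σ3 hf3 ⟨hT3, hJ3⟩ => ?_
    have hσ3 := hσ2.frame hf3 (by decide)
    refine (Does.for (fun r σ' => D.Tables σ'.arr (b + 1) ∧
      (b < D.M → D.Jumps (σ'.arr 11) b (D.birth b).size) ∧ D.Ladder (σ'.arr 12) b r)
      (fun _ => 200) (min (D.death b - D.birth b) (D.birth b))
      (by rw [hf3.1 6 (by decide), r6]) (by decide) (by decide) (by decide)
      (by omega) ⟨hT3, hJ3, fun j hj => by omega⟩ ?_).mono ?_ ?_
    · intro r hrm σ4 ⟨hT4, hJ4, hL⟩ hr4 hf4 _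
      have hσ4 := hσ3.inner hf4 (by decide) (by decide)
      have e3 : σ4.regs 3 = b := by
        rw [hf4 3 (by decide) (by decide), hf3.1 3 (by decide), r3]
      have e4 : σ4.regs 4 = D.birth b := by
        rw [hf4 4 (by decide) (by decide), hf3.1 4 (by decide), r4]
      have e7 : σ4.regs 7 = D.life b := by
        rw [hf4 7 (by decide) (by decide), hf3.1 7 (by decide), r7]
      have hbM' : b < D.M := hne (show r < D.birth b by omega)
      refine Does.block (by decide) fun Q' hQ => ?_
      rw [ladderSet]
      simp only [Cmd.wp, Expr.fits_add, Expr.fits_sub, Expr.fits_reg,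
        Expr.fits_const, Expr.nat_add, Expr.nat_sub, Expr.nat_reg, Expr.nat_const,
        Store.put_regs, e3, e4, hr4, true_and, if_false,
        Nat.reduceEqDiff]
      refine ⟨by omega, by omega, find_wp S
        (σ := (σ4.put 20 (b + 1)).put 21 (D.birth b - (r + 1)))
        (hσ4.access.of_regs fun r hr => ?_) hT4 hbM'
        (by simp) (by simp; rfl) fun σ5 k1 k2 k3 => ?_⟩
      · simp only [Store.put_regs]
        rw [if_neg (by omega), if_neg (by omega)]
      · have hσ5 : Consts D G σ5 := hσ4.of_regs fun r hr => by
          rw [k3 r (by simp; omega)]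
          simp only [Store.put_regs]
          rw [if_neg (by omega), if_neg (by omega)]
        have f7 : σ5.regs 7 = D.life b := by rw [k3 7 (by decide)]; simp [e7]
        have f9 : σ5.regs 9 = r := by rw [k3 9 (by decide)]; simp [hr4]
        refine ⟨⟨?_, ?_, by omega, hσ5.r100⟩, hQ _ ⟨?_, ?_, ?_⟩⟩
        · rw [f7, f9]; omega
        · rw [f7, f9]; omega
        · simp only [f7, f9, k1]
          refine ⟨?_, ?_, ?_, fun b' h1 h2 => ?_⟩
          · simpa [k2] using hT4.birth
          · simpa [k2] using hT4.life
          · simpa [k2] using hT4.jumps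
          · intro r' hr'
            have := D.life_mono h1
            simp only [Store.put_arr, Store.write_arr_self, k2]
            rw [Function.update_of_ne (by omega)]
            exact hT4.ladder b' h1 h2 r' hr'
        · simpa [k2] using hJ4
        · simp only [f7, f9, k1,
            Store.put_arr, Store.write_arr_self, k2]
          intro r' hr'
          rw [Function.update_apply]
          split_ifs with h
          · rw [show r' = r by omega]
          · exact hL r' (by omega)
    · simp only [Finset.sum_const, Finset.card_range, smul_eq_mul]
      have := Nat.mul_le_mul_right (200 + 8)
        (min_le_left (D.death b - D.birth b) (D.birth b))
      omega
    · intro σ5 hf5 ⟨hT5, hJ5, hL5⟩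
      rw [Store.put_arr, show D.M + 1 - (c + 1) = b by omega]
      refine ⟨hT5.birth, hT5.life, fun b' h1 h2 => ?_, fun b' h1 h2 => ?_⟩
      · rcases h1.eq_or_lt with rfl | h
        · exact hJ5 h2
        · exact hT5.jumps b' h h2
      · rcases h1.eq_or_lt with rfl | h
        · exact hL5
        · exact hT5.ladder b' h h2
  · have h1 : D.life (D.M + 1) = ∑ b ∈ Finset.range (D.M + 1), (D.death b - D.birth b) := rfl
    have h2 := D.life_le (le_refl (D.M + 1))
    have h4 : D.life (D.M + 1) =
        ∑ c ∈ Finset.range (D.M + 1), (D.death (D.M - c) - D.birth (D.M - c)) := by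
      rw [h1, ← Finset.sum_range_reflect]
      simp
    have h3 : ∑ c ∈ Finset.range (D.M + 1), (100 + (∑ r ∈ Finset.range D.k.size, (200 + 8) + 6 +
        (∑ r ∈ Finset.range (D.death (D.M - c) - D.birth (D.M - c)), (200 + 8) + 6)) + 8) =
        (D.M + 1) * (208 * D.k.size) + 120 * (D.M + 1) + 208 * D.life (D.M + 1) := by
      rw [h4, Finset.mul_sum]
      simp only [Finset.sum_const, Finset.card_range, smul_eq_mul, Finset.sum_add_distrib]
      rw [Finset.sum_congr rfl fun i _ =>
        mul_comm (D.death (D.M - i) - D.birth (D.M - i)) (200 + 8)]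
      norm_num
      ring
    rw [h3]
    nlinarith [Nat.zero_le ((D.M + 1) * D.k.size)]

/-! ## The top node of a query -/

/-- The tables above the tries. -/
structure Family.Upper (D : Family) (A : ℕ → ℕ → ℕ) : Prop where
  off : ∀ i < D.k, A 0 i = D.off i
  first : ∀ i < D.k, A 3 i = D.first i
  tables : D.Tables A 0
  numbered : ∀ b < D.M + 1, D.Numbered (A 10) b (D.death b - D.birth b)

def topHead : Cmd :=
  .ld 2 0 (reg 0) ;; .ld 3 3 (reg 0) ;; .set 4 (reg 1 / reg 104)

def topFar : Cmd :=
  .set 20 (reg 4) ;; .set 21 (reg 0) ;; find ;; .ld 7 8 (reg 22) ;; .ld 8 7 (reg 22) ;;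
  .ld 5 10 (reg 7 + (reg 0 - reg 8)) ;; .set 6 (bin .eq (reg 22) (reg 4))

def topNear : Cmd := .set 5 (reg 2 + reg 2) ;; .set 6 (bin .eq (reg 3) (reg 4))

/-- For the set in register `0` and the number in register `1`, put the top node into register
`5`, and into register `6` whether the set meets the block. -/
def topCmd : Cmd := topHead ;; .ite (bin .lt (reg 3) (reg 4)) topFar topNear

-- Up to the first block of the set the answer is a comparison. Beyond it, the next block born by
-- time `i` is alive at `i` by monotonicity of `death`, so it has a recorded number for `i`; the set
-- meets the block of `x` exactly when the search does not move.
open Classical in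
theorem top_wp (S : Setting D G tt) {σ : Store} (hσ : Access D G σ) {i x : ℕ}
    (hU : D.Upper σ.arr) (hi : i < D.k) (hx : x ≤ D.N) (h0 : σ.regs 0 = i) (h1 : σ.regs 1 = x)
    {Q : Store → Prop} (hQ : ∀ σ' : Store, σ'.regs 5 = D.top i (x / D.B) →
      σ'.regs 6 = (if ∃ e < D.n, D.own e = i ∧ D.blk e = x / D.B then 1 else 0) →
      σ'.regs 2 = D.off i → σ'.arr = σ.arr →
      (∀ r, r ∉ topCmd.regs → σ'.regs r = σ.regs r) → Q σ') : topCmd.wp G Q σ := by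
  have hcap := S.cap_le
  have hn := S.two_n_lt
  have hk := S.n_add_k_lt
  have hM := S.M_lt
  have hC := S.C_eq
  have hoff := D.off_le hi.le
  have hb : x / D.B < D.M := Nat.lt_succ_of_le (Nat.div_le_div_right hx)
  have e1 := hU.off i hi
  have e2 := hU.first i hi
  rw [topCmd, topHead]
  simp only [Cmd.wp, Expr.nat_reg, Expr.nat_div, Expr.fits_reg, Expr.fits_div, Store.put_regs,
    Store.put_arr, h0, h1, e1, e2, hσ.r100, hσ.r104, Expr.fits_lt, Expr.nat_lt, Nat.reduceEqDiff,
    if_false, if_true, true_and, and_true]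
  generalize hbx : x / D.B = b at *
  refine ⟨by omega, by omega, fun h => ?_, fun h => ?_⟩
  · have h : D.first i < b := by simpa using h
    have hlt := D.lt_death hi h
    have hs := Family.next_spec hb.le i
    have hal := Family.alive_next hb.le (τ := i)
    have hme := D.birth_le_iff hi h hb
    have hself : D.next b i = b ↔ D.birth b ≤ i :=
      ⟨fun h' => h' ▸ hs.2.2, fun h' => Family.next_self h'⟩
    have hds := D.death_mono hs.1
    have hlife := D.life_le (show D.next b i + 1 ≤ D.M + 1 by omega)
    have hls := D.life_succ (D.next b i)
    -- The slot `i - birth s` of the block `s` found is inside its lifetime, because `birth s ≤ i <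
    -- death b ≤ death s`.
    have hnum := hU.numbered (D.next b i) (by omega) (i - D.birth (D.next b i)) (by omega)
    rw [show D.birth (D.next b i) + (i - D.birth (D.next b i)) = i by omega, hal] at hnum
    have ht : D.top i b = 2 * D.off i + 1 + D.alive b i := if_neg (by omega)
    rw [← ht] at hnum
    have hT := hU.tables
    rw [topFar]
    simp only [Cmd.wp, Expr.nat_reg, Expr.fits_reg, Store.put_regs, h0, Nat.reduceEqDiff,
      if_false, if_true, true_and]
    refine find_wp S (σ := (((((σ.put 2 (D.off i)).put 3 (D.first i)).put 4 b).put 20 b).put 21 i))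
      (hσ.of_regs fun r hr => ?_)
      ⟨hT.birth, hT.life, fun b' _ h2 => hT.jumps b' (Nat.zero_le _) h2,
        fun b' _ h2 => hT.ladder b' (Nat.zero_le _) h2⟩ hb.le (by simp) (by simp; rfl)
      fun σ1 k1 k2 k3 => ?_
    · simp only [Store.put_regs]
      simp only [show r ≠ 21 by omega, show r ≠ 20 by omega, show r ≠ 4 by omega,
        show r ≠ 3 by omega, show r ≠ 2 by omega, if_false]
    · have f0 : σ1.regs 0 = i := by rw [k3 0 (by decide)]; simp [h0]
      have f4 : σ1.regs 4 = b := by rw [k3 4 (by decide)]; simp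
      have f2 : σ1.regs 2 = D.off i := by rw [k3 2 (by decide)]; simp
      have f100 : σ1.regs 100 = G.H := by rw [k3 100 (by decide)]; simp [hσ.r100]
      have hbi := hT.birth (D.next b i) (by omega)
      have hli := hT.life (D.next b i) (by omega)
      simp [k1, k2, f0, f4, f100, hbi, hli, hnum]
      refine ⟨by omega, by omega, by omega, hQ _ (by simp) ?_ (by simp [f2]) (by simp [k2]) ?_⟩
      · simp [hself, hme]
      · intro r hr
        simp [topCmd, topHead, topFar, topNear, find, Cmd.regs] at hr
        simp [hr]
        rw [k3 r (by simp [hr])]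
        simp [hr]
  · have h : b ≤ D.first i := by simpa using h
    have ht : D.top i b = 2 * D.off i := if_pos h
    have hme : D.first i = b ↔ ∃ e < D.n, D.own e = i ∧ D.blk e = b := by
      constructor
      · rintro rfl; exact D.first_attained hi
      · rintro ⟨e, h2, rfl, rfl⟩
        exact le_antisymm (D.first_le h2) h
    simp [topNear, Cmd.wp]
    refine ⟨by omega, hQ _ ?_ ?_ (by simp) (by simp) ?_⟩
    · simp [ht]; omega
    · simp [hme]
    · intro r hr
      simp [topCmd, topHead, topFar, topNear, find, Cmd.regs] at hr
      simp [hr]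

/-- The top node of an element is found by the procedure that serves the queries. -/
def nodesSet : Cmd :=
  .ld 0 2 (reg 10) ;; .ld 1 1 (reg 10) ;; topCmd ;; .st 13 (reg 10) (reg 5)

def nodes : Cmd := .for 10 102 nodesSet

theorem nodes_does (S : Setting D G tt) {σ : Store} (hσ : Consts D G σ) (hU : D.Upper σ.arr)
    (hxs : ∀ e < D.n, σ.arr 1 e = D.xs e) (hown : ∀ e < D.n, σ.arr 2 e = D.own e) :
    Does G nodes (508 * D.n + 6) σ fun σ' =>
      ∀ e < D.n, σ'.arr 13 e = D.top (D.own e) (D.blk e) := by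
  have hcap := S.cap_le
  have hn := S.two_n_lt
  have hk := S.n_add_k_lt
  have hC := S.C_eq
  refine (Does.for (fun e σ' => ∀ e' < e, σ'.arr 13 e' = D.top (D.own e') (D.blk e'))
    (fun _ => 500) D.n hσ.r102 (by decide) (by decide) (by decide) (by omega) (by simp) ?_).mono ?_
    fun _ _ h => h
  · intro e he σ1 k1 hr hf hfa
    have hσ1 := hσ.inner hf (by decide) (by decide)
    have hx : σ1.arr 1 e = D.xs e := by rw [hfa 1 (by decide), hxs e he]
    have ho : σ1.arr 2 e = D.own e := by rw [hfa 2 (by decide), hown e he]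
    have hU1 : D.Upper σ1.arr := by
      refine ⟨?_, ?_, ⟨?_, ?_, ?_, ?_⟩, ?_⟩
      · rw [hfa 0 (by decide)]; exact hU.off
      · rw [hfa 3 (by decide)]; exact hU.first
      · rw [hfa 7 (by decide)]; exact hU.tables.birth
      · rw [hfa 8 (by decide)]; exact hU.tables.life
      · rw [hfa 11 (by decide)]; exact hU.tables.jumps
      · rw [hfa 12 (by decide)]; exact hU.tables.ladder
      · rw [hfa 10 (by decide)]; exact hU.numbered
    refine Does.block (by decide) fun Q' hQ => ?_
    rw [nodesSet]
    simp only [Cmd.wp, Expr.nat_reg, Expr.fits_reg, Store.put_regs, Store.put_arr, hr, hx, ho,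
      hσ1.r100, Nat.reduceEqDiff, if_false, true_and, and_true]
    refine ⟨by omega, by omega, top_wp S (σ := (σ1.put 0 (D.own e)).put 1 (D.xs e))
      (hσ1.access.of_regs fun r hr => ?_) hU1 (D.own_lt e he) (D.xs_le e he) (by simp) (by simp)
      fun σ2 j1 j2 j3 j4 j5 => ?_⟩
    · simp only [Store.put_regs]
      rw [if_neg (by omega), if_neg (by omega)]
    · have f10 : σ2.regs 10 = e := by rw [j5 10 (by decide)]; simp [hr]
      have f100 : σ2.regs 100 = G.H := by rw [j5 100 (by decide)]; simp [hσ1.r100]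
      rw [f10, f100, j1]
      refine ⟨⟨by omega, by omega, rfl⟩, hQ _ ?_⟩
      simp only [Store.put_arr, Store.write_arr_self, j4]
      exact update_upto k1 rfl
  · simp; omega

/-! ## The levels of the tries -/

/-- The expression for a digit. -/
def digitExpr (tt j r : ℕ) : Expr := bin .mod (reg r / powExpr (tt - 1 - j)) wordSize

theorem digitExpr_nat {j r x : ℕ} {ρ : ℕ → ℕ} (h : ρ r = x) :
    (digitExpr tt j r).nat G.W ρ = digit G.W tt j x := by
  simp [digitExpr, powExpr_nat, digit, h]

theorem digitExpr_fits (S : Setting D G tt) (j r : ℕ) (ρ : ℕ → ℕ) :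
    (digitExpr tt j r).Fits G.W ρ := by
  have h1 : G.W ^ (tt - 1 - j) ≤ G.W ^ tt := Nat.pow_le_pow_right S.W_pos (by omega)
  have h2 := S.B_lt
  rw [S.B_eq] at h2
  simp [digitExpr, powExpr_fits ρ S.W_pos (h1.trans_lt h2)]

def bitsSet (tt j : ℕ) : Cmd :=
  .ld 3 13 (reg 2) ;; .ld 4 1 (reg 2) ;; .set 4 (digitExpr tt j 4) ;; .ld 5 (14 + 2 * j) (reg 3) ;;
  .st (14 + 2 * j) (reg 3) (bin .or (reg 5) (bin .shl (const 1) (reg 4)))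

def basesSet (j : ℕ) : Cmd :=
  .ld 3 (15 + 2 * j) (reg 2) ;; .ld 4 (14 + 2 * j) (reg 2) ;;
  .st (15 + 2 * j) (reg 2 + const 1) (reg 3 + bin .rank (reg 4) wordSize)

def childrenSet (tt j : ℕ) : Cmd :=
  .ld 3 13 (reg 2) ;; .ld 4 1 (reg 2) ;; .set 4 (digitExpr tt j 4) ;; .ld 5 (14 + 2 * j) (reg 3) ;;
  .ld 6 (15 + 2 * j) (reg 3) ;; .st 13 (reg 2) (reg 6 + bin .rank (reg 5) (reg 4))

/-- Each level owns two arrays that are still zero: the bitmaps arise by disjunction from empty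
words, and the prefix sums start from a zero cell. -/
def level (tt j : ℕ) : Cmd :=
  .for 2 102 (bitsSet tt j) ;; .for 2 107 (basesSet j) ;; .for 2 102 (childrenSet tt j)

def levels (tt : ℕ) : ℕ → Cmd
  | 0 => .skip
  | j + 1 => levels tt j ;; level tt j

theorem level_regs (tt j : ℕ) : ∀ r ∈ (level tt j).regs, r < 100 := by
  simp [level, bitsSet, basesSet, childrenSet, Cmd.for, Cmd.regs]

theorem levels_regs (tt j : ℕ) : ∀ r ∈ (levels tt j).regs, r < 100 := by
  induction j with
  | zero => simp [levels, Cmd.regs]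
  | succ j ih =>
    intro r hr
    rw [levels, Cmd.regs, List.mem_append] at hr
    exact hr.elim (ih r) (level_regs tt j r)

theorem level_arrs {tt j q : ℕ} (h : q ∈ (level tt j).arrs) :
    q = 13 ∨ q = 14 + 2 * j ∨ q = 15 + 2 * j := by
  simp [level, bitsSet, basesSet, childrenSet, Cmd.for, Cmd.arrs] at h
  omega

theorem levels_arrs {tt j q : ℕ} (h : q ∈ (levels tt j).arrs) : 13 ≤ q := by
  induction j with
  | zero => simp [levels, Cmd.arrs] at h
  | succ j ih =>
    rw [levels, Cmd.arrs, List.mem_append] at h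
    rcases h with h | h
    · exact ih h
    · have := level_arrs h; omega

/-- The tables of the level `j`. -/
def Family.LevelTables (D : Family) (G : Layout) (tt : ℕ) (A : ℕ → ℕ → ℕ) (j : ℕ) : Prop :=
  (∀ u < 2 * D.n + 1, A (14 + 2 * j) u = D.bits G.W tt j u) ∧
    ∀ u < 2 * D.n + 1, A (15 + 2 * j) u = baseOf G.W (D.bits G.W tt j) u

/-- A bound for the time per element on level `j`. -/
def levelCost (tt j : ℕ) : ℕ :=
  (bitsSet tt j).cost + 2 * (basesSet j).cost + (childrenSet tt j).cost + 50

theorem level_does (S : Setting D G tt) {σ : Store} (hσ : Consts D G σ) {j : ℕ} (hj : j < tt)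
    (hxs : ∀ e < D.n, σ.arr 1 e = D.xs e)
    (h13 : ∀ e < D.n, σ.arr 13 e = D.node G.W tt j e)
    (hb : ∀ u < 2 * D.n + 1, σ.arr (14 + 2 * j) u = 0) (hs : σ.arr (15 + 2 * j) 0 = 0) :
    Does G (level tt j) (levelCost tt j * D.n + 18) σ fun σ' =>
      (∀ e < D.n, σ'.arr 13 e = D.node G.W tt (j + 1) e) ∧ D.LevelTables G tt σ'.arr j := by
  have hcap := S.cap_le
  have hn := S.two_n_lt
  have hk := S.n_add_k_lt
  have hC := S.C_eq
  have h1 : Does G (.for 2 102 (bitsSet tt j)) (((bitsSet tt j).cost + 8) * D.n + 6) σ fun σ' =>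
      ∀ u < 2 * D.n + 1, σ'.arr (14 + 2 * j) u = D.bits G.W tt j u := by
    refine (Does.for (fun e σ' => ∀ u < 2 * D.n + 1, σ'.arr (14 + 2 * j) u =
      bitsUpTo (D.node G.W tt j) (fun e => digit G.W tt j (D.xs e)) u e)
      (fun _ => (bitsSet tt j).cost) D.n hσ.r102 (by simp [bitsSet, Cmd.regs])
      (by simp [bitsSet, Cmd.regs]) (by decide) (by omega) hb ?_).mono ?_ fun _ _ h => h
    · intro e he σ1 k1 hr hf hfa
      have hσ1 := hσ.inner hf (by simp [bitsSet, Cmd.regs]) (by decide)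
      have hx : σ1.arr 1 e = D.xs e := by
        rw [hfa 1 (by simp [bitsSet, Cmd.arrs]; omega), hxs e he]
      have ho : σ1.arr 13 e = D.node G.W tt j e := by
        rw [hfa 13 (by simp [bitsSet, Cmd.arrs]; omega), h13 e he]
      have hnl := Family.node_lt (tt := tt) S.W_pos (j := j) he
      have hpw : 2 ^ digit G.W tt j (D.xs e) < cap G.W :=
        Nat.pow_lt_pow_right (by norm_num) (Family.digit_lt S.W_pos _ _)
      refine Does.block le_rfl fun Q' hQ => ?_
      have hd : ∀ ρ : ℕ → ℕ, ρ 4 = D.xs e →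
        (digitExpr tt j 4).nat G.W ρ = digit G.W tt j (D.xs e) := fun ρ h => digitExpr_nat h
      simp [bitsSet, Cmd.wp, hr, hx, ho, hσ1.r100, hd, digitExpr_fits S,
        k1 _ (hnl.trans (Nat.lt_succ_self _))]
      refine ⟨by omega, by omega, by omega, ⟨⟨by omega, hpw⟩, by omega, by omega⟩,
        hQ _ fun u hu => ?_⟩
      simp only [Store.put_arr, Store.write_arr_self, bitsUpTo]
      rw [Function.update_apply]
      by_cases h : u = D.node G.W tt j e
      · subst h; simp
      · rw [if_neg h, if_neg (Ne.symm h), k1 u hu]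
    · simp; ring_nf; omega
  have h2 : ∀ σ1 : Store, Consts D G σ1 → σ1.arr (15 + 2 * j) 0 = 0 →
      (∀ u < 2 * D.n + 1, σ1.arr (14 + 2 * j) u = D.bits G.W tt j u) →
      Does G (.for 2 107 (basesSet j)) (((basesSet j).cost + 8) * (2 * D.n) + 6) σ1 fun σ' =>
      ∀ u < 2 * D.n + 1, σ'.arr (15 + 2 * j) u = baseOf G.W (D.bits G.W tt j) u := by
    intro σ1 hσ1 hs1 hb1
    refine (Does.for (fun v σ' => ∀ u < v + 1, σ'.arr (15 + 2 * j) u =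
      baseOf G.W (D.bits G.W tt j) u)
      (fun _ => (basesSet j).cost) (2 * D.n) hσ1.r107 (by simp [basesSet, Cmd.regs])
      (by simp [basesSet, Cmd.regs]) (by decide) (by omega) ?_ ?_).mono ?_ fun _ _ h => h
    · intro u hu
      obtain rfl : u = 0 := by omega
      exact hs1
    · intro v hv σ2 k1 hr hf hfa
      have hσ2 := hσ1.inner hf (by simp [basesSet, Cmd.regs]) (by decide)
      have hx : σ2.arr (14 + 2 * j) v = D.bits G.W tt j v := by
        rw [hfa _ (by simp [basesSet, Cmd.arrs]), hb1 v (by omega)]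
      have hle := baseOf_le (W := G.W) (D.testBit_bits G.W tt j) (v + 1)
      have hsucc := baseOf_succ G.W (D.bits G.W tt j) v
      refine Does.block le_rfl fun Q' hQ => ?_
      simp [basesSet, Cmd.wp, hr, hx, hσ2.r100, k1 _ (Nat.lt_succ_self _)]
      refine ⟨by omega, by omega, by omega, hQ _ ?_⟩
      simp only [Store.put_arr, Store.write_arr_self]
      exact update_upto k1 hsucc.symm
    · simp; ring_nf; omega
  have h3 : ∀ σ1 : Store, Consts D G σ1 → D.LevelTables G tt σ1.arr j →
      (∀ e < D.n, σ1.arr 1 e = D.xs e) → (∀ e < D.n, σ1.arr 13 e = D.node G.W tt j e) →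
      Does G (.for 2 102 (childrenSet tt j)) (((childrenSet tt j).cost + 8) * D.n + 6) σ1 fun σ' =>
      ∀ e < D.n, σ'.arr 13 e = D.node G.W tt (j + 1) e := by
    intro σ1 hσ1 ⟨hb1, hs1⟩ hx1 hn1
    -- Array `13` is overwritten in place, so the invariant separates the elements already moved
    -- from those still in their old nodes.
    refine (Does.for (fun e σ' => (∀ e' < e, σ'.arr 13 e' = D.node G.W tt (j + 1) e') ∧
      ∀ e', e ≤ e' → e' < D.n → σ'.arr 13 e' = D.node G.W tt j e')
      (fun _ => (childrenSet tt j).cost) D.n hσ1.r102 (by simp [childrenSet, Cmd.regs])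
      (by simp [childrenSet, Cmd.regs]) (by decide) (by omega) ⟨by simp, fun e _ h => hn1 e h⟩
      ?_).mono ?_ fun _ _ h => h.1
    · intro e he σ2 ⟨k1, k2⟩ hr hf hfa
      have hσ2 := hσ1.inner hf (by simp [childrenSet, Cmd.regs]) (by decide)
      have hnl := Family.node_lt (tt := tt) S.W_pos (j := j) he
      have hnl' := Family.node_lt (tt := tt) S.W_pos (j := j + 1) he
      have hx : σ2.arr 1 e = D.xs e := by rw [hfa 1 (by simp [childrenSet, Cmd.arrs]), hx1 e he]
      have hb2 : σ2.arr (14 + 2 * j) (D.node G.W tt j e) = D.bits G.W tt j (D.node G.W tt j e) := by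
        rw [hfa _ (by simp [childrenSet, Cmd.arrs]; omega), hb1 _ (by omega)]
      have hs2 : σ2.arr (15 + 2 * j) (D.node G.W tt j e) =
          baseOf G.W (D.bits G.W tt j) (D.node G.W tt j e) := by
        rw [hfa _ (by simp [childrenSet, Cmd.arrs]; omega), hs1 _ (by omega)]
      have hns := D.node_succ G.W tt j e
      unfold child at hns
      refine Does.block le_rfl fun Q' hQ => ?_
      have hd : ∀ ρ : ℕ → ℕ, ρ 4 = D.xs e →
        (digitExpr tt j 4).nat G.W ρ = digit G.W tt j (D.xs e) := fun ρ h => digitExpr_nat h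
      simp [childrenSet, Cmd.wp, hr, hx, hσ2.r100, k2 e le_rfl he, hb2, hs2, hd, digitExpr_fits S]
      refine ⟨by omega, by omega, by omega, by omega, by omega, hQ _ ⟨?_, fun e' h1 h2 => ?_⟩⟩
      · simp only [Store.put_arr, Store.write_arr_self]
        exact update_upto k1 hns.symm
      · simp only [Store.put_arr, Store.write_arr_self]
        rw [Function.update_of_ne (by omega)]
        exact k2 e' (by omega) h2
    · simp; ring_nf; omega
  have key : Does G (level tt j) ((((bitsSet tt j).cost + 8) * D.n + 6) +
      ((((basesSet j).cost + 8) * (2 * D.n) + 6) + (((childrenSet tt j).cost + 8) * D.n + 6))) σ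
      fun σ' => (∀ e < D.n, σ'.arr 13 e = D.node G.W tt (j + 1) e) ∧
        D.LevelTables G tt σ'.arr j := by
    refine Does.seq h1 fun σ1 hf1 k1 => ?_
    have hσ1 := hσ.frame hf1 (by simp [bitsSet, Cmd.for, Cmd.regs])
    have hs1 : σ1.arr (15 + 2 * j) 0 = 0 := by
      rw [hf1.2 _ (by simp [bitsSet, Cmd.for, Cmd.arrs]), hs]
    refine Does.seq (h2 σ1 hσ1 hs1 k1) fun σ2 hf2 k2 => ?_
    have hσ2 := hσ1.frame hf2 (by simp [basesSet, Cmd.for, Cmd.regs])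
    have hL : D.LevelTables G tt σ2.arr j :=
      ⟨by rwa [hf2.2 _ (by simp [basesSet, Cmd.for, Cmd.arrs])], k2⟩
    refine (h3 σ2 hσ2 hL ?_ ?_).mono le_rfl fun σ3 hf3 k3 => ⟨k3, ?_⟩
    · rw [hf2.2 _ (by simp [basesSet, Cmd.for, Cmd.arrs]; omega),
        hf1.2 _ (by simp [bitsSet, Cmd.for, Cmd.arrs]; omega)]
      exact hxs
    · rw [hf2.2 _ (by simp [basesSet, Cmd.for, Cmd.arrs]; omega),
        hf1.2 _ (by simp [bitsSet, Cmd.for, Cmd.arrs]; omega)]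
      exact h13
    · unfold Family.LevelTables
      rw [hf3.2 _ (by simp [childrenSet, Cmd.for, Cmd.arrs]; omega),
        hf3.2 _ (by simp [childrenSet, Cmd.for, Cmd.arrs]; omega)]
      exact hL
  refine key.mono (le_of_eq_of_le ?_ (show
    ((bitsSet tt j).cost + 2 * (basesSet j).cost + (childrenSet tt j).cost + 32) * D.n + 18 ≤ _
    from ?_)) fun _ _ h => h
  · ring
  · rw [levelCost]
    gcongr
    omega

theorem levels_does (S : Setting D G tt) {σ : Store} (hσ : Consts D G σ)
    (hxs : ∀ e < D.n, σ.arr 1 e = D.xs e)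
    (h13 : ∀ e < D.n, σ.arr 13 e = D.top (D.own e) (D.blk e))
    (hz : ∀ q, 14 ≤ q → ∀ u < 2 * D.n + 1, σ.arr q u = 0) {j : ℕ} (hj : j ≤ tt) :
    Does G (levels tt j) (1 + ∑ j' ∈ Finset.range j, (levelCost tt j' * D.n + 18)) σ fun σ' =>
      (∀ e < D.n, σ'.arr 13 e = D.node G.W tt j e) ∧ (∀ j' < j, D.LevelTables G tt σ'.arr j') ∧
      ∀ q, 14 + 2 * j ≤ q → σ'.arr q = σ.arr q := by
  induction j with
  | zero =>
    refine Does.block (by simp [levels, Cmd.cost]) fun Q' hQ => ?_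
    simp only [levels, Cmd.wp]
    exact hQ _ ⟨h13, by simp, fun _ _ => rfl⟩
  | succ j ih =>
    rw [Finset.sum_range_succ, ← Nat.add_assoc]
    refine Does.seq (ih (by omega)) fun σ1 hf ⟨k1, k2, k3⟩ => ?_
    have hσ1 := hσ.frame hf (levels_regs tt j)
    refine (level_does S hσ1 (show j < tt by omega) ?_ k1 ?_ ?_).mono le_rfl
      fun σ2 hf2 ⟨k4, k5⟩ => ⟨k4, fun j' hj' => ?_, fun q hq => ?_⟩
    · rw [hf.2 1 fun h => by have := levels_arrs h; omega]
      exact hxs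
    · rw [k3 _ (by omega)]; exact hz _ (by omega)
    · rw [k3 _ (by omega)]; exact hz _ (by omega) 0 (by omega)
    · rcases Nat.lt_succ_iff_lt_or_eq.1 hj' with h | rfl
      · have := k2 j' h
        unfold Family.LevelTables at this ⊢
        rwa [hf2.2 _ fun h => by have := level_arrs h; omega,
          hf2.2 _ fun h => by have := level_arrs h; omega]
      · exact k5
    · rw [hf2.2 q fun h => by have := level_arrs h; omega, k3 q (by omega)]

/-! ## Queries -/

/-- The flag in register `6` multiplies the rank, so an absent node leads to its first child, as in
`descend`. It then survives only if the bit of the digit is set. -/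
def queryLevel (tt j : ℕ) : Cmd :=
  .ld 7 (14 + 2 * j) (reg 5) ;; .ld 8 (15 + 2 * j) (reg 5) ;; .set 9 (digitExpr tt j 1) ;;
  .set 5 (reg 8 + reg 6 * bin .rank (reg 7) (reg 9)) ;;
  .set 6 (reg 6 * bin .and (bin .shr (reg 7) (reg 9)) (const 1))

def queryLevels (tt : ℕ) : ℕ → Cmd
  | 0 => .skip
  | j + 1 => queryLevels tt j ;; queryLevel tt j

/-- A query starts with only `i` and `x` in its registers. Cell `0` provides the start of the
arrays, left there by the preprocessing; the block length and the row length of the jumps are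
recomputed. -/
def queryCmd (tt : ℕ) : Cmd :=
  .inp 100 (const 0) ;; .inp 101 (const 1) ;; .set 104 (powExpr tt) ;; .set 105 (sizeExpr 101) ;;
  topCmd ;; queryLevels tt tt ;; .set 0 (reg 5 + reg 6 - reg 2)

theorem queryLevels_arrs (tt j : ℕ) : (queryLevels tt j).arrs = [] := by
  induction j with
  | zero => rfl
  | succ j ih => simp [queryLevels, Cmd.arrs, ih, queryLevel]

theorem queryCmd_arrs (tt : ℕ) : (queryCmd tt).arrs = [] := by
  simp [queryCmd, Cmd.arrs, queryLevels_arrs]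
  decide

open Classical in
theorem queryLevel_wp (S : Setting D G tt) {σ : Store} (hσ : σ.regs 100 = G.H) {i x j r : ℕ}
    {ex : Prop} (hL : D.LevelTables G tt σ.arr j) (hj : j < tt) (hR : D.Reached G.W tt i x j r ex)
    (h1 : σ.regs 1 = x) (h5 : σ.regs 5 = r) (h6 : σ.regs 6 = if ex then 1 else 0)
    {Q : Store → Prop} (hQ : ∀ σ' : Store,
      σ'.regs 5 = descend G.W (D.bits G.W tt j) r (digit G.W tt j x) ex →
      σ'.regs 6 = (if ex ∧ (D.bits G.W tt j r).testBit (digit G.W tt j x) = true then 1 else 0) →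
      σ'.arr = σ.arr → σ'.regs 100 = G.H → σ'.regs 1 = x → σ'.regs 2 = σ.regs 2 → Q σ') :
    (queryLevel tt j).wp G Q σ := by
  have hcap := S.cap_le
  have hn := S.two_n_lt
  have hC := S.C_eq
  have hr := hR.1
  have e1 := hL.1 r (by omega)
  have e2 := hL.2 r (by omega)
  have hle := (hR.succ S.W_pos hj).1
  have hd : ∀ ρ : ℕ → ℕ, ρ 1 = x →
    (digitExpr tt j 1).nat G.W ρ = digit G.W tt j x := fun ρ h => digitExpr_nat h
  have hand : ∀ v d : ℕ, v >>> d &&& 1 = if v.testBit d = true then 1 else 0 := fun v d => by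
    rw [Nat.testBit, Nat.and_one_is_mod, Nat.one_and_eq_mod_two]
    rcases Nat.mod_two_eq_zero_or_one (v >>> d) with h | h <;> simp [h]
  generalize digit G.W tt j x = d at *
  unfold descend child at *
  simp only [queryLevel, Cmd.wp, Expr.nat_reg, Expr.fits_reg, Store.put_regs, Store.put_arr, h5,
    hσ, e1, e2, h1, h6, Nat.reduceEqDiff, if_false, if_true, true_and, digitExpr_fits S,
    Expr.fits_add, Expr.fits_mul, Expr.nat_add, Expr.nat_mul, Expr.fits_rank, Expr.nat_rank,
    Expr.fits_and, Expr.fits_shr, Expr.fits_const, Expr.nat_and, Expr.nat_shr, Expr.nat_const,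
    hd, hand]
  by_cases hex : ex
  · simp only [hex, if_true, true_and, and_true, one_mul] at *
    refine ⟨⟨by omega, by omega⟩, ⟨by omega, by omega⟩, ⟨by omega, by omega⟩,
      ⟨by omega, ?_⟩, hQ _ (by simp) (by simp) (by simp) (by simp [hσ]) (by simp [h1]) (by simp)⟩
    split_ifs <;> omega
  · simp only [hex, if_false, false_and, and_true, zero_mul] at *
    refine ⟨⟨by omega, by omega⟩, ⟨by omega, by omega⟩, ⟨by omega, by omega⟩,
      ⟨by omega, by omega⟩, hQ _ (by simp [rank_zero]) (by simp) (by simp) (by simp [hσ])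
      (by simp [h1]) (by simp)⟩

open Classical in
theorem queryLevels_wp (S : Setting D G tt) {σ : Store} (hσ : σ.regs 100 = G.H) {i x r : ℕ}
    {ex : Prop} {j : ℕ} (hL : ∀ j' < j, D.LevelTables G tt σ.arr j') (hj : j ≤ tt)
    (hR : D.Reached G.W tt i x 0 r ex) (h1 : σ.regs 1 = x) (h5 : σ.regs 5 = r)
    (h6 : σ.regs 6 = if ex then 1 else 0) {Q : Store → Prop}
    (hQ : ∀ (σ' : Store) (r' : ℕ) (ex' : Prop), D.Reached G.W tt i x j r' ex' → σ'.regs 5 = r' →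
      σ'.regs 6 = (if ex' then 1 else 0) → σ'.arr = σ.arr → σ'.regs 100 = G.H →
      σ'.regs 1 = x → σ'.regs 2 = σ.regs 2 → Q σ') :
    (queryLevels tt j).wp G Q σ := by
  induction j generalizing Q with
  | zero => exact hQ σ r ex hR h5 h6 rfl hσ h1 rfl
  | succ j ih =>
    refine ih (fun j' h => hL j' (by omega)) (by omega) fun σ' r' ex' k1 k2 k3 k4 k5 k6 k7 => ?_
    refine queryLevel_wp S k5 (k4 ▸ hL j (by omega)) (by omega) k1 k6 k2 k3
      fun σ'' l1 l2 l3 l4 l5 l6 => ?_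
    exact hQ σ'' _ _ (k1.succ S.W_pos (by omega)) l1 (by convert l2) (l3.trans k4) l4 l5
      (l6.trans k7)

theorem query_does (S : Setting D G tt) (hH : G.inp 0 = G.H) {σ : Store} {i x : ℕ}
    (hU : D.Upper σ.arr) (hL : ∀ j < tt, D.LevelTables G tt σ.arr j) (hi : i < D.k)
    (hx : x ≤ D.N) (h0 : σ.regs 0 = i) (h1 : σ.regs 1 = x) :
    Does G (queryCmd tt) (queryCmd tt).cost σ fun σ' => σ'.regs 0 =
      ((Finset.range D.n).filter fun e => D.own e = i ∧ D.xs e ≤ x).card := by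
  classical
  have hcap := S.cap_le
  have hn := S.two_n_lt
  have hk := S.n_add_k_lt
  have hHe := S.H_eq
  have hp := S.B_eq ▸ S.B_lt
  -- The last level is split off, since `Reached.answer` turns its descent into a count.
  obtain ⟨t, rfl⟩ : ∃ t, tt = t + 1 := ⟨tt - 1, by have := S.tt_pos; omega⟩
  refine Does.of_wp ?_
  have hs : ∀ ρ : ℕ → ℕ, ρ 101 = D.k → (sizeExpr 101).nat G.W ρ = D.k.size := fun ρ h => by
    rw [sizeExpr_nat (by omega), h]
  rw [queryCmd]
  simp only [Cmd.wp, Expr.fits_const, Expr.nat_const, Store.put_regs, sizeExpr_fits,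
    powExpr_nat, powExpr_fits _ S.W_pos hp, hH, S.inp_one, hs, Nat.reduceEqDiff, if_true,
    if_false, true_and]
  refine ⟨by omega, by omega, ?_⟩
  refine top_wp S (i := i) (x := x) (σ := (((σ.put 100 G.H).put 101 D.k).put 104
    (G.W ^ (t + 1))).put 105 D.k.size) ⟨by simp, by simp [S.B_eq], by simp⟩ (by simpa using hU) hi
    hx (by simp [h0]) (by simp [h1]) fun σ1 k1 k2 k3 k4 k5 => ?_
  have hL1 : ∀ j < t + 1, D.LevelTables G (t + 1) σ1.arr j := by rw [k4]; exact hL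
  refine queryLevels_wp S (i := i) (x := x) (j := t) (by rw [k5 100 (by decide)]; simp)
    (fun j h => hL1 j (by omega)) (by omega) (Family.reached_zero S.B_eq hi hx)
    (by rw [k5 1 (by decide)]; simp [h1]) k1 (by convert k2) fun σ2 r ex l1 l2 l3 l4 l5 l6 l7 => ?_
  refine queryLevel_wp S l5 (l4 ▸ hL1 t (by omega)) (by omega) l1 l6 l2 l3
    fun σ3 m1 m2 m3 m4 m5 m6 => ?_
  have ha := l1.answer S.W_pos S.B_eq rfl hi
  rw [← m1, ← m2] at ha
  have hc : ((Finset.range D.n).filter fun e => D.own e = i ∧ D.xs e ≤ x).card ≤ D.n :=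
    (Finset.card_filter_le _ _).trans (Finset.card_range _).le
  have hoff := D.off_le hi.le
  simp [m6, l7, k3, ha]
  omega

/-! ## The preprocessing -/

def preprocCmd (tt : ℕ) : Cmd :=
  setup tt ;; lists ;; meets ;; lasts ;; births ;; ids ;; jumps ;; nodes ;; levels tt tt

/-- The factor in the running time of the preprocessing. -/
def preprocCost (tt : ℕ) : ℕ :=
  5000 + (setupParams tt).cost + ∑ j ∈ Finset.range tt, (levelCost tt j + 18)

theorem preproc_does (S : Setting D G tt) (hN : G.inp 0 = D.N) {σ : Store}
    (hz : ∀ q u, σ.arr q u = 0) :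
    Does G (preprocCmd tt) (preprocCost tt * ((D.M + 1) * (D.k.size + 1) + D.n + D.k)) σ fun σ' =>
      σ'.regs 100 = G.H ∧ D.Upper σ'.arr ∧ ∀ j < tt, D.LevelTables G tt σ'.arr j := by
  have key : Does G (preprocCmd tt) (100 * D.k + (100 + (setupParams tt).cost) +
      (100 * (D.k + D.n) + (108 * D.n + 20 + (50 * D.k + 6 + (150 * (D.M + 1) + 10 +
      (100 * (D.M + 1) + 100 * (D.n + D.k) + 6 + ((D.M + 1) * (300 * D.k.size + 300) +
      300 * (D.n + D.k) + 6 + (508 * D.n + 6 +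
      (1 + ∑ j ∈ Finset.range tt, (levelCost tt j * D.n + 18)))))))))) σ fun σ' =>
      σ'.regs 100 = G.H ∧ D.Upper σ'.arr ∧ ∀ j < tt, D.LevelTables G tt σ'.arr j := by
    refine (setup_does S hN σ).seq fun σ1 _ ⟨c1, z1⟩ => ?_
    refine (lists_does S c1).seq fun σ2 f2 ⟨a0, a3, a9, a1, a2⟩ => ?_
    have c2 := c1.frame f2 (by decide)
    refine (meets_does S c2 a1 a2 a3 fun b _ => ?_).seq fun σ3 f3 ⟨b3, b5⟩ => ?_
    · rw [f2.2 5 (by decide), z1, hz]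
    have c3 := c2.frame f3 (by decide)
    refine (lasts_does S c3 b3 fun b _ => ?_).seq fun σ4 f4 d4 => ?_
    · rw [f3.2 4 (by decide), f2.2 4 (by decide), z1, hz]
    have c4 := c3.frame f4 (by decide)
    refine (births_does S c4 (f4.2 5 (by decide) ▸ b5) d4).seq fun σ5 f5 ⟨d6, d7, d8⟩ => ?_
    have c5 := c4.frame f5 (by decide)
    refine (ids_does S c5 ?_ d6 d7 d8).seq fun σ6 f6 d10 => ?_
    · rw [f5.2 9 (by decide), f4.2 9 (by decide), f3.2 9 (by decide)]; exact a9
    have c6 := c5.frame f6 (by decide)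
    refine (jumps_does S c6 (f6.2 6 (by decide) ▸ d6) (f6.2 7 (by decide) ▸ d7)
      (f6.2 8 (by decide) ▸ d8)).seq fun σ7 f7 hT => ?_
    have c7 := c6.frame f7 (by decide)
    have h1 : σ7.arr 1 = σ2.arr 1 := by
      rw [f7.2 1 (by decide), f6.2 1 (by decide), f5.2 1 (by decide), f4.2 1 (by decide),
        f3.2 1 (by decide)]
    have h2 : σ7.arr 2 = σ2.arr 2 := by
      rw [f7.2 2 (by decide), f6.2 2 (by decide), f5.2 2 (by decide), f4.2 2 (by decide),
        f3.2 2 (by decide)]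
    have hU : D.Upper σ7.arr := by
      refine ⟨?_, ?_, hT, f7.2 10 (by decide) ▸ d10⟩
      · rw [f7.2 0 (by decide), f6.2 0 (by decide), f5.2 0 (by decide), f4.2 0 (by decide),
          f3.2 0 (by decide)]
        exact a0
      · rw [f7.2 3 (by decide), f6.2 3 (by decide), f5.2 3 (by decide), f4.2 3 (by decide)]
        exact b3
    refine (nodes_does S c7 hU (h1 ▸ a1) (h2 ▸ a2)).seq fun σ8 f8 d13 => ?_
    have c8 := c7.frame f8 (by decide)
    refine (levels_does S c8 ?_ d13 ?_ le_rfl).mono le_rfl fun σ9 f9 ⟨_, hL, _⟩ =>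
      ⟨(c8.frame f9 (levels_regs tt tt)).r100, ?_, hL⟩
    · rw [f8.2 1 (by decide), h1]; exact a1
    · intro q hq u _
      have e : ∀ c : Cmd, (∀ q ∈ c.arrs, q < 14) → q ∉ c.arrs := fun c h h' => by
        have := h q h'; omega
      rw [f8.2 q (e _ (by decide)), f7.2 q (e _ (by decide)), f6.2 q (e _ (by decide)),
        f5.2 q (e _ (by decide)), f4.2 q (e _ (by decide)), f3.2 q (e _ (by decide)),
        f2.2 q (e _ (by decide)), z1, hz]
    · have e : ∀ q < 13, σ9.arr q = σ7.arr q := fun q hq => by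
        rw [f9.2 q fun h => by have := levels_arrs h; omega, f8.2 q fun h => by
          have : ∀ q ∈ nodes.arrs, 13 ≤ q := by decide
          have := this q h; omega]
      refine ⟨?_, ?_, ⟨?_, ?_, ?_, ?_⟩, ?_⟩
      · rw [e 0 (by decide)]; exact hU.off
      · rw [e 3 (by decide)]; exact hU.first
      · rw [e 7 (by decide)]; exact hU.tables.birth
      · rw [e 8 (by decide)]; exact hU.tables.life
      · rw [e 11 (by decide)]; exact hU.tables.jumps
      · rw [e 12 (by decide)]; exact hU.tables.ladder
      · rw [e 10 (by decide)]; exact hU.numbered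
  refine key.mono ?_ fun _ _ h => h
  have hk := D.k_pos
  have hsum : ∑ j ∈ Finset.range tt, (levelCost tt j * D.n + 18) ≤
      (∑ j ∈ Finset.range tt, (levelCost tt j + 18)) *
        ((D.M + 1) * (D.k.size + 1) + D.n + D.k) := by
    rw [Finset.sum_mul]
    refine Finset.sum_le_sum fun j _ => ?_
    rw [add_mul]
    refine Nat.add_le_add (Nat.mul_le_mul_left _ (by omega)) ?_
    omega
  have hset : (setupParams tt).cost ≤ (setupParams tt).cost *
      ((D.M + 1) * (D.k.size + 1) + D.n + D.k) := Nat.le_mul_of_pos_right _ (by omega)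
  have hM : D.M + 1 ≤ (D.M + 1) * (D.k.size + 1) := Nat.le_mul_of_pos_right _ (by omega)
  have hm : (D.M + 1) * (300 * D.k.size + 300) = 300 * ((D.M + 1) * (D.k.size + 1)) := by ring
  rw [hm, preprocCost]
  generalize (D.M + 1) * (D.k.size + 1) = Y at *
  rw [add_mul, add_mul]
  omega

/-! ## The programs -/

/-- The preprocessing program; it finally puts the size of the input into the first cell. -/
def preprocStmt (tt : ℕ) : Stmt :=
  .seq ((preprocCmd tt).toStmt (14 + 2 * tt)) (.store (const 0) (reg 100))

def queryStmt (tt : ℕ) : Stmt := (queryCmd tt).toStmt (14 + 2 * tt)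

theorem programs_exec (S : Setting D G tt) (hN : G.inp 0 = D.N) {cells : ℕ}
    (hc : G.H + G.C * G.X ≤ cells) (hW : cells ≤ cap G.W) {m : ℕ → ℕ}
    (hm : ∀ a < G.H, m a = G.inp a) (hz : ∀ a, G.H ≤ a → m a = 0) :
    ∃ T ≤ preprocCost tt * ((D.M + 1) * (D.k.size + 1) + D.n + D.k) + 3, ∃ σ : State,
      Exec G.W cells (preprocStmt tt) ⟨fun _ => 0, m⟩ T σ ∧
      ∀ i < D.k, ∀ x ≤ D.N, ∃ T' ≤ (queryCmd tt).cost, ∃ σ' : State,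
        Exec G.W cells (queryStmt tt) (queryState σ.mem i x) T' σ' ∧
        σ'.regs 0 = ((Finset.range D.n).filter fun e => D.own e = i ∧ D.xs e ≤ x).card ∧
        σ'.mem = σ.mem := by
  have hH : 0 < G.H := by rw [S.H_eq]; omega
  obtain ⟨T, hT, σ, h1, h100, hU, hL⟩ := preproc_does S hN (σ := ⟨fun _ => 0, fun _ _ => 0⟩)
    fun _ _ => rfl
  obtain ⟨m', h2, h3⟩ := h1.exec hc hW hH m ⟨hm, fun q _ i _ => hz _ (by omega)⟩
  rw [S.C_eq] at h2
  have h4 := Exec.store (W := G.W) (M := cells) (const 0) (reg 100) ⟨σ.regs, m'⟩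
    (by simp [Expr.eval]; omega)
  simp only [Expr.eval, Nat.zero_mod, h100] at h4
  refine ⟨T + 3, by omega, _, .seq h2 h4, fun i hi x hx => ?_⟩
  -- Cell `0` now holds `H` instead of `N`. `Setting` says nothing about that cell, so it persists
  -- for the changed read-only region.
  let G' : Layout := { G with inp := Function.update G.inp 0 G.H }
  have S' : Setting D G' tt :=
    { B_eq := S.B_eq, W_pos := S.W_pos, tt_pos := S.tt_pos, C_eq := S.C_eq, H_eq := S.H_eq
      two_n_lt := S.two_n_lt, n_add_k_lt := S.n_add_k_lt, M_lt := S.M_lt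
      jumps_le := S.jumps_le, cap_le := S.cap_le, N_lt := S.N_lt, B_lt := S.B_lt
      inp_one := by simp only [G']; rw [Function.update_of_ne (by omega), S.inp_one]
      inp_cnt := fun i hi => by
        simp only [G']; rw [Function.update_of_ne (by omega), S.inp_cnt i hi]
      inp_xs := fun e he => by
        simp only [G']; rw [Function.update_of_ne (by omega), S.inp_xs e he] }
  have h5 : Represents G' (Function.update m' 0 G.H) σ.arr := by
    refine ⟨fun a ha => ?_, fun q hq i hi => ?_⟩
    · simp only [G', Function.update_apply]
      split_ifs
      · rfl
      · exact h3.1 a ha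
    · rw [Function.update_of_ne (by change G.H + _ ≠ 0; omega)]
      exact h3.2 q hq i hi
  obtain ⟨T', hT', σ', h6, h7⟩ := query_does S' (by simp [G'])
    (σ := ⟨(queryState m' i x).regs, σ.arr⟩) (i := i) (x := x) hU hL hi hx
    (by simp [queryState]) (by simp [queryState])
  have h8 := Run.exec_readonly (G := G') (cells := cells) hc hW hH h6 (queryCmd_arrs tt) h5
  rw [S'.C_eq] at h8
  exact ⟨T', hT', _, h8, h7, rfl⟩

end PISNS

namespace PISNS

open WordRAM

/-! ## The family of an instance -/

/-- The number of elements of the first `i` lists. -/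
def offset (Ls : List (List ℕ)) (i : ℕ) : ℕ := ∑ j ∈ Finset.range i, (Ls.getD j []).length

theorem offset_mono (Ls : List (List ℕ)) : Monotone (offset Ls) := fun _ _ h =>
  Finset.sum_le_sum_of_subset (Finset.range_mono h)

theorem offset_succ (Ls : List (List ℕ)) (i : ℕ) :
    offset Ls (i + 1) = offset Ls i + (Ls.getD i []).length := Finset.sum_range_succ _ _

theorem offset_cons_succ (l : List ℕ) (Ls : List (List ℕ)) (i : ℕ) :
    offset (l :: Ls) (i + 1) = l.length + offset Ls i := by
  rw [offset, Finset.sum_range_succ', add_comm]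
  rfl

theorem offset_length (Ls : List (List ℕ)) : offset Ls Ls.length = Ls.flatten.length := by
  induction Ls with
  | nil => rfl
  | cons l Ls ih => simp [offset_cons_succ, ih]

theorem getD_flatten (Ls : List (List ℕ)) {i r : ℕ} (hr : r < (Ls.getD i []).length) :
    Ls.flatten.getD (offset Ls i + r) 0 = (Ls.getD i []).getD r 0 := by
  induction Ls generalizing i with
  | nil => simp at hr
  | cons l Ls ih =>
    cases i with
    | zero =>
      simp only [List.getD_cons_zero] at hr ⊢
      rw [show offset (l :: Ls) 0 = 0 from rfl, Nat.zero_add, List.flatten_cons,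
        List.getD_append _ _ _ _ hr]
    | succ i =>
      rw [offset_cons_succ, List.flatten_cons, List.getD_append_right _ _ _ _ (by omega),
        show l.length + offset Ls i + r - l.length = offset Ls i + r by omega]
      exact ih hr

/-- The list that contains the element at position `e` of the concatenation. -/
def owner (Ls : List (List ℕ)) (e : ℕ) : ℕ := Nat.findGreatest (fun i => offset Ls i ≤ e) Ls.length

theorem owner_eq_iff {Ls : List (List ℕ)} {e i : ℕ} (hi : i < Ls.length) :
    owner Ls e = i ↔ offset Ls i ≤ e ∧ e < offset Ls (i + 1) := by
  rw [owner, Nat.findGreatest_eq_iff]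
  constructor
  · rintro ⟨-, h1, h2⟩
    refine ⟨?_, not_le.1 (h2 (Nat.lt_succ_self i) hi)⟩
    rcases Nat.eq_zero_or_pos i with rfl | h
    · exact Nat.zero_le _
    · exact h1 (by omega)
  · rintro ⟨h1, h2⟩
    exact ⟨hi.le, fun _ => h1, fun j hj _ h =>
      absurd (offset_mono Ls (show i + 1 ≤ j from hj)) (by omega)⟩

theorem owner_lt {Ls : List (List ℕ)} {e : ℕ} (he : e < Ls.flatten.length) :
    owner Ls e < Ls.length := by
  have hne : Ls.length ≠ 0 := fun h => by
    rw [List.length_eq_zero_iff] at h; simp [h] at he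
  refine lt_of_le_of_ne (Nat.findGreatest_le _) fun h => ?_
  have := ((Nat.findGreatest_eq_iff (P := fun i => offset Ls i ≤ e)).1 h).2.1 hne
  rw [offset_length] at this
  omega

/-- An element is the member of its list at the remaining position. -/
theorem exists_position {Ls : List (List ℕ)} {e : ℕ} (he : e < Ls.flatten.length) :
    ∃ r < (Ls.getD (owner Ls e) []).length, e = offset Ls (owner Ls e) + r ∧
      Ls.flatten.getD e 0 = (Ls.getD (owner Ls e) []).getD r 0 := by
  obtain ⟨h1, h2⟩ := (owner_eq_iff (owner_lt he)).1 rfl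
  rw [offset_succ] at h2
  obtain ⟨r, hr⟩ := Nat.exists_eq_add_of_le h1
  generalize owner Ls e = i at *
  subst hr
  exact ⟨r, by omega, rfl, getD_flatten Ls (by omega)⟩

theorem getD_mem {l : List ℕ} {r : ℕ} (h : r < l.length) : l.getD r 0 ∈ l := by
  rw [List.getD_eq_getElem _ _ h]
  exact List.getElem_mem h

theorem mem_getD_iff {Ls : List (List ℕ)} {i : ℕ} (hi : i < Ls.length) (x : ℕ) :
    x ∈ Ls.getD i [] ↔
      ∃ e < Ls.flatten.length, owner Ls e = i ∧ Ls.flatten.getD e 0 = x := by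
  constructor
  · intro h
    obtain ⟨r, hr, rfl⟩ := List.getElem_of_mem h
    have h1 := offset_mono Ls (show i + 1 ≤ Ls.length from hi)
    rw [offset_succ, offset_length] at h1
    refine ⟨offset Ls i + r, by omega, (owner_eq_iff hi).2 ⟨by omega, ?_⟩, ?_⟩
    · rw [offset_succ]; omega
    · rw [getD_flatten Ls hr, List.getD_eq_getElem _ _ hr]
  · rintro ⟨e, he, rfl, rfl⟩
    obtain ⟨r, hr, -, h⟩ := exists_position he
    rw [h]
    exact getD_mem hr

/-- Since `y ∈ S b`, the threshold of `b` is at most `y ≤ x`, and by monotonicity so are the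
thresholds of all earlier sets. Hence `x` is passed on from each set to the next, from `a` up to
`b`. -/
theorem mem_of_shrinking {k N : ℕ} {S : Fin k → Finset ℕ} (hI : IsInstance N S) {a b i : Fin k}
    (hai : a ≤ i) (hib : i ≤ b) {x y : ℕ} (hx : x ∈ S a) (hy : y ∈ S b) (hyx : y ≤ x) :
    x ∈ S i := by
  obtain ⟨n, hn, -, h2, h3⟩ := hI.shrinking
  have hxN := (Finset.mem_Icc.1 (h2 _ hx)).2
  have hyn := (Finset.mem_Icc.1 (h2 _ hy)).1
  have key : ∀ m (h : a.1 + m < k), a.1 + m ≤ b.1 → x ∈ S ⟨a.1 + m, h⟩ := by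
    intro m
    induction m with
    | zero => exact fun _ _ => hx
    | succ m ih =>
      intro h hb
      refine h3 ⟨a.1 + m, by omega⟩ _ rfl (Finset.mem_inter.2 ⟨ih (by omega) (by omega),
        Finset.mem_Icc.2 ⟨?_, hxN⟩⟩)
      have : n ⟨a.1 + (m + 1), h⟩ ≤ n b := hn (Fin.mk_le_of_le_val hb)
      omega
  have h4 : a.1 ≤ i.1 := hai
  have h5 : i.1 ≤ b.1 := hib
  have := key (i.1 - a.1) (by omega) (by omega)
  rwa [show (⟨a.1 + (i.1 - a.1), by omega⟩ : Fin k) = i from Fin.ext (by simp; omega)] at this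

section

variable {k N : ℕ} {S : Fin k → Finset ℕ} {L : Fin k → List ℕ}

theorem getD_ofFn (i : Fin k) : (List.ofFn L).getD i [] = L i := by
  rw [List.getD_eq_getElem _ _ (by simp)]
  simp

theorem mem_set_iff (hL : Lists L S) (i : Fin k) (x : ℕ) : x ∈ S i ↔
    ∃ e < (List.ofFn L).flatten.length, owner (List.ofFn L) e = i ∧
      (List.ofFn L).flatten.getD e 0 = x := by
  rw [← (hL i).2, List.mem_toFinset, ← getD_ofFn (L := L) i, mem_getD_iff (by simp)]

/-- The family of an instance. -/
def Family.ofInstance (hI : IsInstance N S) (hL : Lists L S) {B : ℕ} (hB : 0 < B) : Family where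
  N := N
  k := k
  n := (List.ofFn L).flatten.length
  B := B
  cnt i := ((List.ofFn L).getD i []).length
  xs e := (List.ofFn L).flatten.getD e 0
  own := owner (List.ofFn L)
  B_pos := hB
  k_pos := hI.pos
  cnt_pos i hi := by
    rw [getD_ofFn ⟨i, hi⟩, ← List.toFinset_card_of_nodup (hL _).1, (hL _).2]
    exact Finset.card_pos.2 (hI.nonempty _)
  sum_cnt := by
    have := offset_length (List.ofFn L)
    rwa [List.length_ofFn] at this
  own_lt e he := by simpa using owner_lt he
  own_iff e _ i hi := owner_eq_iff (by simpa using hi)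
  xs_le e he := by
    have hi : owner (List.ofFn L) e < k := by simpa using owner_lt he
    obtain ⟨n, -, -, h2, -⟩ := hI.shrinking
    exact (Finset.mem_Icc.1 (h2 ⟨_, hi⟩ ((mem_set_iff hL _ _).2 ⟨e, he, rfl, rfl⟩))).2
  inj e he e' he' h1 h2 := by
    have hi : owner (List.ofFn L) e < k := by simpa using owner_lt he
    obtain ⟨r, hr, h3, h4⟩ := exists_position he
    obtain ⟨r', hr', h5, h6⟩ := exists_position he'
    rw [h4, h6, ← h1] at h2
    rw [← h1] at hr' h5
    rw [h3, h5]
    rw [List.getD_eq_getElem _ _ hr, List.getD_eq_getElem _ _ hr'] at h2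
    have hnd : ((List.ofFn L).getD (owner (List.ofFn L) e) []).Nodup :=
      getD_ofFn ⟨_, hi⟩ ▸ (hL _).1
    rw [(hnd.getElem_inj_iff).1 h2]
  nest e he e' he' i h1 h2 h3 := by
    have hi : owner (List.ofFn L) e' < k := by simpa using owner_lt he'
    exact (mem_set_iff hL ⟨i, by omega⟩ _).1 (mem_of_shrinking hI
      (a := ⟨owner (List.ofFn L) e, by omega⟩) (b := ⟨owner (List.ofFn L) e', hi⟩) h1 h2
      ((mem_set_iff hL _ _).2 ⟨e, he, rfl, rfl⟩) ((mem_set_iff hL _ _).2 ⟨e', he', rfl, rfl⟩) h3)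

/-- Within one list the values are distinct, so positions may be counted instead of elements. -/
theorem Family.card_ofInstance (hI : IsInstance N S) (hL : Lists L S) {B : ℕ} (hB : 0 < B)
    (i : Fin k) (x : ℕ) :
    ((Finset.range (ofInstance hI hL hB).n).filter fun e =>
      (ofInstance hI hL hB).own e = i ∧ (ofInstance hI hL hB).xs e ≤ x).card =
      predRank (S i) x := by
  rw [predRank, ← Finset.card_image_of_injOn (f := (ofInstance hI hL hB).xs)]
  · congr 1
    ext y
    simp only [Finset.mem_image, Finset.mem_filter, Finset.mem_range, mem_set_iff hL]
    constructor
    · rintro ⟨e, ⟨h1, h2, h3⟩, rfl⟩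
      exact ⟨⟨e, h1, h2, rfl⟩, h3⟩
    · rintro ⟨⟨e, h1, h2, rfl⟩, h3⟩
      exact ⟨e, ⟨h1, h2, h3⟩, rfl⟩
  · intro e he e' he' h
    simp only [Finset.coe_filter, Finset.mem_range, Set.mem_ofPred_eq] at he he'
    exact (ofInstance hI hL hB).inj e he.1 e' he'.1 (he.2.1.trans he'.2.1.symm) h

theorem length_flatten_ofFn (hL : Lists L S) :
    (List.ofFn L).flatten.length = ∑ i, (S i).card := by
  rw [List.length_flatten, List.map_ofFn, List.sum_ofFn]
  exact Finset.sum_congr rfl fun i _ => by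
    rw [← (hL i).2, List.toFinset_card_of_nodup (hL i).1]; rfl

theorem inputWords_length : (inputWords N L).length = 2 + k + (List.ofFn L).flatten.length := by
  simp [inputWords]; omega

theorem inputWords_card {i : ℕ} (hi : i < k) :
    (inputWords N L).getD (2 + i) 0 = ((List.ofFn L).getD i []).length := by
  rw [getD_ofFn (L := L) ⟨i, hi⟩, inputWords, List.getD_append _ _ _ _ (by simp; omega), add_comm]
  simp [hi]

theorem inputWords_element (e : ℕ) :
    (inputWords N L).getD (2 + k + e) 0 = (List.ofFn L).flatten.getD e 0 := by
  rw [inputWords, List.getD_append_right _ _ _ _ (by simp; omega)]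
  congr 1
  simp
  omega

end

/-! ## The bounds -/

/-- The length of the arrays. -/
def Family.width (D : Family) : ℕ := 2 * D.n + D.k + 1 + (D.M + 2) * (D.k.size + 1)

/-- The block length contains one factor `W` more than the target `W ^ p`; it absorbs the row length
`k.size ≤ W` of the jump table. The remaining terms are `O(n)` because `1 ≤ k ≤ n`. -/
theorem Family.width_le {D : Family} {W p : ℕ} (hB : D.B = W ^ (p + 1)) (hW : 0 < W)
    (hs : D.k.size ≤ W) : D.width ≤ 10 * (D.N / W ^ p + D.n) := by
  have h1 := D.k_le_n
  have h2 := D.k_pos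
  have h3 : D.k.size ≤ D.k := Nat.size_le.2 Nat.lt_two_pow_self
  have h4 : D.N / D.B * W ≤ D.N / W ^ p := by
    rw [hB, pow_succ, ← Nat.div_div_eq_div_mul]
    exact Nat.div_mul_le_self _ _
  have h5 : D.N / D.B * (D.k.size + 1) ≤ D.N / D.B * (2 * W) := Nat.mul_le_mul_left _ (by omega)
  have h6 : D.width = 2 * D.n + D.k + 1 + (D.N / D.B * (D.k.size + 1) + 3 * (D.k.size + 1)) := by
    rw [width, M]; ring
  have h7 : D.N / D.B * (2 * W) = 2 * (D.N / D.B * W) := by ring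
  omega

/-- Ensures that the block length fits into a word once the word size is large. -/
theorem exists_pow_lt_two_pow (m : ℕ) : ∃ W₀, ∀ W ≥ W₀, W ^ m < 2 ^ W := by
  have h := (tendsto_pow_const_div_const_pow_of_one_lt m (one_lt_two (α := ℝ))).eventually_lt_const
    one_pos
  obtain ⟨W₀, h⟩ := Filter.eventually_atTop.1 h
  refine ⟨W₀, fun W hW => ?_⟩
  have := (div_lt_one (by positivity)).1 (h W hW)
  exact_mod_cast this

section

variable {k N W : ℕ} {S : Fin k → Finset ℕ}

/-- Rounding the exponent up and the quotient down only decreases the value, so bounds in integers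
suffice. -/
theorem le_bound {t : ℝ} (hW : 0 < W) :
    ((N / W ^ ⌈t⌉₊ + ∑ i, (S i).card : ℕ) : ℝ) ≤ bound t W N S := by
  have hW1 : (1 : ℝ) ≤ W := by exact_mod_cast hW
  rw [bound]
  push_cast
  gcongr
  refine Nat.cast_div_le.trans ?_
  push_cast
  rw [← Real.rpow_natCast]
  gcongr
  exact Nat.le_ceil t

/-- Keeps the memory within the `2 ^ W` addressable cells. -/
theorem bound_le {t : ℝ} (ht : 1 ≤ t) (hW : 0 < W) :
    bound t W N S ≤ ((N + ∑ i, (S i).card : ℕ) : ℝ) := by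
  have hW1 : (1 : ℝ) ≤ W := by exact_mod_cast hW
  rw [bound]
  push_cast
  gcongr
  exact div_le_self (Nat.cast_nonneg N) (Real.one_le_rpow hW1 (by linarith))

end

end PISNS

/-! ### The programs and the constant for a given exponent -/

theorem mainTheorem4 (t : ℝ) (ht : 1 ≤ t) :
    ∃ (preproc query : WordRAM.Stmt) (c : ℕ),
      ∀ (W N k : ℕ) (S : Fin k → Finset ℕ) (L : Fin k → List ℕ),
        PISNS.IsInstance N S → PISNS.Lists L S →
        c * (N + ∑ i, (S i).card) ≤ 2 ^ W →
        ∃ (T : ℕ) (σ : WordRAM.State),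
          WordRAM.Exec W ⌊(c : ℝ) * PISNS.bound t W N S⌋₊ preproc
              (PISNS.inputState N L) T σ ∧
          (T : ℝ) ≤ (c : ℝ) * PISNS.bound t W N S ∧
          ∀ (i : Fin k) (x : ℕ), 1 ≤ x → x ≤ N →
            ∃ (T' : ℕ) (σ' : WordRAM.State),
              WordRAM.Exec W ⌊(c : ℝ) * PISNS.bound t W N S⌋₊ query
                  (PISNS.queryState σ.mem i x) T' σ' ∧
              T' ≤ c ∧
              σ'.regs 0 = PISNS.predRank (S i) x ∧
              σ'.mem = σ.mem := by
  open PISNS WordRAM in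
  obtain ⟨W₀, hW₀⟩ := exists_pow_lt_two_pow (⌈t⌉₊ + 1)
  set tt := ⌈t⌉₊ + 1 with htt
  -- With `Z = N / W ^ ⌈t⌉₊ + ∑ |S_i|`, the input takes at most `4 * Z` cells and an array at most
  -- `10 * Z`. Then `244 = 4 + 14 * 10 + 100` prevents overflow, the second bound covers the memory,
  -- the third and fourth the running times, and the last forces a large word size.
  obtain ⟨c, hc1, hc2, hc3, hc4, hc5⟩ : ∃ c, 244 ≤ c ∧ 4 + (14 + 2 * tt) * 10 ≤ c ∧
      preprocCost tt * 10 + 3 ≤ c ∧ (queryCmd tt).cost ≤ c ∧ 2 ^ (W₀ + 1) ≤ c :=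
    ⟨244 + (4 + (14 + 2 * tt) * 10 + (preprocCost tt * 10 + 3 + ((queryCmd tt).cost +
      2 ^ (W₀ + 1)))), Nat.le_add_right _ _, Nat.le_add_left_of_le (Nat.le_add_right _ _),
      Nat.le_add_left_of_le (Nat.le_add_left_of_le (Nat.le_add_right _ _)),
      Nat.le_add_left_of_le (Nat.le_add_left_of_le (Nat.le_add_left_of_le (Nat.le_add_right _ _))),
      Nat.le_add_left_of_le (Nat.le_add_left_of_le (Nat.le_add_left_of_le (Nat.le_add_left _ _)))⟩
  refine ⟨preprocStmt tt, queryStmt tt, c, fun W N k S L hI hL hcap => ?_⟩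
  have hn : 1 ≤ ∑ i, (S i).card :=
    (Finset.card_pos.2 (hI.nonempty ⟨0, hI.pos⟩)).trans_le
      (Finset.single_le_sum (f := fun i => (S i).card) (fun _ _ => Nat.zero_le _)
        (Finset.mem_univ _))
  have hWW : W₀ + 1 ≤ W := by
    refine (Nat.pow_le_pow_iff_right (by norm_num : 1 < 2)).1 (hc5.trans (le_trans ?_ hcap))
    exact Nat.le_mul_of_pos_right _ (by omega)
  have hBlt := hW₀ W (by omega)
  have hB : 0 < W ^ tt := Nat.pow_pos (by omega)
  set D := Family.ofInstance hI hL hB with hD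
  have hDn : D.n = ∑ i, (S i).card := length_flatten_ofFn hL
  have hDk : D.k = k := rfl
  have hDN : D.N = N := rfl
  have hkn := D.k_le_n
  have hkp := D.k_pos
  have hsmall : 244 * (N + ∑ i, (S i).card) ≤ 2 ^ W := (Nat.mul_le_mul_right _ hc1).trans hcap
  have hwidth := Family.width_le (D := D) (W := W) (p := ⌈t⌉₊) rfl (by omega)
    (Nat.size_le.2 (by omega))
  have hdiv : N / W ^ ⌈t⌉₊ ≤ N := Nat.div_le_self _ _
  rw [hDN, hDn] at hwidth
  set Z := N / W ^ ⌈t⌉₊ + ∑ i, (S i).card with hZ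
  have hnZ : ∑ i, (S i).card ≤ Z := Nat.le_add_left _ _
  let G : Layout := ⟨W, 2 + k + D.n, 14 + 2 * tt, D.width, fun a => (inputWords N L).getD a 0⟩
  have hM : D.M + 2 ≤ (D.M + 2) * (D.k.size + 1) := Nat.le_mul_of_pos_right _ (by omega)
  have hMs : (D.M + 1) * (D.k.size + 1) ≤ (D.M + 2) * (D.k.size + 1) :=
    Nat.mul_le_mul_right _ (by omega)
  have hMs' : (D.M + 1) * D.k.size ≤ (D.M + 2) * (D.k.size + 1) :=
    Nat.mul_le_mul (by omega) (by omega)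
  have hwd : D.width = 2 * D.n + D.k + 1 + (D.M + 2) * (D.k.size + 1) := rfl
  have St : Setting D G tt :=
    { B_eq := rfl
      W_pos := by simp only [G]; omega
      tt_pos := by omega
      C_eq := rfl
      H_eq := rfl
      two_n_lt := by simp only [G]; omega
      n_add_k_lt := by simp only [G]; omega
      M_lt := by simp only [G]; omega
      jumps_le := by simp only [G]; omega
      cap_le := by simp only [G, cap]; omega
      N_lt := by simp only [G, cap]; omega
      B_lt := hBlt
      inp_one := rfl
      inp_cnt := fun i hi => inputWords_card hi
      inp_xs := fun e _ => inputWords_element e }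
  have hZb : (c : ℝ) * (Z : ℝ) ≤ c * bound t W N S :=
    mul_le_mul_of_nonneg_left (le_bound (by omega)) (Nat.cast_nonneg c)
  have hcells : c * Z ≤ ⌊(c : ℝ) * bound t W N S⌋₊ := Nat.le_floor (by exact_mod_cast hZb)
  have hcw : (14 + 2 * tt) * D.width ≤ (14 + 2 * tt) * 10 * Z := by
    rw [mul_assoc]; exact Nat.mul_le_mul_left _ hwidth
  have hc2' := Nat.mul_le_mul_right Z hc2
  obtain ⟨T, hT, σ, h1, h2⟩ := programs_exec St rfl (cells := ⌊(c : ℝ) * bound t W N S⌋₊)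
    (m := fun a => (inputWords N L).getD a 0)
    (by
      rw [add_mul] at hc2'
      have h0 : 2 + k + D.n ≤ 4 * Z := by omega
      exact (Nat.add_le_add h0 hcw).trans (hc2'.trans hcells))
    (by
      refine Nat.floor_le_of_le ((mul_le_mul_of_nonneg_left (bound_le ht (by omega))
        (Nat.cast_nonneg c)).trans ?_)
      exact_mod_cast hcap)
    (fun _ _ => rfl)
    (fun a ha => List.getD_eq_default _ _ (by rw [inputWords_length]; exact ha))
  refine ⟨T, σ, h1, ?_, fun i x _ hx => ?_⟩
  · refine le_trans ?_ hZb
    have h3 : preprocCost tt * ((D.M + 1) * (D.k.size + 1) + D.n + D.k) ≤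
        preprocCost tt * 10 * Z := by
      rw [mul_assoc]; exact Nat.mul_le_mul_left _ (by omega)
    have h4 := Nat.mul_le_mul_right Z hc3
    rw [add_mul] at h4
    have h5 : T ≤ c * Z := by omega
    exact_mod_cast h5
  · obtain ⟨T', hT', σ', h3, h4, h5⟩ := h2 i i.2 x hx
    exact ⟨T', σ', h3, hT'.trans hc4, h4.trans (Family.card_ofInstance hI hL hB i x), h5⟩
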